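/- **Theorem 2.7.** *Setting.* Let $(\Omega,\mathcal F,\mathbb P)$ be a probability space, $H:\mathbb R^d\times\mathbb R^q\to\mathbb R^d$ a Borel function, and $U$, $(U^n)_{n\ge1}$ random vectors in $\mathbb R^q$. Set $h(\theta)=\mathbb E[H(\theta,U)]$, $h^n(\theta)=\mathbb E[H(\theta,U^n)]$, let $Dh$, $Dh^n$ be the Jacobian matrices, and $\Gamma(\theta)=\mathbb E[H(\theta,U)H(\theta,U)^T]$. Let $h(\theta^*)=0$ and $h^n(\theta^{*,n})=0$, and suppose the following. * $\langle\theta-\theta^*,h(\theta)\rangle>0$ for $\theta\ne\theta^*$ and $\langle\theta-\theta^{*,n},h^n(\theta)\rangle>0$ for $\theta\neq\theta^{*,n}$, $n\ge1$. * $h$ is $C^1$ on $\mathbb R^d$ and $C^2$ in a neighborhood of $\theta^*$; each $h^n$ is $C^2$, with $Dh^n$ Lipschitz continuous uniformly in $n$; $h^n\to h$ and $Dh^n\to Dh$ locally uniformly. * All eigenvalues of $Dh(\theta^*)$ have strictly positive real part, and for some $\varepsilon>0$ the function $\theta\mapsto\mathbb E|H(\theta,U)|^{2+\varepsilon}$ is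 locally bounded. * For some $\alpha>0$ and every $\theta\in\mathbb R^d$, $n^\alpha(h^n(\theta)-h(\theta))\to\mathcal E(h,\alpha,\theta)$ as $n\to\infty$. * (HR) There is $b\in(0,1]$ with $\sup_{n\ge1,\,\theta\ne\theta'}\mathbb E|H(\theta,U^n)-H(\theta',U^n)|^2/|\theta-\theta'|^{2b}<\infty$. * (HI) There is $\delta>0$ with $\sup_{|\theta|\le R,\,n\ge1}\mathbb E|H(\theta,U^n)|^{2+\delta}<\infty$ for all $R>0$; $\theta\mapsto\mathbb E[H(\theta,U^n)H(\theta,U^n)^T]$ converges locally uniformly to $\Gamma$; $\Gamma$ is continuous and $\Gamma(\theta^*)$ is positive definite. * (HMR) There is $\underline\lambda>0$ such that $\langle\theta-\theta^{*,n},h^n(\theta)\rangle\ge\underline\lambda|\theta-\theta^{*,n}|^2$ for all $n\ge1$, $\theta\in\mathbb R^d$. * The steps are $\gamma_p=\gamma(p)$, $p\ge1$, where $\gamma$ is a positive decreasing function on $[0,\infty)$ tending to $0$, with $\sum_{p\ge1}\gamma_p=\infty$ and $\sum_{p\ge1}\gamma_p^2<\infty$, and one of the following holds: (HS1) for some $a\in[0,1)$,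 $\lim_{t\to\infty}\gamma(tx)/\gamma(t)=x^{-a}$ for all $x>0$; in this case put $\zeta=0$; (HS2) for some $\gamma_0>0$ with $2\underline\lambda\gamma_0>1$, $\gamma(t)=\gamma_0/t$ for all $t\ge1$; in this case put $\zeta=1/(2\gamma_0)$. For each $n$ let $((U^n)^p)_{p\ge1}$ be i.i.d. with the law of $U^n$, let $\theta^n_0$ be independent of this sequence, with $\sup_n\mathbb E|\theta_0^n|^2<\infty$, and let $$\theta^n_{p+1}=\theta^n_p-\gamma_{p+1}H(\theta^n_p,(U^n)^{p+1}),\qquad p\ge0.$$ Let $\gamma^{-1}(y)=\inf\{t\ge0:\gamma(t)\le y\}$ (the usual inverse if $\gamma$ is invertible), and let $M_n$ be $\gamma^{-1}(1/n^{2\alpha})$ rounded up or down to an integer, i.e. $M_n\in\mathbb N$ and $|M_n-\gamma^{-1}(1/n^{2\alpha})|<1$. *Conclusion.* $Dh(\theta^*)$ is invertible; with $B=Dh(\theta^*)-\zeta I_d$ the integral $$\Sigma^*:=\int_0^\infty \exp(-sB)\,\Gamma(\theta^*)\,\exp(-sB)^T\,ds$$ converges absolutely (entrywise); $\Sigma^*$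 is positive definite and is the unique matrix $S\in\mathbb R^{d\times d}$ solving the Lyapunov equation $\Gamma(\theta^*)-BS-SB^T=0$; and, as $n\to\infty$, $$n^\alpha\left(\theta^n_{M_n}-\theta^*\right)\Longrightarrow -Dh(\theta^*)^{-1}\mathcal E(h,\alpha,\theta^*)+\mathcal N(0,\Sigma^*)\quad\text{in law.}$$ -/

import Mathlib

open MeasureTheory ProbabilityTheory Filter Topology Set
open scoped NNReal ENNReal

/-- The Euclidean space `ℝ^d` (column vectors). -/
abbrev Vec (d : ℕ) : Type := EuclideanSpace ℝ (Fin d)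

/-- The mean field `θ ↦ E[H(θ, X)]`. -/
noncomputable def meanField {d q : ℕ} {Ω : Type*} [MeasurableSpace Ω] (P : Measure Ω)
    (H : Vec d → Vec q → Vec d) (X : Ω → Vec q) (θ : Vec d) : Vec d :=
  ∫ ω, H θ (X ω) ∂P

/-- The second moment matrix `θ ↦ E[H(θ, X) H(θ, X)ᵀ]`. -/
noncomputable def secondMoment {d q : ℕ} {Ω : Type*} [MeasurableSpace Ω] (P : Measure Ω)
    (H : Vec d → Vec q → Vec d) (X : Ω → Vec q) (θ : Vec d) : Matrix (Fin d) (Fin d) ℝ :=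
  Matrix.of fun i j => ∫ ω, H θ (X ω) i * H θ (X ω) j ∂P

/-- The Jacobian matrix of `f` at `θ`: the matrix of the Fréchet derivative in the canonical
basis. -/
noncomputable def jacobian {d : ℕ} (f : Vec d → Vec d) (θ : Vec d) : Matrix (Fin d) (Fin d) ℝ :=
  (Matrix.toEuclideanCLM (n := Fin d) (𝕜 := ℝ)).symm (fderiv ℝ f θ)

/-- The entries of the Jacobian matrix are the partial derivatives. -/
theorem jacobian_apply {d : ℕ} (f : Vec d → Vec d) (θ : Vec d) (i j : Fin d) :
    jacobian f θ i j = fderiv ℝ f θ (EuclideanSpace.single j 1) i := by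
  have h : Matrix.toEuclideanCLM (n := Fin d) (𝕜 := ℝ) (jacobian f θ) = fderiv ℝ f θ := by
    simp [jacobian]
  rw [← h]
  simp

/-- All (complex) eigenvalues of the real matrix `A` have strictly positive real part. -/
def IsStableMatrix {d : ℕ} (A : Matrix (Fin d) (Fin d) ℝ) : Prop :=
  ∀ z ∈ spectrum ℂ (A.map (fun x : ℝ => (x : ℂ))), 0 < z.re

/-- The stochastic approximation scheme
`θ_{p+1} = θ_p - γ(p+1) H(θ_p, ξ_{p+1})` started from `θ₀`. The sequence of innovations is indexed
from `0`: `ξ p` is the innovation used to go from time `p` to time `p + 1`. -/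
noncomputable def saScheme {d q : ℕ} {Ω : Type*} (γ : ℝ → ℝ) (H : Vec d → Vec q → Vec d)
    (θ₀ : Ω → Vec d) (ξ : ℕ → Ω → Vec q) : ℕ → Ω → Vec d
  | 0 => θ₀
  | p + 1 => fun ω =>
      saScheme γ H θ₀ ξ p ω - γ ((p : ℝ) + 1) • H (saScheme γ H θ₀ ξ p ω) (ξ p ω)

/-- The mean-reverting property of `f` with respect to the point `θs`. -/
def MeanReverting {d : ℕ} (f : Vec d → Vec d) (θs : Vec d) : Prop :=
  ∀ θ : Vec d, θ ≠ θs → 0 < inner ℝ (θ - θs) (f θ)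

/-- `H` is Hölder continuous in `θ` in quadratic mean, uniformly in `n`. -/
def HolderInMean {d q : ℕ} {Ω : Type*} [MeasurableSpace Ω] (P : Measure Ω)
    (H : Vec d → Vec q → Vec d) (Un : ℕ+ → Ω → Vec q) : Prop :=
  ∃ b : ℝ, 0 < b ∧ b ≤ 1 ∧ ∃ C : ℝ≥0, ∀ (n : ℕ+) (θ θ' : Vec d),
    ∫⁻ ω, ‖H θ (Un n ω) - H θ' (Un n ω)‖ₑ ^ (2 : ℝ) ∂P ≤ C * ‖θ - θ'‖ₑ ^ (2 * b)

/-- Uniform moments of order `2 + δ`, locally uniform convergence of the second moment matrices,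
continuity of the limit, and its positive definiteness at `θs`. -/
def InnovationRegularity {d q : ℕ} {Ω : Type*} [MeasurableSpace Ω] (P : Measure Ω)
    (H : Vec d → Vec q → Vec d) (U : Ω → Vec q) (Un : ℕ+ → Ω → Vec q) (θs : Vec d) : Prop :=
  (∃ δ : ℝ, 0 < δ ∧ ∀ R : ℝ, 0 < R → ∃ C : ℝ≥0, ∀ (n : ℕ+) (θ : Vec d), ‖θ‖ ≤ R →
      ∫⁻ ω, ‖H θ (Un n ω)‖ₑ ^ (2 + δ) ∂P ≤ C) ∧
  (∀ i j, TendstoLocallyUniformly (fun (n : ℕ+) θ => secondMoment P H (Un n) θ i j)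
      (fun θ => secondMoment P H U θ i j) atTop) ∧
  Continuous (secondMoment P H U) ∧
  (secondMoment P H U θs).PosDef

/-- `θ ↦ E[|H(θ, U)|^{2+ε}]` is (finite and) locally bounded for some `ε > 0`. -/
def LocallyBoundedMoment {d q : ℕ} {Ω : Type*} [MeasurableSpace Ω] (P : Measure Ω)
    (H : Vec d → Vec q → Vec d) (U : Ω → Vec q) : Prop :=
  ∃ ε : ℝ, 0 < ε ∧ ∀ θ₁ : Vec d, ∃ C : ℝ≥0, ∀ᶠ θ in 𝓝 θ₁,
    ∫⁻ ω, ‖H θ (U ω)‖ₑ ^ (2 + ε) ∂P ≤ C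

/-- `γ` varies regularly (at `+∞`) with exponent `-a` for some `a ∈ [0, 1)`. -/
def RegularlyVaryingStep (γ : ℝ → ℝ) : Prop :=
  ∃ a : ℝ, 0 ≤ a ∧ a < 1 ∧
    ∀ x : ℝ, 0 < x → Tendsto (fun t => γ (t * x) / γ t) atTop (𝓝 (x ^ (-a)))

/-- `γ(t) = γ₀ / t` for `t ≥ 1`, with `2 lam γ₀ > 1`. -/
def HarmonicStep (γ : ℝ → ℝ) (lam γ₀ : ℝ) : Prop :=
  0 < γ₀ ∧ (∀ t : ℝ, 1 ≤ t → γ t = γ₀ / t) ∧ 1 < 2 * lam * γ₀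

/-- The inverse `γ⁻¹(y) = inf {t ≥ 0 : γ(t) ≤ y}` of a decreasing function on `[0, ∞)`. -/
noncomputable def stepInverse (γ : ℝ → ℝ) (y : ℝ) : ℝ :=
  sInf {t : ℝ | 0 ≤ t ∧ γ t ≤ y}

/-- For a strictly decreasing function, `stepInverse` is the usual inverse. -/
theorem stepInverse_apply {γ : ℝ → ℝ} (hγ : StrictAntiOn γ (Ici 0)) {t : ℝ} (ht : 0 ≤ t) :
    stepInverse γ (γ t) = t := by
  have : {s : ℝ | 0 ≤ s ∧ γ s ≤ γ t} = Ici t := by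
    ext s
    constructor
    · rintro ⟨hs, hst⟩
      exact (hγ.le_iff_ge hs ht).1 hst
    · intro hs
      have hs0 : 0 ≤ s := ht.trans hs
      exact ⟨hs0, (hγ.le_iff_ge hs0 ht).2 hs⟩
  rw [stepInverse, this, csInf_Ici]

/-- The integrand `exp(-s B) Γ exp(-s B)ᵀ`. -/
noncomputable def covIntegrand {d : ℕ} (B Γ : Matrix (Fin d) (Fin d) ℝ) (s : ℝ) :
    Matrix (Fin d) (Fin d) ℝ :=
  NormedSpace.exp (-(s • B)) * Γ * (NormedSpace.exp (-(s • B))).transpose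

/-- The matrix `∫₀^∞ exp(-s B) Γ exp(-s B)ᵀ ds` (entrywise integral). -/
noncomputable def asymptoticCov {d : ℕ} (B Γ : Matrix (Fin d) (Fin d) ℝ) :
    Matrix (Fin d) (Fin d) ℝ :=
  Matrix.of fun i j => ∫ s in Ioi (0 : ℝ), covIntegrand B Γ s i j

/-!
The central limit theorem is proved by following characteristic functions along the recursion,
without a martingale central limit theorem.

Let `Z_p = θ^n_p - θ^{*,n}` be the error with respect to the zero of the approximate mean field
`h^n` and let `A = Dh(θ^*)`. Strong mean reversion of the `h^n` with constant `lam` passes to the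
limit and gives `⟪v, A v⟫ ≥ lam ‖v‖²` (`coercive_of_reverting`). Hence `A` is invertible,
`B = A - ζ` is coercive (`ζ < lam`), `exp(-sB)` decays exponentially, and everything about the
Lyapunov equation follows from the fundamental theorem of calculus (`asymptoticCov_lyapunov`).

The errors are normalized by a gauge `c_p` (`IsStepGauge`), a sequence equivalent to the steps with
`c_p / c_{p+1} = 1 + 2 ζ γ_{p+1} + o(γ_{p+1})`. The steps themselves need not satisfy this, since
the increments of a decreasing regularly varying function are not controlled; but its average over
the window `[t, 2t]` does (`isStepGauge_of_regularlyVarying`). The recursion for the mean squared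
error gives `E‖Z_p‖² ≤ C c_p` uniformly in `n` (`IsStepGauge.exists_forall_le_mul_gauge`).

Let `φ_p(u) = E exp(i ⟪Z_p, u⟫ / √c_p)`. Conditioning on `Z_p`, linearizing `h^n` and expanding the
characteristic function of the innovation to second order give
`φ_{p+1}(u) = (1 - γ_{p+1}² ⟪u, Γ u⟫ / (2 c_{p+1})) φ_p(u') + o(γ_{p+1}) ‖u‖`, where
`u' = √(c_p / c_{p+1}) (u - γ_{p+1} Aᵀ u)` (`IsAdmissible`, `norm_charFun_step_sub_le`,
`eventually_norm_charFun_innovation_le`). By the Lyapunov equation the characteristic function of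
`N(0, Σ^*)` satisfies the same recursion up to `o(γ_{p+1}) ‖u‖` (`exists_gaussian_step_error`). As
`‖u'‖ ≤ (1 - κ γ_{p+1}) ‖u‖` with `κ = (lam - ζ) / 2 > 0`, the difference of the two functions,
measured by the best constant `x_p` in a bound `x_p ‖u‖` on a fixed ball, satisfies
`x_{p+1} ≤ (1 - κ γ_{p+1}) x_p + o(γ_{p+1})`, hence tends to `0` since the steps are not summable
(`charFun_tendsto_of_recursion`). All estimates are uniform in large `n`, so `p = M_n` is allowed.

Finally `n^{2α} c_{M_n} → 1` (`tendsto_gauge_div_of_stepInverse`), the linearization of `h^n` at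
`θ^{*,n}` turns the expansion of `h^n(θ^*)` into `n^α (θ^{*,n} - θ^*) → -A⁻¹ E(θ^*)`
(`tendsto_smul_clm_sub_of_linearization`), and Lévy's continuity theorem concludes.
-/

/-! ### The Lyapunov equation -/

section Lyapunov
open scoped Matrix.Norms.L2Operator Matrix

variable {d : ℕ}

theorem hasDerivAt_exp_neg_smul (B : Matrix (Fin d) (Fin d) ℝ) (s : ℝ) :
    HasDerivAt (fun s : ℝ => NormedSpace.exp (-(s • B))) (-(B * NormedSpace.exp (-(s • B)))) s := by
  have h := hasDerivAt_exp_smul_const' (𝕂 := ℝ) (-B) s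
  simpa using h

theorem commute_exp_neg_smul (B : Matrix (Fin d) (Fin d) ℝ) (s : ℝ) :
    B * NormedSpace.exp (-(s • B)) = NormedSpace.exp (-(s • B)) * B := by
  have : Commute B (-(s • B)) := ((Commute.refl B).smul_right s).neg_right
  exact this.exp_right

/-- Coercivity of `B` makes `s ↦ exp(2μs) ‖exp(-sB) x‖²` antitone. -/
theorem norm_exp_neg_smul_le {B : Matrix (Fin d) (Fin d) ℝ} {μ : ℝ}
    (hB : ∀ x, μ * ‖x‖ ^ 2 ≤ inner ℝ x (Matrix.toEuclideanCLM (n := Fin d) (𝕜 := ℝ) B x))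
    {s : ℝ} (hs : 0 ≤ s) : ‖NormedSpace.exp (-(s • B))‖ ≤ Real.exp (-(μ * s)) := by
  rw [← Matrix.l2_opNorm_toEuclideanCLM]
  refine ContinuousLinearMap.opNorm_le_bound _ (Real.exp_nonneg _) fun x => ?_
  let T := (Matrix.toEuclideanCLM (n := Fin d) (𝕜 := ℝ))
  let y : ℝ → Vec d := fun s => T (NormedSpace.exp (-(s • B))) x
  have hy : ∀ s, HasDerivAt y (-(T B (y s))) s := by
    intro s
    have h1 := hasDerivAt_exp_neg_smul B s
    let L : Matrix (Fin d) (Fin d) ℝ →L[ℝ] Vec d :=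
      LinearMap.toContinuousLinearMap
        { toFun := fun M => T M x, map_add' := by simp, map_smul' := by simp }
    have h2 := L.hasFDerivAt.comp_hasDerivAt s h1
    have h3 : L (-(B * NormedSpace.exp (-(s • B)))) = -(T B (y s)) := by
      change T (-(B * NormedSpace.exp (-(s • B)))) x = _
      rw [map_neg, map_mul]
      rfl
    rw [← h3]
    exact h2
  have hφ : ∀ s, HasDerivAt (fun s => Real.exp (2 * μ * s) * ‖y s‖ ^ 2)
      (Real.exp (2 * μ * s) * (2 * (μ * ‖y s‖ ^ 2 - inner ℝ (y s) (T B (y s))))) s := by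
    intro s
    have h1 : HasDerivAt (fun s => Real.exp (2 * μ * s)) (Real.exp (2 * μ * s) * (2 * μ)) s := by
      simpa using ((hasDerivAt_id s).const_mul (2 * μ)).exp
    have h2 := h1.mul (hy s).norm_sq
    rw [inner_neg_right] at h2
    have h3 : Real.exp (2 * μ * s) * (2 * (μ * ‖y s‖ ^ 2 - inner ℝ (y s) (T B (y s))))
      = Real.exp (2 * μ * s) * (2 * μ) * ‖y s‖ ^ 2
        + Real.exp (2 * μ * s) * (2 * -inner ℝ (y s) (T B (y s))) := by ring
    rw [h3]
    exact h2
  have hanti : Antitone (fun s => Real.exp (2 * μ * s) * ‖y s‖ ^ 2) := by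
    refine antitone_of_deriv_nonpos (fun s => (hφ s).differentiableAt) fun s => ?_
    rw [(hφ s).deriv]
    have := hB (y s)
    have h3 : 2 * (μ * ‖y s‖ ^ 2 - inner ℝ (y s) (T B (y s))) ≤ 0 := by linarith
    exact mul_nonpos_of_nonneg_of_nonpos (Real.exp_nonneg _) h3
  have h0 := hanti hs
  have hy0 : y 0 = x := by simp [y, T]
  simp only [hy0, mul_zero, Real.exp_zero, one_mul] at h0
  have h4 : (Real.exp (μ * s) * ‖y s‖) ^ 2 ≤ ‖x‖ ^ 2 := by
    rw [mul_pow, ← Real.exp_nat_mul]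
    have h6 : ((2 : ℕ) : ℝ) * (μ * s) = 2 * μ * s := by push_cast; ring
    rw [h6]
    exact h0
  have h5 := (sq_le_sq₀ (by positivity) (norm_nonneg _)).1 h4
  rw [Real.exp_neg, inv_mul_eq_div, le_div_iff₀ (Real.exp_pos _), mul_comm]
  exact h5

theorem abs_apply_le_l2_opNorm (M : Matrix (Fin d) (Fin d) ℝ) (i j : Fin d) : |M i j| ≤ ‖M‖ := by
  have h := Matrix.l2_opNorm_mulVec M (EuclideanSpace.single j (1 : ℝ))
  have h3 := PiLp.norm_apply_le ((EuclideanSpace.equiv (Fin d) ℝ).symm <|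
    M *ᵥ (EuclideanSpace.single j (1 : ℝ) : Vec d)) i
  simp at h h3
  exact h3.trans h

theorem norm_covIntegrand_le {B : Matrix (Fin d) (Fin d) ℝ} {μ : ℝ}
    (hB : ∀ x, μ * ‖x‖ ^ 2 ≤ inner ℝ x (Matrix.toEuclideanCLM (n := Fin d) (𝕜 := ℝ) B x))
    (G : Matrix (Fin d) (Fin d) ℝ) {s : ℝ} (hs : 0 ≤ s) :
    ‖covIntegrand B G s‖ ≤ ‖G‖ * Real.exp (-(2 * μ) * s) := by
  have h1 := norm_exp_neg_smul_le hB hs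
  have h2 : ‖(NormedSpace.exp (-(s • B))).transpose‖ ≤ Real.exp (-(μ * s)) := by
    rw [← Matrix.conjTranspose_eq_transpose_of_trivial, Matrix.l2_opNorm_conjTranspose]
    exact h1
  calc ‖covIntegrand B G s‖ ≤ ‖NormedSpace.exp (-(s • B)) * G‖
        * ‖(NormedSpace.exp (-(s • B))).transpose‖ := norm_mul_le _ _
    _ ≤ (‖NormedSpace.exp (-(s • B))‖ * ‖G‖) * Real.exp (-(μ * s)) := by
        gcongr; exact norm_mul_le _ _
    _ ≤ (Real.exp (-(μ * s)) * ‖G‖) * Real.exp (-(μ * s)) := by gcongr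
    _ = ‖G‖ * Real.exp (-(2 * μ) * s) := by
        rw [mul_right_comm, ← Real.exp_add, mul_comm]; ring_nf

theorem hasDerivAt_covIntegrand (B G : Matrix (Fin d) (Fin d) ℝ) (s : ℝ) :
    HasDerivAt (covIntegrand B G) (-(B * covIntegrand B G s + covIntegrand B G s * Bᵀ)) s := by
  have h1 := hasDerivAt_exp_neg_smul B s
  let L : Matrix (Fin d) (Fin d) ℝ →L[ℝ] Matrix (Fin d) (Fin d) ℝ :=
    LinearMap.toContinuousLinearMap (Matrix.transposeLinearEquiv (Fin d) (Fin d) ℝ ℝ).toLinearMap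
  have h2 := L.hasFDerivAt.comp_hasDerivAt s h1
  have h3 := (h1.mul_const G).mul h2
  have h4 : -(B * covIntegrand B G s + covIntegrand B G s * Bᵀ)
      = -(B * NormedSpace.exp (-(s • B))) * G * (NormedSpace.exp (-(s • B)))ᵀ
        + NormedSpace.exp (-(s • B)) * G * (-(B * NormedSpace.exp (-(s • B))))ᵀ := by
    simp only [covIntegrand, Matrix.transpose_neg, Matrix.transpose_mul, neg_mul, mul_neg,
      mul_assoc]
    abel
  rw [h4]
  exact h3

theorem continuous_covIntegrand (B G : Matrix (Fin d) (Fin d) ℝ) :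
    Continuous (covIntegrand B G) :=
  continuous_iff_continuousAt.2 fun s => (hasDerivAt_covIntegrand B G s).continuousAt

theorem mul_covIntegrand_add (B G : Matrix (Fin d) (Fin d) ℝ) (s : ℝ) :
    B * covIntegrand B G s + covIntegrand B G s * Bᵀ = covIntegrand B (B * G + G * Bᵀ) s := by
  have h := commute_exp_neg_smul B s
  have h' := congrArg Matrix.transpose h
  rw [Matrix.transpose_mul, Matrix.transpose_mul] at h'
  simp only [covIntegrand, mul_add, add_mul]
  rw [← mul_assoc, ← mul_assoc, h, mul_assoc _ _ Bᵀ, h']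
  simp only [mul_assoc]

theorem integrableOn_covIntegrand {B : Matrix (Fin d) (Fin d) ℝ} {μ : ℝ} (hμ : 0 < μ)
    (hB : ∀ x, μ * ‖x‖ ^ 2 ≤ inner ℝ x (Matrix.toEuclideanCLM (n := Fin d) (𝕜 := ℝ) B x))
    (G : Matrix (Fin d) (Fin d) ℝ) (i j : Fin d) :
    IntegrableOn (fun s => covIntegrand B G s i j) (Ioi 0) := by
  have h1 : IntegrableOn (fun s => ‖G‖ * Real.exp (-(2 * μ) * s)) (Ioi 0) :=
    (exp_neg_integrableOn_Ioi 0 (by positivity)).const_mul _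
  refine Integrable.mono' h1 ?_ ?_
  · exact ((continuous_covIntegrand B G).matrix_elem i j).aestronglyMeasurable
  · refine (ae_restrict_iff' measurableSet_Ioi).2 (ae_of_all _ fun s hs => ?_)
    exact (abs_apply_le_l2_opNorm _ i j).trans (norm_covIntegrand_le hB G (le_of_lt hs))

theorem tendsto_covIntegrand {B : Matrix (Fin d) (Fin d) ℝ} {μ : ℝ} (hμ : 0 < μ)
    (hB : ∀ x, μ * ‖x‖ ^ 2 ≤ inner ℝ x (Matrix.toEuclideanCLM (n := Fin d) (𝕜 := ℝ) B x))
    (G : Matrix (Fin d) (Fin d) ℝ) (i j : Fin d) :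
    Tendsto (fun s => covIntegrand B G s i j) atTop (𝓝 0) := by
  have h1 : Tendsto (fun s => ‖G‖ * Real.exp (-(2 * μ) * s)) atTop (𝓝 0) := by
    rw [← mul_zero ‖G‖]
    refine Tendsto.const_mul _ (Real.tendsto_exp_atBot.comp ?_)
    exact tendsto_id.const_mul_atTop_of_neg (by linarith)
  refine squeeze_zero_norm' ?_ h1
  filter_upwards [eventually_ge_atTop 0] with s hs
  exact (abs_apply_le_l2_opNorm _ i j).trans (norm_covIntegrand_le hB G hs)

/-- The fundamental theorem of calculus for `s ↦ exp(-sB) G exp(-sB)ᵀ`, whose derivative is the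
negative of the same expression for `BG + GBᵀ`. -/
theorem asymptoticCov_lyapunov {B : Matrix (Fin d) (Fin d) ℝ} {μ : ℝ} (hμ : 0 < μ)
    (hB : ∀ x, μ * ‖x‖ ^ 2 ≤ inner ℝ x (Matrix.toEuclideanCLM (n := Fin d) (𝕜 := ℝ) B x))
    (G : Matrix (Fin d) (Fin d) ℝ) : asymptoticCov B (B * G + G * Bᵀ) = G := by
  ext i j
  have hd : ∀ s, HasDerivAt (fun s => covIntegrand B G s i j)
      (-(covIntegrand B (B * G + G * Bᵀ) s i j)) s := by
    intro s
    have h := hasDerivAt_covIntegrand B G s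
    rw [mul_covIntegrand_add] at h
    exact hasDerivAt_pi.1 (hasDerivAt_pi.1 h i) j
  have h := integral_Ioi_of_hasDerivAt_of_tendsto' (a := 0) (fun s _ => hd s)
    (integrableOn_covIntegrand hμ hB _ i j).neg (tendsto_covIntegrand hμ hB G i j)
  rw [integral_neg] at h
  have h0 : covIntegrand B G 0 i j = G i j := by simp [covIntegrand]
  simp only [asymptoticCov, Matrix.of_apply]
  linarith

theorem lyapunov_asymptoticCov {B : Matrix (Fin d) (Fin d) ℝ} {μ : ℝ} (hμ : 0 < μ)
    (hB : ∀ x, μ * ‖x‖ ^ 2 ≤ inner ℝ x (Matrix.toEuclideanCLM (n := Fin d) (𝕜 := ℝ) B x))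
    (G : Matrix (Fin d) (Fin d) ℝ) :
    B * asymptoticCov B G + asymptoticCov B G * Bᵀ = G := by
  ext i j
  have hI := integrableOn_covIntegrand hμ hB G
  conv_rhs => rw [← asymptoticCov_lyapunov hμ hB G]
  simp only [asymptoticCov, Matrix.of_apply, Matrix.add_apply, Matrix.mul_apply,
    ← mul_covIntegrand_add]
  rw [integral_add, integral_finsetSum, integral_finsetSum]
  · simp only [integral_const_mul, integral_mul_const]
  · exact fun k _ => (hI i k).mul_const _
  · exact fun k _ => (hI k j).const_mul _
  · exact integrable_finsetSum _ fun k _ => (hI k j).const_mul _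
  · exact integrable_finsetSum _ fun k _ => (hI i k).mul_const _

/-- Uniqueness is again `asymptoticCov_lyapunov`: a solution `S` is recovered from the right-hand
side `B S + S Bᵀ`. -/
theorem lyapunov_iff {B : Matrix (Fin d) (Fin d) ℝ} {μ : ℝ} (hμ : 0 < μ)
    (hB : ∀ x, μ * ‖x‖ ^ 2 ≤ inner ℝ x (Matrix.toEuclideanCLM (n := Fin d) (𝕜 := ℝ) B x))
    (G S : Matrix (Fin d) (Fin d) ℝ) :
    G - B * S - S * Bᵀ = 0 ↔ S = asymptoticCov B G := by
  constructor
  · intro h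
    have : G = B * S + S * Bᵀ := by rw [sub_sub, sub_eq_zero] at h; exact h
    rw [this, asymptoticCov_lyapunov hμ hB]
  · rintro rfl
    rw [sub_sub, lyapunov_asymptoticCov hμ hB, sub_self]

theorem posDef_asymptoticCov {B : Matrix (Fin d) (Fin d) ℝ} {μ : ℝ} (hμ : 0 < μ)
    (hB : ∀ x, μ * ‖x‖ ^ 2 ≤ inner ℝ x (Matrix.toEuclideanCLM (n := Fin d) (𝕜 := ℝ) B x))
    {G : Matrix (Fin d) (Fin d) ℝ} (hG : G.PosDef) : (asymptoticCov B G).PosDef := by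
  have hC : ∀ s, (covIntegrand B G s).PosDef := by
    intro s
    have hu : IsUnit (NormedSpace.exp (-(s • B))) := Matrix.isUnit_exp _
    have := (Matrix.IsUnit.posDef_star_right_conjugate_iff hu (x := G)).2 hG
    rwa [Matrix.star_eq_conjTranspose, Matrix.conjTranspose_eq_transpose_of_trivial] at this
  have hI := integrableOn_covIntegrand hμ hB G
  refine Matrix.PosDef.of_dotProduct_mulVec_pos ?_ ?_
  · ext i j
    simp only [asymptoticCov, Matrix.conjTranspose_apply, Matrix.of_apply, star_trivial]
    congr 1
    ext s
    exact (hC s).1.apply i j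
  · intro x hx
    have hq : ∀ s, x ⬝ᵥ covIntegrand B G s *ᵥ x
        = ∑ i, ∑ j, x i * (covIntegrand B G s i j * x j) := by
      intro s; simp [dotProduct, Matrix.mulVec, Finset.mul_sum]
    have hint : ∀ i j, IntegrableOn (fun s => x i * (covIntegrand B G s i j * x j)) (Ioi 0) :=
      fun i j => ((hI i j).mul_const _).const_mul _
    have h1 : star x ⬝ᵥ asymptoticCov B G *ᵥ x
        = ∫ s in Ioi (0 : ℝ), x ⬝ᵥ covIntegrand B G s *ᵥ x := by
      simp only [hq]
      rw [integral_finsetSum _ fun i _ => integrable_finsetSum _ fun j _ => hint i j]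
      simp only [star_trivial, dotProduct, Matrix.mulVec, Finset.mul_sum]
      refine Finset.sum_congr rfl fun i _ => ?_
      rw [integral_finsetSum _ fun j _ => hint i j]
      refine Finset.sum_congr rfl fun j _ => ?_
      rw [integral_const_mul, integral_mul_const]
      rfl
    rw [h1]
    have hpos : ∀ s, 0 < x ⬝ᵥ covIntegrand B G s *ᵥ x := fun s => by
      simpa using (hC s).dotProduct_mulVec_pos hx
    rw [setIntegral_pos_iff_support_of_nonneg_ae (ae_of_all _ fun s => (hpos s).le)]
    · have : (Function.support fun s => x ⬝ᵥ covIntegrand B G s *ᵥ x) = univ := by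
        ext s; simp [(hpos s).ne']
      simp [this]
    · simp only [hq]
      exact integrable_finsetSum _ fun i _ => integrable_finsetSum _ fun j _ => hint i j

end Lyapunov

/-! ### Step gauges: a regular normalization of the squared error -/

/-- A positive sequence `c` is a gauge for the steps `g` with exponent `ζ` if `c (p + 1)` is
equivalent to `g p` and `c` decays at the relative rate `2ζ` in the time scale of the steps. The
gauge is the normalization of the squared error; unlike the steps themselves, its one-step
increments are controlled. -/
structure IsStepGauge (g c : ℕ → ℝ) (ζ : ℝ) : Prop where
  step_pos : ∀ p, 0 < g p
  gauge_pos : ∀ p, 0 < c p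
  tendsto_step : Tendsto g atTop (𝓝 0)
  not_summable : ¬ Summable g
  tendsto_ratio : Tendsto (fun p => c (p + 1) / g p) atTop (𝓝 1)
  tendsto_drift : Tendsto (fun p => (c p / c (p + 1) - 1) / g p) atTop (𝓝 (2 * ζ))

namespace IsStepGauge

variable {g c : ℕ → ℝ} {ζ : ℝ}

theorem tendsto_gauge_ratio (h : IsStepGauge g c ζ) :
    Tendsto (fun p => c p / c (p + 1)) atTop (𝓝 1) := by
  have h1 := (h.tendsto_drift.mul h.tendsto_step).add_const 1
  rw [mul_zero, zero_add] at h1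
  refine h1.congr fun p => ?_
  rw [div_mul_cancel₀ _ (h.step_pos p).ne']
  ring

theorem tendsto_ratio_same (h : IsStepGauge g c ζ) :
    Tendsto (fun p => c p / g p) atTop (𝓝 1) := by
  have h1 := h.tendsto_gauge_ratio.mul h.tendsto_ratio
  rw [mul_one] at h1
  refine h1.congr fun p => ?_
  rw [div_mul_div_cancel₀ (h.gauge_pos _).ne']

theorem tendsto_ratio_two (h : IsStepGauge g c ζ) :
    Tendsto (fun p => c (p + 2) / g p) atTop (𝓝 1) := by
  have h1 := ((h.tendsto_gauge_ratio.comp (tendsto_add_atTop_nat 1)).inv₀ one_ne_zero).mul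
    h.tendsto_ratio
  rw [inv_one, mul_one] at h1
  refine h1.congr fun p => ?_
  have := (h.gauge_pos (p + 1)).ne'
  have := (h.gauge_pos (p + 2)).ne'
  have := (h.step_pos p).ne'
  simp only [Function.comp_apply, add_assoc, one_add_one_eq_two]
  field_simp

theorem tendsto_gauge (h : IsStepGauge g c ζ) : Tendsto c atTop (𝓝 0) := by
  have h1 := h.tendsto_ratio_same.mul h.tendsto_step
  rw [mul_zero] at h1
  refine h1.congr fun p => ?_
  rw [div_mul_cancel₀ _ (h.step_pos p).ne']

end IsStepGauge

section StepFunction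

variable {γ : ℝ → ℝ}

theorem tendsto_stepInverse {ι : Type*} {l : Filter ι} (hγpos : ∀ t, 0 ≤ t → 0 < γ t)
    (hγanti : AntitoneOn γ (Ici 0)) (hγlim : Tendsto γ atTop (𝓝 0)) {y : ι → ℝ}
    (hypos : ∀ i, 0 < y i) (hy : Tendsto y l (𝓝 0)) :
    Tendsto (fun i => stepInverse γ (y i)) l atTop := by
  refine tendsto_atTop.2 fun T => ?_
  filter_upwards [hy.eventually_lt_const (hγpos (max T 0) (le_max_right _ _))] with i hi
  refine (le_max_left T 0).trans (le_csInf ?_ ?_)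
  · obtain ⟨t, ht0, ht⟩ := ((eventually_ge_atTop 0).and
      (hγlim.eventually_lt_const (hypos i))).exists
    exact ⟨t, ht0, ht.le⟩
  · rintro t ⟨ht0, ht⟩
    by_contra! hlt
    have := hγanti (mem_Ici.2 ht0) (mem_Ici.2 (le_max_right T 0)) hlt.le
    linarith

/-- The number of steps `M ≈ γ⁻¹(y)` satisfies `γ(M + 1) ≤ y < γ(M - 1)`, so that the gauge at `M`
is equivalent to `y`, even if `γ` is not continuous. -/
theorem tendsto_gauge_div_of_stepInverse {ι : Type*} {l : Filter ι}
    (hγpos : ∀ t, 0 ≤ t → 0 < γ t)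
    (hγanti : AntitoneOn γ (Ici 0)) (hγlim : Tendsto γ atTop (𝓝 0)) {c : ℕ → ℝ} {ζ : ℝ}
    (hc : IsStepGauge (fun p => γ ((p : ℝ) + 1)) c ζ) {y : ι → ℝ}
    (hypos : ∀ i, 0 < y i) (hy : Tendsto y l (𝓝 0)) {M : ι → ℕ}
    (hM : ∀ i, |(M i : ℝ) - stepInverse γ (y i)| < 1) :
    Tendsto M l atTop ∧ Tendsto (fun i => c (M i) / y i) l (𝓝 1) := by
  have hMtop : Tendsto M l atTop := by
    have h1 := tendsto_atTop_add_const_right l (-1)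
      (tendsto_stepInverse hγpos hγanti hγlim hypos hy)
    refine tendsto_natCast_atTop_iff.1 (tendsto_atTop_mono (fun i => ?_) h1)
    have := (abs_lt.1 (hM i)).1
    linarith
  refine ⟨hMtop, ?_⟩
  have hup : Tendsto (fun i => c (M i) / γ ((M i : ℝ) + 1)) l (𝓝 1) :=
    hc.tendsto_ratio_same.comp hMtop
  have hlo : Tendsto (fun i => c (M i) / γ ((M i : ℝ) - 1)) l (𝓝 1) := by
    have h1 := hc.tendsto_ratio_two.comp ((tendsto_sub_atTop_nat 2).comp hMtop)
    refine h1.congr' ?_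
    filter_upwards [hMtop.eventually_ge_atTop 2] with i hi
    simp only [Function.comp_apply]
    rw [Nat.sub_add_cancel hi, Nat.cast_sub hi]
    congr 2
    push_cast
    ring
  refine tendsto_of_tendsto_of_tendsto_of_le_of_le' hlo hup ?_ ?_
  · filter_upwards [hMtop.eventually_ge_atTop 1] with i hi
    have hi' : (1 : ℝ) ≤ M i := by exact_mod_cast hi
    have h1 : y i < γ ((M i : ℝ) - 1) := by
      by_contra! hle
      have : stepInverse γ (y i) ≤ (M i : ℝ) - 1 :=
        csInf_le ⟨0, fun t ht => ht.1⟩ ⟨by linarith, hle⟩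
      have := (abs_lt.1 (hM i)).2
      linarith
    have := (hc.gauge_pos (M i)).le
    have := hypos i
    gcongr
  · filter_upwards with i
    have h1 : γ ((M i : ℝ) + 1) ≤ y i := by
      have hlt : stepInverse γ (y i) < (M i : ℝ) + 1 := by
        have := (abs_lt.1 (hM i)).1
        linarith
      have hne : {t : ℝ | 0 ≤ t ∧ γ t ≤ y i}.Nonempty := by
        obtain ⟨t, ht0, ht⟩ := ((eventually_ge_atTop 0).and
          (hγlim.eventually_lt_const (hypos i))).exists
        exact ⟨t, ht0, ht.le⟩
      obtain ⟨s, ⟨hs0, hs⟩, hslt⟩ := exists_lt_of_csInf_lt hne hlt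
      exact (hγanti (mem_Ici.2 hs0) (mem_Ici.2 (by positivity)) hslt.le).trans hs
    have := (hc.gauge_pos (M i)).le
    have := hγpos ((M i : ℝ) + 1) (by positivity)
    gcongr

/-- For harmonic steps the gauge is `γ₀ / (p + 1)`, whose relative decay is `1 / γ₀` per unit of
step. -/
theorem isStepGauge_of_harmonicStep {lam γ₀ : ℝ} (hγpos : ∀ t, 0 ≤ t → 0 < γ t)
    (hγlim : Tendsto γ atTop (𝓝 0)) (hγsum : ¬ Summable (fun p : ℕ => γ ((p : ℝ) + 1)))
    (h : HarmonicStep γ lam γ₀) :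
    IsStepGauge (fun p => γ ((p : ℝ) + 1)) (fun p => γ₀ / ((p : ℝ) + 1)) (1 / (2 * γ₀)) := by
  obtain ⟨h0, hγ, -⟩ := h
  have hg : ∀ p : ℕ, γ ((p : ℝ) + 1) = γ₀ / ((p : ℝ) + 1) := fun p => hγ _ (by simp)
  refine ⟨fun p => hγpos _ (by positivity), fun p => by positivity,
    hγlim.comp (tendsto_atTop_add_const_right _ 1 tendsto_natCast_atTop_atTop), hγsum, ?_, ?_⟩
  · have h1 := (tendsto_one_div_add_atTop_nhds_zero_nat (𝕜 := ℝ)).comp (tendsto_add_atTop_nat 1)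
    have h2 := h1.const_sub 1
    rw [sub_zero] at h2
    refine h2.congr fun p => ?_
    simp only [hg, Function.comp_apply, Nat.cast_add, Nat.cast_one]
    have : (p : ℝ) + 1 + 1 ≠ 0 := by positivity
    field_simp
    ring
  · refine tendsto_const_nhds.congr fun p => ?_
    simp only [hg, Nat.cast_add, Nat.cast_one]
    have : (p : ℝ) + 1 + 1 ≠ 0 := by positivity
    field_simp
    ring

/-- A regularly varying function of exponent `-a > -1` decays more slowly than `1 / t`: iterate
`2t γ(2t) ≥ 2r t γ(t)` for some `r > 1/2`. -/
theorem tendsto_mul_self_of_regularlyVarying {a : ℝ} (ha1 : a < 1)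
    (hγpos : ∀ t, 0 ≤ t → 0 < γ t) (hγanti : AntitoneOn γ (Ici 0))
    (hrv : Tendsto (fun t => γ (t * 2) / γ t) atTop (𝓝 (2 ^ (-a)))) :
    Tendsto (fun t => t * γ t) atTop atTop := by
  have h2a : (1 / 2 : ℝ) < 2 ^ (-a) := by
    have : (2 : ℝ) ^ (-1 : ℝ) < 2 ^ (-a) := Real.rpow_lt_rpow_of_exponent_lt (by norm_num)
      (by linarith)
    rwa [Real.rpow_neg_one, ← one_div] at this
  obtain ⟨r, hr1, hr2⟩ := exists_between h2a
  obtain ⟨T, hT⟩ := eventually_atTop.1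
    ((hrv.eventually_const_lt hr2).and (eventually_ge_atTop 1))
  have hT1 : 1 ≤ T := (hT T le_rfl).2
  have hm : 0 < T * γ (T * 2) := mul_pos (by linarith) (hγpos _ (by linarith))
  have key : ∀ k : ℕ, ∀ t, 2 ^ k * T ≤ t → t ≤ 2 ^ (k + 1) * T →
      (2 * r) ^ k * (T * γ (T * 2)) ≤ t * γ t := by
    intro k
    induction k with
    | zero =>
      intro t h1 h2
      simp only [pow_zero, one_mul, zero_add, pow_one] at *
      have ht : 0 ≤ t := by linarith
      have : γ (T * 2) ≤ γ t := hγanti ht (mem_Ici.2 (by linarith)) (by linarith)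
      have := hγpos (T * 2) (by linarith)
      gcongr
    | succ k ih =>
      intro t h1 h2
      have h3 := ih (t / 2) (by rw [le_div_iff₀ two_pos, mul_right_comm, ← pow_succ]; exact h1)
        (by rw [div_le_iff₀ two_pos, mul_right_comm, ← pow_succ]; exact h2)
      have hk : (1 : ℝ) ≤ 2 ^ k := one_le_pow₀ (by norm_num)
      have hTt : T ≤ t / 2 := by
        rw [le_div_iff₀ two_pos]
        have := pow_succ (2 : ℝ) k
        nlinarith
      have h4 := (hT (t / 2) hTt).1
      rw [div_mul_cancel₀ _ two_ne_zero, lt_div_iff₀ (hγpos _ (by linarith))] at h4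
      have h5 : t * (r * γ (t / 2)) ≤ t * γ t :=
        mul_le_mul_of_nonneg_left h4.le (by linarith)
      have h6 : (2 * r) * ((2 * r) ^ k * (T * γ (T * 2))) ≤ (2 * r) * (t / 2 * γ (t / 2)) :=
        mul_le_mul_of_nonneg_left h3 (by linarith)
      rw [pow_succ]
      linarith
  refine tendsto_atTop.2 fun b => ?_
  have hpow : Tendsto (fun k : ℕ => (2 * r) ^ k * (T * γ (T * 2))) atTop atTop :=
    (tendsto_pow_atTop_atTop_of_one_lt (by linarith)).atTop_mul_const hm
  obtain ⟨k₀, hk₀⟩ := eventually_atTop.1 (hpow.eventually_ge_atTop b)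
  filter_upwards [eventually_ge_atTop (2 ^ k₀ * T)] with t ht
  have hT0 : 0 < T := by linarith
  have h1k : (1 : ℝ) ≤ 2 ^ k₀ := one_le_pow₀ (by norm_num)
  obtain ⟨k, hk1, hk2⟩ := exists_nat_pow_near (x := t / T) (y := 2)
    (by rw [le_div_iff₀ hT0]; nlinarith) (by norm_num)
  rw [le_div_iff₀ hT0] at hk1
  rw [div_lt_iff₀ hT0] at hk2
  have hkk : k₀ ≤ k := by
    have : (2 : ℝ) ^ k₀ < 2 ^ (k + 1) := by
      have := ht.trans_lt hk2
      exact lt_of_mul_lt_mul_right this hT0.le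
    have := (pow_lt_pow_iff_right₀ (by norm_num : (1 : ℝ) < 2)).1 this
    omega
  exact (hk₀ k hkk).trans (key k t hk1 hk2.le)

/-- The average of `γ` over `[t, 2t]`. -/
noncomputable def windowAverage (γ : ℝ → ℝ) (t : ℝ) : ℝ := ∫ x in (1 : ℝ)..2, γ (t * x)

theorem intervalIntegrable_of_antitoneOn_Ici (hγanti : AntitoneOn γ (Ici 0)) {a b : ℝ}
    (ha : 0 ≤ a) (hb : 0 ≤ b) : IntervalIntegrable γ volume a b := by
  refine (hγanti.mono fun x hx => ?_).intervalIntegrable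
  exact (le_min ha hb).trans hx.1

theorem antitoneOn_comp_mul (hγanti : AntitoneOn γ (Ici 0)) {t : ℝ} (ht : 0 ≤ t) :
    AntitoneOn (fun x => γ (t * x)) (Ici 0) := fun _ hx _ hy hxy =>
  hγanti (mem_Ici.2 (mul_nonneg ht hx)) (mem_Ici.2 (mul_nonneg ht hy))
    (mul_le_mul_of_nonneg_left hxy ht)

theorem windowAverage_eq {t : ℝ} (ht : 0 < t) :
    windowAverage γ t = t⁻¹ * ∫ x in t..(2 * t), γ x := by
  rw [windowAverage, intervalIntegral.integral_comp_mul_left _ ht.ne', smul_eq_mul, mul_one,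
    mul_comm t 2]

theorem windowAverage_pos (hγpos : ∀ t, 0 ≤ t → 0 < γ t) (hγanti : AntitoneOn γ (Ici 0))
    {t : ℝ} (ht : 0 ≤ t) : 0 < windowAverage γ t := by
  refine intervalIntegral.intervalIntegral_pos_of_pos_on
    (intervalIntegrable_of_antitoneOn_Ici (antitoneOn_comp_mul hγanti ht) (by norm_num)
      (by norm_num)) (fun x hx => hγpos _ (mul_nonneg ht ?_)) (by norm_num)
  linarith [hx.1]

theorem windowAverage_antitone (hγanti : AntitoneOn γ (Ici 0)) {s t : ℝ} (hs : 0 ≤ s)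
    (hst : s ≤ t) : windowAverage γ t ≤ windowAverage γ s := by
  have ht := hs.trans hst
  refine intervalIntegral.integral_mono_on (by norm_num)
    (intervalIntegrable_of_antitoneOn_Ici (antitoneOn_comp_mul hγanti ht) (by norm_num)
      (by norm_num))
    (intervalIntegrable_of_antitoneOn_Ici (antitoneOn_comp_mul hγanti hs) (by norm_num)
      (by norm_num)) fun x hx => ?_
  have hx0 : 0 ≤ x := by linarith [hx.1]
  exact hγanti (mem_Ici.2 (mul_nonneg hs hx0)) (mem_Ici.2 (mul_nonneg ht hx0))
    (mul_le_mul_of_nonneg_right hst hx0)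

/-- Unlike the increments of a monotone `γ`, those of its window average are `O(γ(t) / t)`. -/
theorem windowAverage_sub_le (hγpos : ∀ t, 0 ≤ t → 0 < γ t) (hγanti : AntitoneOn γ (Ici 0))
    {t : ℝ} (ht : 0 < t) :
    windowAverage γ t - windowAverage γ (t + 1) ≤ 2 * γ t / (t + 1) := by
  have hI : ∀ {a b : ℝ}, 0 ≤ a → 0 ≤ b → IntervalIntegrable γ volume a b :=
    fun ha hb => intervalIntegrable_of_antitoneOn_Ici hγanti ha hb
  have hle : ∀ {a b : ℝ}, t ≤ a → a ≤ b → ∫ x in a..b, γ x ≤ (b - a) * γ t := by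
    intro a b ha hab
    have h1 : ∫ x in a..b, γ x ≤ ∫ _ in a..b, γ t :=
      intervalIntegral.integral_mono_on hab (hI (by linarith) (by linarith))
        intervalIntegrable_const fun x hx =>
          hγanti (mem_Ici.2 ht.le) (mem_Ici.2 (by linarith [hx.1])) (by linarith [hx.1])
    rwa [intervalIntegral.integral_const, smul_eq_mul] at h1
  have h0 : 0 ≤ ∫ x in (2 * t)..(2 * (t + 1)), γ x :=
    intervalIntegral.integral_nonneg (by linarith) fun x hx => (hγpos x (by linarith [hx.1])).le
  have hsplit : (∫ x in t..(t + 1), γ x) + ∫ x in (t + 1)..(2 * (t + 1)), γ x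
      = (∫ x in t..(2 * t), γ x) + ∫ x in (2 * t)..(2 * (t + 1)), γ x := by
    rw [intervalIntegral.integral_add_adjacent_intervals
        (hI ht.le (by linarith)) (hI (by linarith) (by linarith)),
      intervalIntegral.integral_add_adjacent_intervals
        (hI ht.le (by linarith)) (hI (by linarith) (by linarith))]
  have h1 := hle le_rfl (by linarith : t ≤ t + 1)
  have h2 := hle le_rfl (by linarith : t ≤ 2 * t)
  rw [windowAverage_eq ht, windowAverage_eq (by linarith : 0 < t + 1)]
  have e1 : t⁻¹ * (∫ x in t..(2 * t), γ x) = (t + 1)⁻¹ * (∫ x in t..(2 * t), γ x)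
      + (t + 1)⁻¹ * (t⁻¹ * ∫ x in t..(2 * t), γ x) := by
    have := ht.ne'
    have : t + 1 ≠ 0 := by linarith
    field_simp
  have e2 : t⁻¹ * (∫ x in t..(2 * t), γ x) ≤ γ t := by
    rw [inv_mul_le_iff₀ ht]; linarith
  have e3 : t⁻¹ * (∫ x in t..(2 * t), γ x) - (t + 1)⁻¹ * (∫ x in (t + 1)..(2 * (t + 1)), γ x)
      = (t + 1)⁻¹ * ((∫ x in t..(2 * t), γ x) - (∫ x in (t + 1)..(2 * (t + 1)), γ x)
        + t⁻¹ * ∫ x in t..(2 * t), γ x) := by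
    linear_combination e1
  rw [e3, div_eq_inv_mul]
  refine mul_le_mul_of_nonneg_left ?_ (by positivity)
  linarith

theorem tendsto_windowAverage_div {a : ℝ} (hγpos : ∀ t, 0 ≤ t → 0 < γ t)
    (hγanti : AntitoneOn γ (Ici 0))
    (hrv : ∀ x : ℝ, 0 < x → Tendsto (fun t => γ (t * x) / γ t) atTop (𝓝 (x ^ (-a)))) :
    Tendsto (fun t => windowAverage γ t / γ t) atTop (𝓝 (∫ x in (1 : ℝ)..2, x ^ (-a))) := by
  have h1 : Tendsto (fun t => ∫ x in (1 : ℝ)..2, γ (t * x) / γ t) atTop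
      (𝓝 (∫ x in (1 : ℝ)..2, x ^ (-a))) := by
    refine intervalIntegral.tendsto_integral_filter_of_dominated_convergence (fun _ => 1) ?_ ?_
      intervalIntegrable_const ?_
    · filter_upwards [eventually_ge_atTop 0] with t ht
      have := intervalIntegrable_of_antitoneOn_Ici (antitoneOn_comp_mul hγanti ht)
        (by norm_num : (0 : ℝ) ≤ 1) (by norm_num : (0 : ℝ) ≤ 2)
      exact (this.div_const (γ t)).aestronglyMeasurable_restrict_uIoc
    · filter_upwards [eventually_ge_atTop 0] with t ht
      refine ae_of_all _ fun x hx => ?_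
      rw [uIoc_of_le (by norm_num)] at hx
      have hx1 := hx.1.le
      have htx : 0 ≤ t * x := mul_nonneg ht (by linarith)
      rw [Real.norm_eq_abs, abs_of_nonneg (div_nonneg (hγpos _ htx).le (hγpos t ht).le),
        div_le_one (hγpos t ht)]
      exact hγanti ht htx (by nlinarith)
    · refine ae_of_all _ fun x hx => ?_
      rw [uIoc_of_le (by norm_num)] at hx
      exact hrv x (by linarith [hx.1])
  refine h1.congr fun t => ?_
  rw [intervalIntegral.integral_div, windowAverage]

/-- The normalized window average of a regularly varying `γ` is a gauge with exponent `0`: its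
increments are `O(γ(t) / t)`, which is negligible against `γ(t) ^ 2` because `t γ(t) → ∞`. -/
theorem isStepGauge_of_regularlyVarying {a : ℝ} (ha1 : a < 1)
    (hγpos : ∀ t, 0 ≤ t → 0 < γ t) (hγanti : AntitoneOn γ (Ici 0))
    (hγlim : Tendsto γ atTop (𝓝 0)) (hγsum : ¬ Summable (fun p : ℕ => γ ((p : ℝ) + 1)))
    (hrv : ∀ x : ℝ, 0 < x → Tendsto (fun t => γ (t * x) / γ t) atTop (𝓝 (x ^ (-a)))) :
    IsStepGauge (fun p => γ ((p : ℝ) + 1))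
      (fun p => windowAverage γ ((p : ℝ) + 1) / ∫ x in (1 : ℝ)..2, x ^ (-a)) 0 := by
  set I := ∫ x in (1 : ℝ)..2, x ^ (-a) with hIdef
  have hI : 0 < I := by
    refine intervalIntegral.intervalIntegral_pos_of_pos_on ?_
      (fun x hx => Real.rpow_pos_of_pos (by linarith [hx.1]) _) (by norm_num)
    refine intervalIntegral.intervalIntegrable_rpow (Or.inr ?_)
    rw [uIcc_of_le (by norm_num)]
    intro h
    linarith [h.1]
  have hW := tendsto_windowAverage_div hγpos hγanti hrv
  have hWpos : ∀ p : ℕ, 0 < windowAverage γ ((p : ℝ) + 1) :=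
    fun p => windowAverage_pos hγpos hγanti (by positivity)
  have hgpos : ∀ p : ℕ, 0 < γ ((p : ℝ) + 1) := fun p => hγpos _ (by positivity)
  have hp1 : Tendsto (fun p : ℕ => (p : ℝ) + 1) atTop atTop :=
    tendsto_atTop_add_const_right _ 1 tendsto_natCast_atTop_atTop
  have hdiff0 : ∀ p : ℕ, 0 ≤ windowAverage γ ((p : ℝ) + 1) - windowAverage γ ((p : ℝ) + 1 + 1) :=
    fun p => sub_nonneg.2 (windowAverage_antitone hγanti (by positivity) (by linarith))
  have hdiff : ∀ p : ℕ, windowAverage γ ((p : ℝ) + 1) - windowAverage γ ((p : ℝ) + 1 + 1)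
      ≤ 2 * γ ((p : ℝ) + 1) / ((p : ℝ) + 1 + 1) :=
    fun p => windowAverage_sub_le hγpos hγanti (by positivity)
  have hratio : Tendsto (fun p : ℕ => windowAverage γ ((p : ℝ) + 1 + 1) / γ ((p : ℝ) + 1)) atTop
      (𝓝 I) := by
    have h1 := hW.comp hp1
    have h2 : Tendsto (fun p : ℕ => (windowAverage γ ((p : ℝ) + 1)
        - windowAverage γ ((p : ℝ) + 1 + 1)) / γ ((p : ℝ) + 1)) atTop (𝓝 0) := by
      have h3 : Tendsto (fun p : ℕ => 2 / ((p : ℝ) + 1 + 1)) atTop (𝓝 0) :=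
        Tendsto.const_div_atTop (tendsto_atTop_add_const_right _ 1 hp1) 2
      refine squeeze_zero (fun p => div_nonneg (hdiff0 p) (hgpos p).le) (fun p => ?_) h3
      rw [div_le_iff₀ (hgpos p)]
      refine (hdiff p).trans (le_of_eq ?_)
      ring
    have h3 := h1.sub h2
    rw [sub_zero] at h3
    refine h3.congr fun p => ?_
    simp only [Function.comp_apply]
    ring
  refine ⟨hgpos, fun p => div_pos (hWpos p) hI, hγlim.comp hp1, hγsum, ?_, ?_⟩
  · have h1 := hratio.div_const I
    rw [div_self hI.ne'] at h1
    refine h1.congr fun p => ?_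
    push_cast
    rw [div_right_comm]
  · have htop : Tendsto (fun p : ℕ => ((p : ℝ) + 1 + 1) * windowAverage γ ((p : ℝ) + 1 + 1))
        atTop atTop := by
      have h1 := (tendsto_mul_self_of_regularlyVarying ha1 hγpos hγanti (hrv 2 two_pos)).comp
        (tendsto_atTop_add_const_right _ 1 hp1)
      have h2 := h1.atTop_mul_pos hI (hW.comp (tendsto_atTop_add_const_right _ 1 hp1))
      refine h2.congr fun p => ?_
      have := (hγpos ((p : ℝ) + 1 + 1) (by positivity)).ne'
      simp only [Function.comp_apply]
      field_simp
    have h3 := Tendsto.const_div_atTop htop 2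
    rw [mul_zero]
    have hW2 : ∀ p : ℕ, 0 < windowAverage γ ((p : ℝ) + 1 + 1) :=
      fun p => windowAverage_pos hγpos hγanti (by positivity)
    have e : ∀ p : ℕ, (windowAverage γ ((p : ℝ) + 1) / I
        / (windowAverage γ (((p + 1 : ℕ) : ℝ) + 1) / I) - 1) / γ ((p : ℝ) + 1)
        = (windowAverage γ ((p : ℝ) + 1) - windowAverage γ ((p : ℝ) + 1 + 1))
          / (windowAverage γ ((p : ℝ) + 1 + 1) * γ ((p : ℝ) + 1)) := by
      intro p
      push_cast
      have := (hW2 p).ne'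
      have := (hgpos p).ne'
      field_simp
    refine squeeze_zero (fun p => ?_) (fun p => ?_) h3
    · rw [e]
      exact div_nonneg (hdiff0 p) (mul_pos (hW2 p) (hgpos p)).le
    · rw [e, div_le_iff₀ (mul_pos (hW2 p) (hgpos p))]
      refine (hdiff p).trans (le_of_eq ?_)
      have := (hW2 p).ne'
      field_simp

end StepFunction

/-! ### Discrete Gronwall bounds and Taylor bounds for the exponential -/

namespace IsStepGauge

variable {g c : ℕ → ℝ} {ζ : ℝ}

/-- The decay `ζ` of the gauge is beaten by the mean reversion `lam`: the mean squared error divided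
by the gauge contracts. -/
theorem eventually_contraction (h : IsStepGauge g c ζ) {lam : ℝ} (hlam : ζ < lam) (L : ℝ) :
    ∀ᶠ p in atTop, c p / c (p + 1) * (1 - 2 * lam * g p + L * g p ^ 2)
      ≤ 1 - (lam - ζ) * g p := by
  have h1 : Tendsto (fun p => (c p / c (p + 1) - 1) / g p
      + c p / c (p + 1) * (-(2 * lam) + L * g p)) atTop (𝓝 (2 * ζ + 1 * (-(2 * lam) + L * 0))) :=
    h.tendsto_drift.add (h.tendsto_gauge_ratio.mul ((h.tendsto_step.const_mul L).const_add _))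
  filter_upwards [h1.eventually_lt_const (by linarith : _ < -(lam - ζ))] with p hp
  have hg := h.step_pos p
  have h2 := mul_le_mul_of_nonneg_right hp.le hg.le
  rw [add_mul, div_mul_cancel₀ _ hg.ne'] at h2
  linarith

/-- Solutions of the recursion satisfied by the mean squared error of the scheme are bounded by a
multiple of the gauge, uniformly in the solution. -/
theorem exists_forall_le_mul_gauge (h : IsStepGauge g c ζ) {lam : ℝ} (hlam0 : 0 < lam)
    (hlam : ζ < lam) {L : ℝ} (hL : 0 ≤ L) {Y : ℝ} (hY : 0 ≤ Y) :
    ∃ C : ℝ, 0 ≤ C ∧ ∀ y : ℕ → ℝ, (∀ p, 0 ≤ y p) → y 0 ≤ Y →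
      (∀ p, y (p + 1) ≤ (1 - 2 * lam * g p + L * g p ^ 2) * y p + L * g p ^ 2) →
      ∀ p, y p ≤ C * c p := by
  obtain ⟨p₀, hp₀⟩ := eventually_atTop.1 ((h.eventually_contraction hlam L).and
    ((h.tendsto_step.eventually_lt_const
      (by have := sub_pos.2 hlam; positivity : (0 : ℝ) < 1 / (lam - ζ))).and
      (h.tendsto_ratio.eventually_const_lt (by norm_num : (1 / 2 : ℝ) < 1))))
  have hκ : 0 < lam - ζ := sub_pos.2 hlam
  -- a crude majorant of all solutions, used only for the finitely many times up to `p₀`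
  let m : ℕ → ℝ := fun p => Nat.rec Y (fun k m => (1 + L * g k ^ 2) * m + L * g k ^ 2) p
  have hm : ∀ p, 0 ≤ m p := by
    intro p
    induction p with
    | zero => exact hY
    | succ k ih =>
      change 0 ≤ (1 + L * g k ^ 2) * m k + L * g k ^ 2
      positivity
  have hmc : ∀ p, 0 ≤ m p / c p := fun p => div_nonneg (hm p) (h.gauge_pos p).le
  -- the last term makes `C` a supersolution: `2 L ≤ (lam - ζ) C`
  set C := (∑ p ∈ Finset.range (p₀ + 1), m p / c p) + 2 * L / (lam - ζ) with hC
  have hsum : 0 ≤ ∑ p ∈ Finset.range (p₀ + 1), m p / c p := Finset.sum_nonneg fun p _ => hmc p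
  have hLκ : 0 ≤ 2 * L / (lam - ζ) := by positivity
  refine ⟨C, by positivity, fun y hy hy0 hrec p => ?_⟩
  have hym : ∀ p, y p ≤ m p := by
    intro p
    induction p with
    | zero => exact hy0
    | succ k ih =>
      change y (k + 1) ≤ (1 + L * g k ^ 2) * m k + L * g k ^ 2
      have hg := h.step_pos k
      have h1 : (1 - 2 * lam * g k + L * g k ^ 2) * y k ≤ (1 + L * g k ^ 2) * y k := by
        refine mul_le_mul_of_nonneg_right ?_ (hy k)
        have : 0 < 2 * lam * g k := by positivity
        linarith
      have h2 : (1 + L * g k ^ 2) * y k ≤ (1 + L * g k ^ 2) * m k :=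
        mul_le_mul_of_nonneg_left ih (by positivity)
      linarith [hrec k]
  have hle : ∀ p ≤ p₀, y p ≤ C * c p := by
    intro p hp
    have h1 : m p / c p ≤ C := by
      have := Finset.single_le_sum (f := fun p => m p / c p) (fun p _ => hmc p)
        (Finset.mem_range.2 (Nat.lt_succ_of_le hp))
      linarith
    rw [div_le_iff₀ (h.gauge_pos p)] at h1
    exact (hym p).trans h1
  rcases le_total p p₀ with hp | hp
  · exact hle p hp
  · induction p, hp using Nat.le_induction with
    | base => exact hle p₀ le_rfl
    | succ p hp ih =>
      obtain ⟨h1, h2, h3⟩ := hp₀ p hp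
      have hg := h.step_pos p
      have hc := h.gauge_pos p
      have hc' := h.gauge_pos (p + 1)
      rw [lt_div_iff₀ hg] at h3
      rw [lt_div_iff₀ hκ] at h2
      have h4 : c p * (1 - 2 * lam * g p + L * g p ^ 2)
          ≤ (1 - (lam - ζ) * g p) * c (p + 1) := by
        rwa [div_mul_eq_mul_div, div_le_iff₀ hc'] at h1
      have h5 : (1 - 2 * lam * g p + L * g p ^ 2) * y p
          ≤ (1 - (lam - ζ) * g p) * c (p + 1) * C := by
        have h6 : 0 ≤ y p / c p := div_nonneg (hy p) hc.le
        have h7 : y p / c p ≤ C := by rwa [div_le_iff₀ hc]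
        calc (1 - 2 * lam * g p + L * g p ^ 2) * y p
            = c p * (1 - 2 * lam * g p + L * g p ^ 2) * (y p / c p) := by
              field_simp
          _ ≤ (1 - (lam - ζ) * g p) * c (p + 1) * (y p / c p) :=
              mul_le_mul_of_nonneg_right h4 h6
          _ ≤ (1 - (lam - ζ) * g p) * c (p + 1) * C :=
              mul_le_mul_of_nonneg_left h7 (mul_nonneg (by linarith) hc'.le)
      have h8 : L * g p ^ 2 ≤ (lam - ζ) * g p * C * c (p + 1) := by
        have h9 : 2 * L ≤ (lam - ζ) * C := by
          rw [hC, mul_add, mul_div_cancel₀ _ hκ.ne']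
          have := mul_nonneg hκ.le hsum
          linarith
        have h10 : L * g p ^ 2 ≤ 2 * L * g p * c (p + 1) := by
          have : L * g p * (g p) ≤ L * g p * (2 * c (p + 1)) :=
            mul_le_mul_of_nonneg_left (by linarith) (by positivity)
          linarith
        have h11 : 2 * L * (g p * c (p + 1)) ≤ (lam - ζ) * C * (g p * c (p + 1)) :=
          mul_le_mul_of_nonneg_right h9 (by positivity)
        linarith
      linarith [hrec p]

theorem tendsto_prod_one_sub (h : IsStepGauge g c ζ) {κ : ℝ} (hκ : 0 < κ) {p₁ : ℕ}
    (hp₁ : ∀ p ≥ p₁, κ * g p ≤ 1) :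
    Tendsto (fun p => ∏ k ∈ Finset.Ico p₁ p, (1 - κ * g k)) atTop (𝓝 0) := by
  have h1 : Tendsto (fun p => ∑ k ∈ Finset.range p, g k) atTop atTop :=
    (not_summable_iff_tendsto_nat_atTop_of_nonneg fun p => (h.step_pos p).le).1 h.not_summable
  have h2 : Tendsto (fun p => Real.exp (-(κ * (∑ k ∈ Finset.range p, g k
      - ∑ k ∈ Finset.range p₁, g k)))) atTop (𝓝 0) := by
    refine Real.tendsto_exp_atBot.comp (tendsto_neg_atTop_atBot.comp ?_)
    exact (tendsto_atTop_add_const_right _ _ h1).const_mul_atTop hκ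
  refine squeeze_zero' (Eventually.of_forall fun p => Finset.prod_nonneg fun k hk => ?_) ?_ h2
  · linarith [hp₁ k (Finset.mem_Ico.1 hk).1]
  · filter_upwards [eventually_ge_atTop p₁] with p hp
    rw [← Finset.sum_Ico_eq_sub _ hp, Finset.mul_sum, ← Finset.sum_neg_distrib, Real.exp_sum]
    refine Finset.prod_le_prod (fun k hk => ?_) fun k _ => ?_
    · linarith [hp₁ k (Finset.mem_Ico.1 hk).1]
    · linarith [Real.add_one_le_exp (-(κ * g k))]

end IsStepGauge

section ExpTaylor

open Complex

theorem norm_cexp_ofReal_mul_I_sub_one_le (x : ℝ) : ‖cexp (x * I) - 1‖ ≤ |x| := by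
  rw [mul_comm]
  exact Real.norm_exp_I_mul_ofReal_sub_one_le

theorem norm_cexp_ofReal_mul_I_sub_le (x : ℝ) : ‖cexp (x * I) - (1 + x * I)‖ ≤ 3 * x ^ 2 := by
  rcases le_total |x| 1 with hx | hx
  · have h := Complex.norm_exp_sub_sum_le_norm_mul_exp (x * I) 2
    simp only [Finset.sum_range_succ, Finset.range_zero, Finset.sum_empty, Complex.norm_mul,
      Complex.norm_I, mul_one, Complex.norm_real, Real.norm_eq_abs, sq_abs] at h
    norm_num at h
    refine h.trans ?_
    have : Real.exp |x| ≤ 3 := (Real.exp_le_exp.2 hx).trans Real.exp_one_lt_three.le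
    nlinarith [sq_nonneg x]
  · have h1 := norm_cexp_ofReal_mul_I_sub_one_le x
    calc ‖cexp (x * I) - (1 + x * I)‖ = ‖(cexp (x * I) - 1) - x * I‖ := by ring_nf
      _ ≤ ‖cexp (x * I) - 1‖ + ‖(x * I : ℂ)‖ := norm_sub_le _ _
      _ ≤ |x| + |x| := by
          gcongr
          simp
      _ ≤ 3 * x ^ 2 := by nlinarith [sq_abs x]

theorem norm_cexp_ofReal_mul_I_sub_sub_le (x : ℝ) :
    ‖cexp (x * I) - (1 + x * I - (x ^ 2 / 2 : ℝ))‖ ≤ 4 * x ^ 2 := by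
  have h := norm_cexp_ofReal_mul_I_sub_le x
  calc ‖cexp (x * I) - (1 + x * I - (x ^ 2 / 2 : ℝ))‖
      = ‖(cexp (x * I) - (1 + x * I)) + (x ^ 2 / 2 : ℝ)‖ := by ring_nf
    _ ≤ ‖cexp (x * I) - (1 + x * I)‖ + ‖((x ^ 2 / 2 : ℝ) : ℂ)‖ := norm_add_le _ _
    _ ≤ 3 * x ^ 2 + x ^ 2 / 2 := by
        gcongr
        rw [Complex.norm_real, Real.norm_eq_abs, abs_of_nonneg (by positivity)]
    _ ≤ 4 * x ^ 2 := by nlinarith [sq_nonneg x]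

theorem norm_cexp_ofReal_mul_I_sub_sub_le_cube (x : ℝ) :
    ‖cexp (x * I) - (1 + x * I - (x ^ 2 / 2 : ℝ))‖ ≤ 4 * |x| ^ 3 := by
  rcases le_total |x| 1 with hx | hx
  · have h := Complex.norm_exp_sub_sum_le_norm_mul_exp (x * I) 3
    simp only [Finset.sum_range_succ, Finset.range_zero, Finset.sum_empty, Complex.norm_mul,
      Complex.norm_I, mul_one, Complex.norm_real, Real.norm_eq_abs] at h
    have e : cexp (x * I) - (1 + x * I - (x ^ 2 / 2 : ℝ))
        = cexp (x * I) - (0 + (x * I : ℂ) ^ 0 / (Nat.factorial 0 : ℕ)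
          + (x * I : ℂ) ^ 1 / (Nat.factorial 1 : ℕ) + (x * I : ℂ) ^ 2 / (Nat.factorial 2 : ℕ)) := by
      simp [Nat.factorial, mul_pow]
      ring
    rw [e]
    refine h.trans ?_
    have : Real.exp |x| ≤ 3 := (Real.exp_le_exp.2 hx).trans Real.exp_one_lt_three.le
    have h3 : 0 ≤ |x| ^ 3 := by positivity
    nlinarith
  · refine (norm_cexp_ofReal_mul_I_sub_sub_le x).trans ?_
    rw [← sq_abs]
    nlinarith [sq_nonneg |x|]

/-- The minimum of the quadratic and the cubic bound of the Taylor remainder, interpolated so that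
a moment of any order `2 + δ` controls it. -/
theorem norm_cexp_taylor_le_rpow {ε δ : ℝ} (hε : 0 < ε) (hδ : 0 < δ) (x : ℝ) :
    ‖cexp (x * I) - (1 + x * I - (x ^ 2 / 2 : ℝ))‖
      ≤ 4 * (ε * x ^ 2 + ε ^ (-δ) * |x| ^ (2 + δ)) := by
  rcases le_total |x| ε with hx | hx
  · have h1 : |x| ^ 3 ≤ ε * x ^ 2 := by
      rw [← sq_abs x]
      nlinarith [sq_nonneg |x|]
    have h2 : 0 ≤ ε ^ (-δ) * |x| ^ (2 + δ) := by positivity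
    linarith [norm_cexp_ofReal_mul_I_sub_sub_le_cube x]
  · have h1 : x ^ 2 ≤ ε ^ (-δ) * |x| ^ (2 + δ) := by
      have hx0 : 0 < |x| := hε.trans_le hx
      rw [Real.rpow_add hx0, Real.rpow_two, sq_abs, Real.rpow_neg hε.le, mul_left_comm,
        ← div_eq_inv_mul]
      refine le_mul_of_one_le_right (sq_nonneg _) ?_
      rw [one_le_div (by positivity)]
      exact Real.rpow_le_rpow hε.le hx hδ.le
    have h2 : 0 ≤ ε * x ^ 2 := by positivity
    linarith [norm_cexp_ofReal_mul_I_sub_sub_le x]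

theorem abs_one_sub_mul_exp_sub_exp_le {a b s : ℝ} (ha : 0 ≤ a) (hb : 0 ≤ b) (hs : 0 ≤ s) :
    |(1 - s) * Real.exp (-a) - Real.exp (-b)| ≤ s ^ 2 + |a + s - b| := by
  have hlip : ∀ x y : ℝ, 0 ≤ x → 0 ≤ y → |Real.exp (-x) - Real.exp (-y)| ≤ |x - y| := by
    have key : ∀ x y : ℝ, 0 ≤ x → x ≤ y → |Real.exp (-x) - Real.exp (-y)| ≤ |x - y| := by
      intro x y hx hxy
      rw [abs_of_nonneg (sub_nonneg.2 (Real.exp_le_exp.2 (by linarith))),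
        abs_of_nonpos (by linarith)]
      have h1 := Real.add_one_le_exp (x - y)
      have h2 : Real.exp (-y) = Real.exp (-x) * Real.exp (x - y) := by
        rw [← Real.exp_add]; ring_nf
      have h3 : Real.exp (-x) ≤ 1 := Real.exp_le_one_iff.2 (by linarith)
      have h4 := Real.exp_pos (-x)
      rw [h2]
      nlinarith [Real.exp_le_one_iff.2 (by linarith : x - y ≤ 0)]
    intro x y hx hy
    rcases le_total x y with h | h
    · exact key x y hx h
    · rw [abs_sub_comm, abs_sub_comm x y]; exact key y x hy h
  have h1 : |(1 - s) - Real.exp (-s)| ≤ s ^ 2 := by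
    have h2 := Real.add_one_le_exp (-s)
    have h3 := Real.add_one_le_exp s
    rw [abs_le]
    constructor
    · have h4 : Real.exp (-s) ≤ 1 / (1 + s) := by
        rw [Real.exp_neg, ← one_div]
        exact one_div_le_one_div_of_le (by linarith) (by linarith)
      have h5 : 1 / (1 + s) ≤ 1 - s + s ^ 2 := by
        rw [div_le_iff₀ (by linarith)]
        nlinarith [pow_nonneg hs 3]
      linarith
    · nlinarith
  have h2 := hlip (a + s) b (by linarith) hb
  have e : (1 - s) * Real.exp (-a) - Real.exp (-b)
      = Real.exp (-a) * ((1 - s) - Real.exp (-s)) + (Real.exp (-(a + s)) - Real.exp (-b)) := by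
    rw [neg_add, Real.exp_add]; ring
  rw [e]
  refine (abs_add_le _ _).trans (add_le_add ?_ h2)
  rw [abs_mul, abs_of_pos (Real.exp_pos _)]
  exact (mul_le_of_le_one_left (abs_nonneg _) (Real.exp_le_one_iff.2 (by linarith))).trans h1

end ExpTaylor

/-! ### One step of the scheme -/

section Independence

variable {Ω α β E : Type*} [MeasurableSpace Ω] [MeasurableSpace α] [MeasurableSpace β]
  [NormedAddCommGroup E] {P : Measure Ω} [IsProbabilityMeasure P] {ν : Measure β}
  {X : Ω → α} {ξ : Ω → β} {F : α → β → E}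

theorem integrable_comp_of_indepFun (hX : Measurable X) (hξ : Measurable ξ)
    (hind : IndepFun X ξ P) (hν : P.map ξ = ν)
    (hF : StronglyMeasurable (Function.uncurry F)) (hFint : ∀ a, Integrable (F a) ν)
    {ψ : α → ℝ} (hψ : ∀ a, ∫ b, ‖F a b‖ ∂ν ≤ ψ a) (hψX : Integrable (fun ω => ψ (X ω)) P) :
    Integrable (fun ω => F (X ω) (ξ ω)) P := by
  have : IsProbabilityMeasure ν := hν ▸ Measure.isProbabilityMeasure_map hξ.aemeasurable
  have : IsProbabilityMeasure (P.map X) := Measure.isProbabilityMeasure_map hX.aemeasurable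
  have hlaw := (indepFun_iff_map_prod_eq_prod_map_map hX.aemeasurable hξ.aemeasurable).1 hind
  rw [hν] at hlaw
  have hg : StronglyMeasurable (fun a => ∫ b, ‖F a b‖ ∂ν) :=
    StronglyMeasurable.integral_prod_right (f := fun a b => ‖F a b‖) hF.norm
  have hint : Integrable (Function.uncurry F) ((P.map X).prod ν) := by
    rw [integrable_prod_iff hF.aestronglyMeasurable]
    refine ⟨ae_of_all _ fun a => hFint a, ?_⟩
    refine (integrable_map_measure hg.aestronglyMeasurable hX.aemeasurable).2 ?_
    refine hψX.mono' (hg.comp_measurable hX).aestronglyMeasurable (ae_of_all _ fun ω => ?_)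
    rw [Real.norm_eq_abs, Function.comp_apply,
      abs_of_nonneg (integral_nonneg fun b => norm_nonneg _)]
    exact hψ _
  rw [← hlaw] at hint
  exact hint.comp_measurable (hX.prodMk hξ)

theorem integral_comp_of_indepFun [NormedSpace ℝ E] (hX : Measurable X) (hξ : Measurable ξ)
    (hind : IndepFun X ξ P) (hν : P.map ξ = ν)
    (hF : StronglyMeasurable (Function.uncurry F))
    (hint : Integrable (fun ω => F (X ω) (ξ ω)) P) :
    ∫ ω, F (X ω) (ξ ω) ∂P = ∫ ω, ∫ b, F (X ω) b ∂ν ∂P := by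
  have : IsProbabilityMeasure ν := hν ▸ Measure.isProbabilityMeasure_map hξ.aemeasurable
  have : IsProbabilityMeasure (P.map X) := Measure.isProbabilityMeasure_map hX.aemeasurable
  have hlaw := (indepFun_iff_map_prod_eq_prod_map_map hX.aemeasurable hξ.aemeasurable).1 hind
  rw [hν] at hlaw
  have hint' : Integrable (Function.uncurry F) ((P.map X).prod ν) := by
    rw [← hlaw, integrable_map_measure hF.aestronglyMeasurable (hX.prodMk hξ).aemeasurable]
    exact hint
  have h1 : ∫ ω, F (X ω) (ξ ω) ∂P = ∫ z, Function.uncurry F z ∂((P.map X).prod ν) := by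
    rw [← hlaw, integral_map (hX.prodMk hξ).aemeasurable hF.aestronglyMeasurable]
    rfl
  rw [h1, integral_prod _ hint', integral_map hX.aemeasurable]
  · rfl
  · exact (StronglyMeasurable.integral_prod_right (f := F) hF).aestronglyMeasurable

end Independence

/-- The innovation law `ν` is admissible for `H` around the zero `θs` of the mean field: the second
moment of `H θ` grows at most quadratically in `θ - θs`, and the mean field is strongly
mean-reverting. -/
structure IsAdmissible {d q : ℕ} (H : Vec d → Vec q → Vec d) (ν : Measure (Vec q)) (θs : Vec d)
    (L lam : ℝ) : Prop where
  measurable : Measurable (Function.uncurry H)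
  memLp : ∀ θ, MemLp (H θ) 2 ν
  integral_sq_le : ∀ θ, ∫ x, ‖H θ x‖ ^ 2 ∂ν ≤ L * (1 + ‖θ - θs‖ ^ 2)
  reverting : ∀ θ, lam * ‖θ - θs‖ ^ 2 ≤ inner ℝ (θ - θs) (∫ x, H θ x ∂ν)

section Step

variable {d q : ℕ} {Ω : Type*} [MeasurableSpace Ω] {P : Measure Ω} [IsProbabilityMeasure P]
  {H : Vec d → Vec q → Vec d} {ν : Measure (Vec q)} {θs : Vec d}
  {L lam : ℝ} {X : Ω → Vec d} {ξ : Ω → Vec q}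

theorem integrable_norm_sq_of_memLp {α E : Type*} [MeasurableSpace α] [NormedAddCommGroup E]
    {μ : Measure α} {f : α → E} (hf : MemLp f 2 μ) : Integrable (fun x => ‖f x‖ ^ 2) μ :=
  hf.integrable_norm_pow two_ne_zero

theorem integrable_inner_of_memLp {α : Type*} [MeasurableSpace α] {μ : Measure α}
    {f g : α → Vec d} (hf : MemLp f 2 μ) (hg : MemLp g 2 μ) :
    Integrable (fun x => inner ℝ (f x) (g x)) μ := by
  refine Integrable.mono' ((integrable_norm_sq_of_memLp hf).add (integrable_norm_sq_of_memLp hg))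
    (hf.1.inner hg.1) (ae_of_all _ fun x => (norm_inner_le_norm (𝕜 := ℝ) _ _).trans ?_)
  simp only [Pi.add_apply]
  nlinarith [sq_nonneg (‖f x‖ - ‖g x‖), sq_nonneg ‖f x‖, sq_nonneg ‖g x‖]

theorem IsAdmissible.memLp_innovation (h : IsAdmissible H ν θs L lam) (hX : Measurable X)
    (hξ : Measurable ξ) (hind : IndepFun X ξ P) (hν : P.map ξ = ν)
    (hX2 : MemLp (fun ω => X ω - θs) 2 P) : MemLp (fun ω => H (X ω) (ξ ω)) 2 P := by
  have hm : Measurable (fun ω => H (X ω) (ξ ω)) := h.measurable.comp (hX.prodMk hξ)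
  rw [memLp_two_iff_integrable_sq_norm hm.aestronglyMeasurable]
  refine integrable_comp_of_indepFun (F := fun θ x => ‖H θ x‖ ^ 2)
    (ψ := fun θ => L * (1 + ‖θ - θs‖ ^ 2)) hX hξ hind hν ?_
    (fun θ => integrable_norm_sq_of_memLp (h.memLp θ)) (fun θ => ?_) ?_
  · exact (h.measurable.norm.pow_const 2).stronglyMeasurable
  · refine le_trans (le_of_eq ?_) (h.integral_sq_le θ)
    simp
  · exact ((integrable_const _).add (integrable_norm_sq_of_memLp hX2)).const_mul _

theorem IsAdmissible.memLp_step (h : IsAdmissible H ν θs L lam) (hX : Measurable X)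
    (hξ : Measurable ξ) (hind : IndepFun X ξ P) (hν : P.map ξ = ν)
    (hX2 : MemLp (fun ω => X ω - θs) 2 P) (g : ℝ) :
    MemLp (fun ω => X ω - g • H (X ω) (ξ ω) - θs) 2 P := by
  have h1 := hX2.sub ((h.memLp_innovation hX hξ hind hν hX2).const_smul g)
  refine h1.congr_norm (h1.aestronglyMeasurable.congr (ae_of_all _ fun ω => ?_))
    (ae_of_all _ fun ω => ?_) <;> simp [sub_right_comm]

theorem IsAdmissible.integral_sq_step_le (h : IsAdmissible H ν θs L lam) (hX : Measurable X)
    (hξ : Measurable ξ) (hind : IndepFun X ξ P) (hν : P.map ξ = ν)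
    (hX2 : MemLp (fun ω => X ω - θs) 2 P) {g : ℝ} (hg : 0 ≤ g) :
    ∫ ω, ‖X ω - g • H (X ω) (ξ ω) - θs‖ ^ 2 ∂P
      ≤ (1 - 2 * lam * g + L * g ^ 2) * ∫ ω, ‖X ω - θs‖ ^ 2 ∂P + L * g ^ 2 := by
  have hW := h.memLp_innovation hX hξ hind hν hX2
  have hW2 := integrable_norm_sq_of_memLp hW
  have hZ2 := integrable_norm_sq_of_memLp hX2
  have hZW : Integrable (fun ω => inner ℝ (X ω - θs) (H (X ω) (ξ ω))) P :=
    integrable_inner_of_memLp hX2 hW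
  have e1 : ∀ ω, ‖X ω - g • H (X ω) (ξ ω) - θs‖ ^ 2 = ‖X ω - θs‖ ^ 2
      - 2 * g * inner ℝ (X ω - θs) (H (X ω) (ξ ω)) + g ^ 2 * ‖H (X ω) (ξ ω)‖ ^ 2 := by
    intro ω
    rw [sub_right_comm, norm_sub_sq_real, inner_smul_right, norm_smul, mul_pow,
      Real.norm_eq_abs, sq_abs]
    ring
  simp only [e1]
  have : IsProbabilityMeasure ν := hν ▸ Measure.isProbabilityMeasure_map hξ.aemeasurable
  have hZW' := hZW.const_mul (2 * g)
  have hsub : Integrable (fun ω => ‖X ω - θs‖ ^ 2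
      - 2 * g * inner ℝ (X ω - θs) (H (X ω) (ξ ω))) P := hZ2.sub hZW'
  rw [integral_add hsub (hW2.const_mul _), integral_sub hZ2 hZW', integral_const_mul,
    integral_const_mul]
  have h1 : lam * ∫ ω, ‖X ω - θs‖ ^ 2 ∂P ≤ ∫ ω, inner ℝ (X ω - θs) (H (X ω) (ξ ω)) ∂P := by
    have hm : Measurable (Function.uncurry fun (θ : Vec d) (x : Vec q) =>
        inner ℝ (θ - θs) (H θ x)) := (measurable_fst.sub_const θs).inner h.measurable
    rw [integral_comp_of_indepFun (F := fun θ x => inner ℝ (θ - θs) (H θ x)) hX hξ hind hν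
      hm.stronglyMeasurable hZW, ← integral_const_mul]
    have e2 : ∀ ω, ∫ x, inner ℝ (X ω - θs) (H (X ω) x) ∂ν
        = inner ℝ (X ω - θs) (∫ x, H (X ω) x ∂ν) := fun ω =>
      integral_inner ((h.memLp _).integrable (by norm_num)) _
    simp only [e2]
    refine integral_mono_ae (hZ2.const_mul _) ?_ (ae_of_all _ fun ω => h.reverting (X ω))
    simp only [← e2]
    have hm' := (StronglyMeasurable.integral_prod_right (ν := ν)
      (f := fun (θ : Vec d) x => inner ℝ (θ - θs) (H θ x)) hm.stronglyMeasurable).comp_measurable hX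
    refine Integrable.mono' (g := fun ω => 2⁻¹ * ‖X ω - θs‖ ^ 2
      + 2⁻¹ * (L * (1 + ‖X ω - θs‖ ^ 2))) ?_ hm'.aestronglyMeasurable
      (ae_of_all _ fun ω => ?_)
    · exact (hZ2.const_mul _).add ((((integrable_const _).add hZ2).const_mul _).const_mul _)
    · have hHi := integrable_norm_sq_of_memLp (h.memLp (X ω))
      calc ‖∫ x, inner ℝ (X ω - θs) (H (X ω) x) ∂ν‖
          ≤ ∫ x, (2⁻¹ * ‖X ω - θs‖ ^ 2 + 2⁻¹ * ‖H (X ω) x‖ ^ 2) ∂ν := by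
            refine norm_integral_le_of_norm_le
              ((integrable_const _).add (hHi.const_mul _)) (ae_of_all _ fun x => ?_)
            refine (norm_inner_le_norm (𝕜 := ℝ) _ _).trans ?_
            nlinarith [sq_nonneg (‖X ω - θs‖ - ‖H (X ω) x‖)]
        _ = 2⁻¹ * ‖X ω - θs‖ ^ 2 + 2⁻¹ * ∫ x, ‖H (X ω) x‖ ^ 2 ∂ν := by
            rw [integral_add (integrable_const _) (hHi.const_mul _), integral_const,
              integral_const_mul]
            simp
        _ ≤ _ := by gcongr; exact h.integral_sq_le _
  have h2 : ∫ ω, ‖H (X ω) (ξ ω)‖ ^ 2 ∂P ≤ L * (1 + ∫ ω, ‖X ω - θs‖ ^ 2 ∂P) := by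
    rw [integral_comp_of_indepFun (F := fun θ x => ‖H θ x‖ ^ 2) hX hξ hind hν
      (h.measurable.norm.pow_const 2).stronglyMeasurable hW2]
    have e3 : L * (1 + ∫ ω, ‖X ω - θs‖ ^ 2 ∂P) = ∫ ω, L * (1 + ‖X ω - θs‖ ^ 2) ∂P := by
      rw [integral_const_mul, integral_add (integrable_const _) hZ2]
      simp
    rw [e3]
    refine integral_mono_of_nonneg (ae_of_all _ fun ω => integral_nonneg fun x => by positivity)
      (((integrable_const _).add hZ2).const_mul _) (ae_of_all _ fun ω => h.integral_sq_le _)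
  have h3 := mul_le_mul_of_nonneg_left h1 (by positivity : 0 ≤ 2 * g)
  have h4 := mul_le_mul_of_nonneg_left h2 (by positivity : 0 ≤ g ^ 2)
  linarith

open Complex in
/-- One step of the scheme in terms of characteristic functions: up to an error controlled by the
first two moments of `X - θs`, a step linearizes the drift and multiplies by the factor
`1 - ½ ⟪w, G w⟫` produced by the noise. -/
theorem norm_charFun_step_sub_le (hH : Measurable (Function.uncurry H)) (hX : Measurable X)
    (hξ : Measurable ξ) (hind : IndepFun X ξ P) (hν : P.map ξ = ν)
    (hX2 : MemLp (fun ω => X ω - θs) 2 P) (A G : Vec d →L[ℝ] Vec d)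
    (hG : ∀ w, 0 ≤ inner ℝ w (G w)) {K e η C m₁ m₂ g : ℝ} {v w : Vec d} (hw : w = g • v)
    (hK : 0 ≤ K) (he : 0 ≤ e) (hC : 0 ≤ C)
    (hlin : ∀ θ, ‖(∫ x, H θ x ∂ν) - A (θ - θs)‖ ≤ K * ‖θ - θs‖ ^ 2 + e * ‖θ - θs‖)
    (hexp : ∀ θ, ‖(∫ x, cexp ((-(inner ℝ (H θ x) w) : ℝ) * I) ∂ν)
        - (1 - (inner ℝ (∫ x, H θ x ∂ν) w : ℝ) * I - ((inner ℝ w (G w) / 2 : ℝ) : ℂ))‖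
      ≤ ‖w‖ ^ 2 * (η + C * ‖θ - θs‖ ^ 2))
    (hm₁ : ∫ ω, ‖X ω - θs‖ ∂P ≤ m₁) (hm₂ : ∫ ω, ‖X ω - θs‖ ^ 2 ∂P ≤ m₂) :
    ‖(∫ ω, cexp ((inner ℝ (X ω - g • H (X ω) (ξ ω) - θs) v : ℝ) * I) ∂P)
      - ((1 - inner ℝ w (G w) / 2 : ℝ) : ℂ)
        * ∫ ω, cexp ((inner ℝ (X ω - θs) (v - A.adjoint w) : ℝ) * I) ∂P‖
      ≤ ‖w‖ ^ 2 * (η + C * m₂) + ‖w‖ * (K * m₂ + e * m₁) + 3 * ‖A‖ ^ 2 * ‖w‖ ^ 2 * m₂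
        + ‖G‖ * ‖A‖ * ‖w‖ ^ 3 * m₁ := by
  set s := inner ℝ w (G w) / 2 with hs
  have hs0 : 0 ≤ s := by have := hG w; positivity
  have hsG : s ≤ ‖G‖ * ‖w‖ ^ 2 := by
    have h1 : inner ℝ w (G w) ≤ ‖w‖ * (‖G‖ * ‖w‖) :=
      (real_inner_le_norm _ _).trans (mul_le_mul_of_nonneg_left (G.le_opNorm w) (norm_nonneg _))
    have h2 : 0 ≤ ‖G‖ * ‖w‖ ^ 2 := by positivity
    rw [hs]; linarith
  have hXm : Measurable (fun ω => X ω - θs) := hX.sub_const θs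
  have hZ2 := integrable_norm_sq_of_memLp hX2
  have hZ1 : Integrable (fun ω => ‖X ω - θs‖) P := (hX2.integrable (by norm_num)).norm
  -- the characteristic function of one step, conditionally on the current position
  set J : Vec d → ℂ := fun θ => ∫ x, cexp ((-(inner ℝ (H θ x) w) : ℝ) * I) ∂ν with hJ
  have hnorm : ∀ x : ℝ, ‖cexp (x * I)‖ = 1 := Complex.norm_exp_ofReal_mul_I
  have : IsProbabilityMeasure ν := hν ▸ Measure.isProbabilityMeasure_map hξ.aemeasurable
  have hFm : StronglyMeasurable (Function.uncurry fun (θ : Vec d) (x : Vec q) =>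
      cexp ((inner ℝ (θ - g • H θ x - θs) v : ℝ) * I)) := by
    refine (Complex.measurable_exp.comp
      ((Complex.measurable_ofReal.comp ?_).mul_const I)).stronglyMeasurable
    exact ((measurable_fst.sub (hH.const_smul g)).sub_const θs).inner measurable_const
  have hJm : StronglyMeasurable J := by
    refine StronglyMeasurable.integral_prod_right (ν := ν)
      (f := fun (θ : Vec d) (x : Vec q) => cexp ((-(inner ℝ (H θ x) w) : ℝ) * I)) ?_
    exact (Complex.measurable_exp.comp ((Complex.measurable_ofReal.comp
      (hH.inner measurable_const).neg).mul_const I)).stronglyMeasurable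
  have hcm : ∀ u : Vec d, Measurable (fun ω => cexp ((inner ℝ (X ω - θs) u : ℝ) * I)) :=
    fun u => Complex.measurable_exp.comp ((Complex.measurable_ofReal.comp
      (hXm.inner measurable_const)).mul_const I)
  have hJ1 : ∀ θ, ‖J θ‖ ≤ 1 := by
    intro θ
    refine (norm_integral_le_integral_norm _).trans ?_
    simp only [hnorm]
    simp
  have hlhs : ∫ ω, cexp ((inner ℝ (X ω - g • H (X ω) (ξ ω) - θs) v : ℝ) * I) ∂P
      = ∫ ω, cexp ((inner ℝ (X ω - θs) v : ℝ) * I) * J (X ω) ∂P := by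
    rw [integral_comp_of_indepFun (F := fun θ x =>
      cexp ((inner ℝ (θ - g • H θ x - θs) v : ℝ) * I)) hX hξ hind hν hFm]
    · refine integral_congr_ae (ae_of_all _ fun ω => ?_)
      simp only [hJ]
      rw [← integral_const_mul]
      refine integral_congr_ae (ae_of_all _ fun x => ?_)
      simp only
      rw [← Complex.exp_add, sub_right_comm, inner_sub_left, inner_smul_left, hw,
        inner_smul_right]
      congr 1
      push_cast
      simp
      ring
    · refine Integrable.of_bound (hFm.comp_measurable (hX.prodMk hξ)).aestronglyMeasurable 1
        (ae_of_all _ fun ω => ?_)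
      simp only [hnorm, le_refl]
  have hsplit : ∀ ω, cexp ((inner ℝ (X ω - θs) (v - A.adjoint w) : ℝ) * I)
      = cexp ((inner ℝ (X ω - θs) v : ℝ) * I)
        * cexp ((-(inner ℝ (A (X ω - θs)) w) : ℝ) * I) := by
    intro ω
    rw [← Complex.exp_add, inner_sub_right, ContinuousLinearMap.adjoint_inner_right]
    congr 1
    push_cast
    ring
  rw [hlhs, ← integral_const_mul, ← integral_sub]
  rotate_left
  · refine Integrable.of_bound (((hcm v).mul
      (hJm.measurable.comp hX)).aestronglyMeasurable) 1 (ae_of_all _ fun ω => ?_)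
    rw [norm_mul, hnorm, one_mul]
    exact hJ1 _
  · refine (Integrable.of_bound (hcm _).aestronglyMeasurable 1
      (ae_of_all _ fun ω => ?_)).const_mul _
    rw [hnorm]
  have hbound : ∀ ω, ‖cexp ((inner ℝ (X ω - θs) v : ℝ) * I) * J (X ω)
      - ((1 - s : ℝ) : ℂ) * cexp ((inner ℝ (X ω - θs) (v - A.adjoint w) : ℝ) * I)‖
      ≤ ‖w‖ ^ 2 * (η + C * ‖X ω - θs‖ ^ 2) + ‖w‖ * (K * ‖X ω - θs‖ ^ 2 + e * ‖X ω - θs‖)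
        + 3 * ‖A‖ ^ 2 * ‖w‖ ^ 2 * ‖X ω - θs‖ ^ 2 + ‖G‖ * ‖A‖ * ‖w‖ ^ 3 * ‖X ω - θs‖ := by
    intro ω
    set θ := X ω
    set a := inner ℝ (∫ x, H θ x ∂ν) w with ha
    set b := inner ℝ (A (θ - θs)) w with hb
    have hba : |b| ≤ ‖A‖ * ‖θ - θs‖ * ‖w‖ :=
      (abs_real_inner_le_norm _ _).trans
        (mul_le_mul_of_nonneg_right (A.le_opNorm _) (norm_nonneg _))
    have hab : |b - a| ≤ ‖w‖ * (K * ‖θ - θs‖ ^ 2 + e * ‖θ - θs‖) := by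
      rw [abs_sub_comm, ha, hb, ← inner_sub_left]
      refine (abs_real_inner_le_norm _ _).trans ?_
      rw [mul_comm]
      exact mul_le_mul_of_nonneg_left (hlin θ) (norm_nonneg _)
    -- expansion of `J θ`, linearization of the mean field, Taylor expansion of the linear drift,
    -- and the cross term between noise and drift
    have e1 : cexp ((inner ℝ (θ - θs) v : ℝ) * I) * J θ
        - ((1 - s : ℝ) : ℂ) * cexp ((inner ℝ (θ - θs) (v - A.adjoint w) : ℝ) * I)
        = cexp ((inner ℝ (θ - θs) v : ℝ) * I) * ((J θ - (1 - a * I - (s : ℂ)))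
          + ((b - a : ℝ) : ℂ) * I - (cexp ((-b : ℝ) * I) - (1 + (-b : ℝ) * I))
          + (s : ℂ) * (cexp ((-b : ℝ) * I) - 1)) := by
      rw [hsplit]
      push_cast
      ring
    rw [e1, norm_mul, hnorm, one_mul]
    have n1 := hexp θ
    have n2 : ‖((b - a : ℝ) : ℂ) * I‖ ≤ ‖w‖ * (K * ‖θ - θs‖ ^ 2 + e * ‖θ - θs‖) := by
      rw [norm_mul, Complex.norm_I, mul_one, Complex.norm_real]
      exact hab
    have n3 : ‖cexp ((-b : ℝ) * I) - (1 + (-b : ℝ) * I)‖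
        ≤ 3 * ‖A‖ ^ 2 * ‖w‖ ^ 2 * ‖θ - θs‖ ^ 2 := by
      refine (norm_cexp_ofReal_mul_I_sub_le (-b)).trans ?_
      have : b ^ 2 ≤ (‖A‖ * ‖θ - θs‖ * ‖w‖) ^ 2 := by
        rw [← sq_abs b]
        exact pow_le_pow_left₀ (abs_nonneg _) hba 2
      rw [neg_sq]
      linarith [this, mul_pow (‖A‖ * ‖θ - θs‖) ‖w‖ 2, mul_pow ‖A‖ ‖θ - θs‖ 2]
    have n4 : ‖(s : ℂ) * (cexp ((-b : ℝ) * I) - 1)‖ ≤ ‖G‖ * ‖A‖ * ‖w‖ ^ 3 * ‖θ - θs‖ := by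
      rw [norm_mul, Complex.norm_real, Real.norm_eq_abs, abs_of_nonneg hs0]
      have h1 := norm_cexp_ofReal_mul_I_sub_one_le (-b)
      rw [abs_neg] at h1
      calc s * ‖cexp ((-b : ℝ) * I) - 1‖
          ≤ (‖G‖ * ‖w‖ ^ 2) * (‖A‖ * ‖θ - θs‖ * ‖w‖) :=
            mul_le_mul hsG (h1.trans hba) (norm_nonneg _) (by positivity)
        _ = _ := by ring
    refine (norm_add_le _ _).trans (add_le_add ((norm_sub_le _ _).trans
      (add_le_add ((norm_add_le _ _).trans (add_le_add n1 n2)) n3)) n4)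
  have i1 : Integrable (fun ω => ‖w‖ ^ 2 * (η + C * ‖X ω - θs‖ ^ 2)) P :=
    ((integrable_const _).add (hZ2.const_mul _)).const_mul _
  have i2 : Integrable (fun ω => ‖w‖ * (K * ‖X ω - θs‖ ^ 2 + e * ‖X ω - θs‖)) P :=
    ((hZ2.const_mul _).add (hZ1.const_mul _)).const_mul _
  have i3 : Integrable (fun ω => 3 * ‖A‖ ^ 2 * ‖w‖ ^ 2 * ‖X ω - θs‖ ^ 2) P := hZ2.const_mul _
  have i4 : Integrable (fun ω => ‖G‖ * ‖A‖ * ‖w‖ ^ 3 * ‖X ω - θs‖) P := hZ1.const_mul _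
  refine (norm_integral_le_of_norm_le (((i1.add i2).add i3).add i4)
    (ae_of_all _ hbound)).trans ?_
  have e2 : ∫ ω, (‖w‖ ^ 2 * (η + C * ‖X ω - θs‖ ^ 2)
      + ‖w‖ * (K * ‖X ω - θs‖ ^ 2 + e * ‖X ω - θs‖)
      + 3 * ‖A‖ ^ 2 * ‖w‖ ^ 2 * ‖X ω - θs‖ ^ 2 + ‖G‖ * ‖A‖ * ‖w‖ ^ 3 * ‖X ω - θs‖) ∂P
      = ‖w‖ ^ 2 * (η + C * ∫ ω, ‖X ω - θs‖ ^ 2 ∂P)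
        + ‖w‖ * (K * ∫ ω, ‖X ω - θs‖ ^ 2 ∂P + e * ∫ ω, ‖X ω - θs‖ ∂P)
        + 3 * ‖A‖ ^ 2 * ‖w‖ ^ 2 * ∫ ω, ‖X ω - θs‖ ^ 2 ∂P
        + ‖G‖ * ‖A‖ * ‖w‖ ^ 3 * ∫ ω, ‖X ω - θs‖ ∂P := by
    rw [integral_add ((i1.add i2).add i3 : Integrable (fun ω => _ + _ + _) P) i4,
      integral_add (i1.add i2 : Integrable (fun ω => _ + _) P) i3, integral_add i1 i2,
      integral_const_mul, integral_const_mul, integral_const_mul, integral_const_mul,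
      integral_add (integrable_const _) (hZ2.const_mul _),
      integral_add (hZ2.const_mul _) (hZ1.const_mul _), integral_const_mul, integral_const_mul,
      integral_const_mul]
    simp
  refine (le_of_eq e2).trans ?_
  gcongr

end Step

/-! ### Characteristic functions of the innovations -/

section Innovation

open Complex

variable {d q : ℕ} {ν : Measure (Vec q)} {W : Vec q → Vec d}

theorem integrable_inner_sq_of_memLp (hW : MemLp W 2 ν) (w : Vec d) :
    Integrable (fun x => (inner ℝ (W x) w) ^ 2) ν := by
  refine Integrable.mono' ((integrable_norm_sq_of_memLp hW).mul_const (‖w‖ ^ 2))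
    ((hW.1.inner aestronglyMeasurable_const).pow 2) (ae_of_all _ fun x => ?_)
  rw [Real.norm_eq_abs, abs_of_nonneg (sq_nonneg _), ← mul_pow, ← sq_abs]
  exact pow_le_pow_left₀ (abs_nonneg _) (abs_real_inner_le_norm _ _) 2

theorem integral_cexp_inner_sub_eq [IsProbabilityMeasure ν] (hW : MemLp W 2 ν) (w : Vec d) (s : ℝ) :
    (∫ x, cexp ((-(inner ℝ (W x) w) : ℝ) * I) ∂ν)
      - (1 - (inner ℝ (∫ x, W x ∂ν) w : ℝ) * I - (s : ℂ))
    = (∫ x, (cexp ((-(inner ℝ (W x) w) : ℝ) * I) - (1 + (-(inner ℝ (W x) w) : ℝ) * I)) ∂ν) + s := by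
  have hWi := hW.integrable (by norm_num)
  have h1 : Integrable (fun x => ((-(inner ℝ (W x) w) : ℝ) : ℂ) * I) ν :=
    (((hWi.inner_const w).neg).ofReal).mul_const I
  have h2 : Integrable (fun x => cexp ((-(inner ℝ (W x) w) : ℝ) * I)) ν := by
    refine Integrable.of_bound ?_ 1 (ae_of_all _ fun x => ?_)
    · exact Complex.continuous_exp.comp_aestronglyMeasurable h1.1
    · rw [Complex.norm_exp_ofReal_mul_I]
  have h3 : Integrable (fun x => 1 + ((-(inner ℝ (W x) w) : ℝ) : ℂ) * I) ν :=
    (integrable_const _).add h1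
  rw [integral_sub h2 h3, integral_add (integrable_const _) h1, integral_mul_const,
    integral_complex_ofReal, integral_neg]
  have h4 : ∫ x, inner ℝ (W x) w ∂ν = inner ℝ (∫ x, W x ∂ν) w := by
    simp only [real_inner_comm w]
    rw [integral_inner hWi]
  rw [h4]
  simp
  ring

theorem norm_charFun_innovation_sub_le [IsProbabilityMeasure ν] (hW : MemLp W 2 ν)
    (G : Vec d →L[ℝ] Vec d) (w : Vec d) :
    ‖(∫ x, cexp ((-(inner ℝ (W x) w) : ℝ) * I) ∂ν)
      - (1 - (inner ℝ (∫ x, W x ∂ν) w : ℝ) * I - ((inner ℝ w (G w) / 2 : ℝ) : ℂ))‖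
    ≤ ‖w‖ ^ 2 * (3 * ∫ x, ‖W x‖ ^ 2 ∂ν + ‖G‖) := by
  rw [integral_cexp_inner_sub_eq hW]
  have hW2 := integrable_norm_sq_of_memLp hW
  refine (norm_add_le _ _).trans ?_
  rw [mul_add]
  refine add_le_add ?_ ?_
  · refine (norm_integral_le_of_norm_le (g := fun x => ‖w‖ ^ 2 * (3 * ‖W x‖ ^ 2))
      ((hW2.const_mul _).const_mul _) (ae_of_all _ fun x => ?_)).trans (le_of_eq ?_)
    · refine (norm_cexp_ofReal_mul_I_sub_le _).trans ?_
      have h1 : (inner ℝ (W x) w) ^ 2 ≤ (‖W x‖ * ‖w‖) ^ 2 := by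
        rw [← sq_abs]
        exact pow_le_pow_left₀ (abs_nonneg _) (abs_real_inner_le_norm _ _) 2
      rw [neg_sq]
      linarith [mul_pow ‖W x‖ ‖w‖ 2]
    · rw [integral_const_mul, integral_const_mul]
  · rw [Complex.norm_real, Real.norm_eq_abs, abs_div, abs_two]
    have h1 : |inner ℝ w (G w)| ≤ ‖w‖ * (‖G‖ * ‖w‖) :=
      (abs_real_inner_le_norm _ _).trans (mul_le_mul_of_nonneg_left (G.le_opNorm w) (norm_nonneg _))
    have h2 : 0 ≤ ‖w‖ ^ 2 * ‖G‖ := by positivity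
    linarith

theorem norm_charFun_innovation_sub_le_rpow [IsProbabilityMeasure ν] (hW : MemLp W 2 ν)
    {δ ε : ℝ} (hδ : 0 < δ) (hε : 0 < ε) (hWδ : Integrable (fun x => ‖W x‖ ^ (2 + δ)) ν)
    (w : Vec d) (s : ℝ) :
    ‖(∫ x, cexp ((-(inner ℝ (W x) w) : ℝ) * I) ∂ν)
      - (1 - (inner ℝ (∫ x, W x ∂ν) w : ℝ) * I - ((s / 2 : ℝ) : ℂ))‖
    ≤ ‖w‖ ^ 2 * (4 * ε * ∫ x, ‖W x‖ ^ 2 ∂ν)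
      + ‖w‖ ^ 2 * (4 * ε ^ (-δ) * ‖w‖ ^ δ * ∫ x, ‖W x‖ ^ (2 + δ) ∂ν)
      + |(∫ x, (inner ℝ (W x) w) ^ 2 ∂ν) - s| / 2 := by
  have hW2 := integrable_norm_sq_of_memLp hW
  have hin := integrable_inner_sq_of_memLp hW w
  have e1 : (∫ x, cexp ((-(inner ℝ (W x) w) : ℝ) * I) ∂ν)
      - (1 - (inner ℝ (∫ x, W x ∂ν) w : ℝ) * I - ((s / 2 : ℝ) : ℂ))
      = (∫ x, (cexp ((-(inner ℝ (W x) w) : ℝ) * I) - (1 + (-(inner ℝ (W x) w) : ℝ) * I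
          - ((-(inner ℝ (W x) w)) ^ 2 / 2 : ℝ))) ∂ν)
        + ((-(((∫ x, (inner ℝ (W x) w) ^ 2 ∂ν) - s) / 2) : ℝ) : ℂ) := by
    rw [integral_cexp_inner_sub_eq hW]
    have hWi := hW.integrable (by norm_num)
    have h1 : Integrable (fun x => ((-(inner ℝ (W x) w) : ℝ) : ℂ) * I) ν :=
      (((hWi.inner_const w).neg).ofReal).mul_const I
    have h2 : Integrable (fun x => cexp ((-(inner ℝ (W x) w) : ℝ) * I)) ν := by
      refine Integrable.of_bound ?_ 1 (ae_of_all _ fun x => ?_)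
      · exact Complex.continuous_exp.comp_aestronglyMeasurable h1.1
      · rw [Complex.norm_exp_ofReal_mul_I]
    have h3 : Integrable (fun x => cexp ((-(inner ℝ (W x) w) : ℝ) * I)
        - (1 + ((-(inner ℝ (W x) w) : ℝ) : ℂ) * I)) ν := h2.sub ((integrable_const _).add h1)
    have h4 : Integrable (fun x => (((-(inner ℝ (W x) w)) ^ 2 / 2 : ℝ) : ℂ)) ν := by
      simp only [neg_sq]
      exact (hin.div_const 2).ofReal
    have h5 : ∀ x, cexp ((-(inner ℝ (W x) w) : ℝ) * I) - (1 + (-(inner ℝ (W x) w) : ℝ) * I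
          - ((-(inner ℝ (W x) w)) ^ 2 / 2 : ℝ))
        = (cexp ((-(inner ℝ (W x) w) : ℝ) * I) - (1 + (-(inner ℝ (W x) w) : ℝ) * I))
          + ((-(inner ℝ (W x) w)) ^ 2 / 2 : ℝ) := fun x => by ring
    simp only [h5]
    rw [integral_add h3 h4, integral_complex_ofReal, integral_div]
    simp only [neg_sq]
    push_cast
    ring
  rw [e1]
  refine (norm_add_le _ _).trans (add_le_add ?_ ?_)
  · have hb1 : Integrable (fun x => ‖w‖ ^ 2 * (4 * ε * ‖W x‖ ^ 2)) ν :=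
      (hW2.const_mul _).const_mul _
    have hb2 : Integrable (fun x => ‖w‖ ^ 2 * (4 * ε ^ (-δ) * ‖w‖ ^ δ * ‖W x‖ ^ (2 + δ))) ν :=
      (hWδ.const_mul _).const_mul _
    refine (norm_integral_le_of_norm_le (hb1.add hb2) (ae_of_all _ fun x => ?_)).trans
      (le_of_eq ?_)
    · refine (norm_cexp_taylor_le_rpow hε hδ _).trans ?_
      have h0 : |-(inner ℝ (W x) w)| ≤ ‖W x‖ * ‖w‖ := by
        rw [abs_neg]; exact abs_real_inner_le_norm _ _
      have h1 : (-(inner ℝ (W x) w)) ^ 2 ≤ (‖W x‖ * ‖w‖) ^ 2 := by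
        rw [← sq_abs]
        exact pow_le_pow_left₀ (abs_nonneg _) h0 2
      have h2 : |-(inner ℝ (W x) w)| ^ (2 + δ) ≤ ‖W x‖ ^ (2 + δ) * (‖w‖ ^ 2 * ‖w‖ ^ δ) := by
        refine (Real.rpow_le_rpow (abs_nonneg _) h0 (by positivity)).trans (le_of_eq ?_)
        rw [Real.mul_rpow (norm_nonneg _) (norm_nonneg _)]
        congr 1
        rw [← Real.rpow_two, ← Real.rpow_add_of_nonneg (norm_nonneg _) (by norm_num) hδ.le]
      have h3 := mul_le_mul_of_nonneg_left h1 hε.le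
      have h4 := mul_le_mul_of_nonneg_left h2 (Real.rpow_nonneg hε.le (-δ))
      simp only [Pi.add_apply]
      linarith [mul_pow ‖W x‖ ‖w‖ 2, congrArg (ε * ·) (mul_pow ‖W x‖ ‖w‖ 2)]
    · refine (integral_add hb1 hb2).trans ?_
      rw [integral_const_mul, integral_const_mul, integral_const_mul,
        integral_const_mul]
  · rw [Complex.norm_real, Real.norm_eq_abs, abs_neg, abs_div, abs_two]

/-- Second-order expansion of the characteristic function of the innovations, uniform in the
position `θ` and along the family `ν`. Near `θs` it rests on the moments of order `2 + δ` and on the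
convergence of the covariances; away from `θs` the quadratic term on the right absorbs the crude
bound given by the second moments. -/
theorem eventually_norm_charFun_innovation_le {ι : Type*} {l : Filter ι}
    {H : Vec d → Vec q → Vec d} {ν : ι → Measure (Vec q)} (hν : ∀ i, IsProbabilityMeasure (ν i))
    {θn : ι → Vec d} {θs : Vec d} (hθ : Tendsto θn l (𝓝 θs)) {L lam δ : ℝ} (hL : 0 ≤ L)
    (hδ : 0 < δ) (G : Vec d →L[ℝ] Vec d)
    (hadm : ∀ᶠ i in l, IsAdmissible H (ν i) (θn i) L lam)
    (hmom : ∀ R : ℝ, 0 < R → ∃ C : ℝ, ∀ i θ, ‖θ‖ ≤ R →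
      Integrable (fun x => ‖H θ x‖ ^ (2 + δ)) (ν i) ∧ ∫ x, ‖H θ x‖ ^ (2 + δ) ∂(ν i) ≤ C)
    (hcov : ∀ ε > 0, ∃ r > 0, ∀ᶠ i in l, ∀ θ, ‖θ - θs‖ < r → ∀ w,
      |(∫ x, (inner ℝ (H θ x) w) ^ 2 ∂(ν i)) - inner ℝ w (G w)| ≤ ε * ‖w‖ ^ 2)
    {η : ℝ} (hη : 0 < η) :
    ∃ C : ℝ, 0 ≤ C ∧ ∃ τ : ℝ, 0 < τ ∧ ∀ᶠ i in l, ∀ θ w, ‖w‖ ≤ τ →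
      ‖(∫ x, cexp ((-(inner ℝ (H θ x) w) : ℝ) * I) ∂(ν i))
        - (1 - (inner ℝ (∫ x, H θ x ∂(ν i)) w : ℝ) * I - ((inner ℝ w (G w) / 2 : ℝ) : ℂ))‖
      ≤ ‖w‖ ^ 2 * (η + C * ‖θ - θn i‖ ^ 2) := by
  obtain ⟨r, hr, hcov⟩ := hcov (η / 3) (by positivity)
  obtain ⟨C', hC'⟩ := hmom (‖θs‖ + r) (by positivity)
  set ε := η / (12 * (L + 1)) with hεdef
  have hε : 0 < ε := by positivity
  have hεL : 4 * ε * L ≤ η / 3 := by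
    rw [hεdef, mul_div_assoc', div_mul_eq_mul_div, div_le_div_iff₀ (by positivity) (by positivity)]
    nlinarith
  have hεδ : 0 < ε ^ (-δ) := Real.rpow_pos_of_pos hε _
  set y := η / (12 * ε ^ (-δ) * (|C'| + 1)) with hydef
  have hy : 0 < y := by positivity
  -- `y` bounds `‖w‖ ^ δ`; the factor `4 / r ^ 2` is used where `‖θ - θn i‖ ≥ r / 2`
  refine ⟨η + 3 * L + (3 * L + ‖G‖) * (4 / r ^ 2), by positivity, y ^ δ⁻¹, by positivity, ?_⟩
  filter_upwards [hadm, hcov, hθ.eventually (Metric.ball_mem_nhds θs (half_pos hr))]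
    with i hadm hcov hθi θ w hw
  have := hν i
  have hL2 := hadm.integral_sq_le θ
  rcases lt_or_ge ‖θ - θn i‖ (r / 2) with hnear | hfar
  · have hd : ‖θ - θs‖ < r := by
      have h1 : ‖θn i - θs‖ < r / 2 := by rwa [dist_eq_norm] at hθi
      calc ‖θ - θs‖ = ‖(θ - θn i) + (θn i - θs)‖ := by congr 1; abel
        _ ≤ ‖θ - θn i‖ + ‖θn i - θs‖ := norm_add_le _ _
        _ < r := by linarith
    have hR : ‖θ‖ ≤ ‖θs‖ + r := by
      calc ‖θ‖ = ‖θs + (θ - θs)‖ := by congr 1; abel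
        _ ≤ ‖θs‖ + ‖θ - θs‖ := norm_add_le _ _
        _ ≤ _ := by linarith
    obtain ⟨hint, hle⟩ := hC' i θ hR
    refine (norm_charFun_innovation_sub_le_rpow (hadm.memLp θ) hδ hε hint w _).trans ?_
    have h1 : 4 * ε * ∫ x, ‖H θ x‖ ^ 2 ∂(ν i) ≤ η / 3 + η * ‖θ - θn i‖ ^ 2 := by
      have h2 := mul_le_mul_of_nonneg_left hL2 (by positivity : 0 ≤ 4 * ε)
      have h3 := mul_le_mul_of_nonneg_right hεL (by positivity : 0 ≤ 1 + ‖θ - θn i‖ ^ 2)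
      have h4 : 0 ≤ η * ‖θ - θn i‖ ^ 2 := by positivity
      linarith
    have h2 : 4 * ε ^ (-δ) * ‖w‖ ^ δ * ∫ x, ‖H θ x‖ ^ (2 + δ) ∂(ν i) ≤ η / 3 := by
      have h3 : ‖w‖ ^ δ ≤ y := by
        refine (Real.rpow_le_rpow (norm_nonneg _) hw hδ.le).trans (le_of_eq ?_)
        exact Real.rpow_inv_rpow hy.le hδ.ne'
      have h4 : ∫ x, ‖H θ x‖ ^ (2 + δ) ∂(ν i) ≤ |C'| + 1 := by
        linarith [le_abs_self C']
      calc 4 * ε ^ (-δ) * ‖w‖ ^ δ * ∫ x, ‖H θ x‖ ^ (2 + δ) ∂(ν i)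
          ≤ 4 * ε ^ (-δ) * y * (|C'| + 1) := by
            refine mul_le_mul ?_ h4 (integral_nonneg fun x => by positivity) (by positivity)
            exact mul_le_mul_of_nonneg_left h3 (by positivity)
        _ = η / 3 := by
            rw [hydef]
            have : |C'| + 1 ≠ 0 := by positivity
            field_simp
            norm_num
    have h3 := hcov θ hd w
    have h4 := mul_le_mul_of_nonneg_left h1 (sq_nonneg ‖w‖)
    have h5 := mul_le_mul_of_nonneg_left h2 (sq_nonneg ‖w‖)
    have h6 : 0 ≤ ‖w‖ ^ 2 * ((3 * L + (3 * L + ‖G‖) * (4 / r ^ 2)) * ‖θ - θn i‖ ^ 2) := by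
      positivity
    have h7 : 0 ≤ η * ‖w‖ ^ 2 := by positivity
    linarith
  · refine (norm_charFun_innovation_sub_le (hadm.memLp θ) G w).trans ?_
    refine mul_le_mul_of_nonneg_left ?_ (sq_nonneg _)
    have h1 : 1 ≤ 4 / r ^ 2 * ‖θ - θn i‖ ^ 2 := by
      rw [div_mul_eq_mul_div, one_le_div (by positivity)]
      have := pow_le_pow_left₀ (by positivity) hfar 2
      linarith [div_pow r 2 2]
    have h2 := mul_le_mul_of_nonneg_left h1 (by positivity : 0 ≤ 3 * L + ‖G‖)
    have h3 : 0 ≤ η * ‖θ - θn i‖ ^ 2 := by positivity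
    linarith

end Innovation

/-! ### The recursion on characteristic functions -/

section CharFunRecursion

open Complex

variable {d : ℕ} {g c : ℕ → ℝ} {ζ lam : ℝ} {A G S : Vec d →L[ℝ] Vec d}

theorem abs_inner_clm_le (T : Vec d →L[ℝ] Vec d) (x y : Vec d) :
    |inner ℝ x (T y)| ≤ ‖T‖ * (‖x‖ * ‖y‖) := by
  have := (abs_real_inner_le_norm x (T y)).trans
    (mul_le_mul_of_nonneg_left (T.le_opNorm y) (norm_nonneg x))
  linarith

/-- The frequency at which the normalized characteristic function at time `p` has to be evaluated in
order to obtain the one at time `p + 1` and frequency `u`. -/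
noncomputable def prevFrequency (g c : ℕ → ℝ) (A : Vec d →L[ℝ] Vec d) (p : ℕ) (u : Vec d) : Vec d :=
  √(c p / c (p + 1)) • (u - g p • A.adjoint u)

theorem smul_prevFrequency (hc : ∀ p, 0 < c p) (p : ℕ) (u : Vec d) :
    (√(c p))⁻¹ • prevFrequency g c A p u
      = (√(c (p + 1)))⁻¹ • u - A.adjoint ((g p / √(c (p + 1))) • u) := by
  have h1 := (Real.sqrt_pos.2 (hc p)).ne'
  have h2 := (Real.sqrt_pos.2 (hc (p + 1))).ne'
  have h3 : (√(c p))⁻¹ * (√(c p) / √(c (p + 1))) = (√(c (p + 1)))⁻¹ := by field_simp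
  rw [prevFrequency, Real.sqrt_div' _ (hc (p + 1)).le, smul_smul, h3, smul_sub, map_smul, smul_smul]
  congr 2
  rw [div_eq_inv_mul]

theorem norm_prevFrequency_sq (hc : ∀ p, 0 < c p) (p : ℕ) (u : Vec d) :
    ‖prevFrequency g c A p u‖ ^ 2 = c p / c (p + 1)
      * (‖u‖ ^ 2 - 2 * g p * inner ℝ u (A u) + g p ^ 2 * ‖A.adjoint u‖ ^ 2) := by
  have h1 : 0 ≤ c p / c (p + 1) := (div_pos (hc p) (hc (p + 1))).le
  rw [prevFrequency, norm_smul, mul_pow, Real.norm_eq_abs, sq_abs, Real.sq_sqrt h1,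
    norm_sub_sq_real, inner_smul_right, norm_smul, mul_pow, Real.norm_eq_abs, sq_abs,
    ContinuousLinearMap.adjoint_inner_right, real_inner_comm u (A u)]
  ring

/-- The backward frequencies contract at the rate `(lam - ζ) / 2` per unit of step. -/
theorem eventually_norm_prevFrequency_le (h : IsStepGauge g c ζ) (hlam : ζ < lam)
    (hA : ∀ v, lam * ‖v‖ ^ 2 ≤ inner ℝ v (A v)) :
    ∀ᶠ p in atTop, ∀ u, ‖prevFrequency g c A p u‖ ≤ (1 - (lam - ζ) / 2 * g p) * ‖u‖ := by
  have hκ := sub_pos.2 hlam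
  filter_upwards [h.eventually_contraction hlam (‖A‖ ^ 2),
    h.tendsto_step.eventually_lt_const (by positivity : (0 : ℝ) < 1 / (lam - ζ))] with p hp hp2 u
  have hg := h.step_pos p
  rw [lt_div_iff₀ hκ] at hp2
  have hq : 0 ≤ c p / c (p + 1) := (div_pos (h.gauge_pos p) (h.gauge_pos (p + 1))).le
  refine le_of_sq_le_sq ?_ (mul_nonneg (by nlinarith) (norm_nonneg _))
  rw [norm_prevFrequency_sq h.gauge_pos, mul_pow]
  have h1 : ‖A.adjoint u‖ ^ 2 ≤ (‖A‖ * ‖u‖) ^ 2 := by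
    refine pow_le_pow_left₀ (norm_nonneg _) ?_ 2
    have := A.adjoint.le_opNorm u
    rwa [LinearIsometryEquiv.norm_map] at this
  have h2 : ‖u‖ ^ 2 - 2 * g p * inner ℝ u (A u) + g p ^ 2 * ‖A.adjoint u‖ ^ 2
      ≤ (1 - 2 * lam * g p + ‖A‖ ^ 2 * g p ^ 2) * ‖u‖ ^ 2 := by
    have h3 := mul_le_mul_of_nonneg_left (hA u) (by positivity : 0 ≤ 2 * g p)
    have h4 := mul_le_mul_of_nonneg_left h1 (by positivity : 0 ≤ g p ^ 2)
    linarith [congrArg (g p ^ 2 * ·) (mul_pow ‖A‖ ‖u‖ 2)]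
  calc c p / c (p + 1) * (‖u‖ ^ 2 - 2 * g p * inner ℝ u (A u) + g p ^ 2 * ‖A.adjoint u‖ ^ 2)
      ≤ c p / c (p + 1) * ((1 - 2 * lam * g p + ‖A‖ ^ 2 * g p ^ 2) * ‖u‖ ^ 2) :=
        mul_le_mul_of_nonneg_left h2 hq
    _ = (c p / c (p + 1) * (1 - 2 * lam * g p + ‖A‖ ^ 2 * g p ^ 2)) * ‖u‖ ^ 2 := by ring
    _ ≤ (1 - (lam - ζ) * g p) * ‖u‖ ^ 2 := mul_le_mul_of_nonneg_right hp (sq_nonneg _)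
    _ ≤ (1 - (lam - ζ) / 2 * g p) ^ 2 * ‖u‖ ^ 2 := by
        refine mul_le_mul_of_nonneg_right ?_ (sq_nonneg _)
        nlinarith [sq_nonneg ((lam - ζ) / 2 * g p)]

/-- The Gaussian characteristic function with covariance `S` is invariant under one step of the
recursion up to `o(g p)`: the terms of first order in `g p` cancel by the Lyapunov equation. -/
theorem exists_gaussian_step_error (h : IsStepGauge g c ζ)
    (hG : ∀ w, 0 ≤ inner ℝ w (G w)) (hS : ∀ w, 0 ≤ inner ℝ w (S w))
    (hSsymm : ∀ x y, inner ℝ x (S y) = inner ℝ y (S x))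
    (hLyap : ∀ u, inner ℝ u (G u) = 2 * inner ℝ (A.adjoint u) (S u) - 2 * ζ * inner ℝ u (S u))
    (R : ℝ) :
    ∃ e : ℕ → ℝ, Tendsto e atTop (𝓝 0) ∧ ∀ p u, ‖u‖ ≤ R →
      |(1 - inner ℝ ((g p / √(c (p + 1))) • u) (G ((g p / √(c (p + 1))) • u)) / 2)
          * Real.exp (-(inner ℝ (prevFrequency g c A p u) (S (prevFrequency g c A p u)) / 2))
        - Real.exp (-(inner ℝ u (S u) / 2))| ≤ g p * ‖u‖ * e p := by
  set ρ : ℕ → ℝ := fun p => g p / c (p + 1) with hρ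
  set k : ℕ → ℝ := fun p => c p / c (p + 1) with hk
  set r : ℕ → ℝ := fun p => (c p / c (p + 1) - 1) / g p with hr
  have hρ1 : Tendsto ρ atTop (𝓝 1) := by
    have := h.tendsto_ratio.inv₀ one_ne_zero
    rw [inv_one] at this
    exact this.congr fun p => inv_div _ _
  have hρpos : ∀ p, 0 < ρ p := fun p => div_pos (h.step_pos p) (h.gauge_pos _)
  have hkpos : ∀ p, 0 < k p := fun p => div_pos (h.gauge_pos p) (h.gauge_pos _)
  refine ⟨fun p => g p * ρ p ^ 2 * ‖G‖ ^ 2 * R ^ 3 + R * (|r p - 2 * ζ| * ‖S‖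
    + 2 * |1 - k p| * (‖A‖ * ‖S‖) + k p * g p * (‖A‖ ^ 2 * ‖S‖) + |ρ p - 1| * ‖G‖), ?_, ?_⟩
  · have t1 : Tendsto (fun p => |r p - 2 * ζ|) atTop (𝓝 0) := by
      have := (h.tendsto_drift.sub_const (2 * ζ)).abs
      rwa [sub_self, abs_zero] at this
    have t2 : Tendsto (fun p => |1 - k p|) atTop (𝓝 0) := by
      have := (h.tendsto_gauge_ratio.const_sub 1).abs
      rwa [sub_self, abs_zero] at this
    have t3 : Tendsto (fun p => |ρ p - 1|) atTop (𝓝 0) := by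
      have := (hρ1.sub_const 1).abs
      rwa [sub_self, abs_zero] at this
    have t4 := ((h.tendsto_step.mul (hρ1.pow 2)).mul_const (‖G‖ ^ 2)).mul_const (R ^ 3)
    have t5 := (((t1.mul_const ‖S‖).add ((t2.const_mul 2).mul_const (‖A‖ * ‖S‖))).add
      ((h.tendsto_gauge_ratio.mul h.tendsto_step).mul_const (‖A‖ ^ 2 * ‖S‖))).add
      (t3.mul_const ‖G‖)
    have t6 := t4.add (t5.const_mul R)
    simpa using t6
  · intro p u hu
    have hR : 0 ≤ R := (norm_nonneg u).trans hu
    have hg := h.step_pos p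
    have hc' := h.gauge_pos (p + 1)
    set a := A.adjoint u with ha
    have haA : ‖a‖ ≤ ‖A‖ * ‖u‖ := by
      have := A.adjoint.le_opNorm u
      rwa [LinearIsometryEquiv.norm_map] at this
    have hw : inner ℝ ((g p / √(c (p + 1))) • u) (G ((g p / √(c (p + 1))) • u))
        = g p * ρ p * inner ℝ u (G u) := by
      have h1 : g p / √(c (p + 1)) * (g p / √(c (p + 1))) = g p * ρ p := by
        rw [div_mul_div_comm, Real.mul_self_sqrt hc'.le, hρ]
        ring
      rw [map_smul, inner_smul_left, inner_smul_right, ← mul_assoc, conj_trivial, h1]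
    have hu' : inner ℝ (prevFrequency g c A p u) (S (prevFrequency g c A p u))
        = k p * (inner ℝ u (S u) - 2 * g p * inner ℝ a (S u) + g p ^ 2 * inner ℝ a (S a)) := by
      rw [prevFrequency, map_smul, inner_smul_left, inner_smul_right, ← mul_assoc, conj_trivial,
        Real.mul_self_sqrt (hkpos p).le, map_sub, map_smul, inner_sub_left, inner_sub_right,
        inner_sub_right, inner_smul_left, inner_smul_right, inner_smul_left, inner_smul_right,
        hSsymm u a]
      simp only [conj_trivial]
      ring
    have hS' := hS (prevFrequency g c A p u)
    have hGu := hG u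
    rw [hw]
    set s := g p * ρ p * inner ℝ u (G u) / 2 with hs
    have hs0 : 0 ≤ s := by
      have := hρpos p
      positivity
    refine (abs_one_sub_mul_exp_sub_exp_le (by linarith) (by linarith [hS u]) hs0).trans ?_
    have hsle : s ≤ g p * ρ p * (‖G‖ * ‖u‖ ^ 2) := by
      have h1 := (le_abs_self _).trans (abs_inner_clm_le G u u)
      have h2 := mul_le_mul_of_nonneg_left h1 (mul_pos hg (hρpos p)).le
      have h3 : 0 ≤ g p * ρ p * inner ℝ u (G u) := mul_nonneg (mul_pos hg (hρpos p)).le hGu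
      rw [hs]
      linarith [congrArg (g p * ρ p * ‖G‖ * ·) (sq ‖u‖)]
    have b1 : s ^ 2 ≤ g p * ‖u‖ * (g p * ρ p ^ 2 * ‖G‖ ^ 2 * R ^ 3) := by
      have h1 := pow_le_pow_left₀ hs0 hsle 2
      have h2 : ‖u‖ ^ 3 ≤ R ^ 3 := pow_le_pow_left₀ (norm_nonneg _) hu 3
      have h3 := mul_le_mul_of_nonneg_left h2
        (by positivity : 0 ≤ g p * ‖u‖ * (g p * ρ p ^ 2 * ‖G‖ ^ 2))
      refine h1.trans (le_trans (le_of_eq ?_) (h3.trans (le_of_eq ?_))) <;> ring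
    have hdrift : k p = 1 + r p * g p := by
      rw [hk, hr]
      simp only
      rw [div_mul_cancel₀ _ hg.ne']
      ring
    have e1 : inner ℝ (prevFrequency g c A p u) (S (prevFrequency g c A p u)) / 2 + s
        - inner ℝ u (S u) / 2
        = g p / 2 * ((r p - 2 * ζ) * inner ℝ u (S u) + (1 - k p) * (2 * inner ℝ a (S u))
          + k p * g p * inner ℝ a (S a) + (ρ p - 1) * inner ℝ u (G u)) := by
      rw [hu', hs]
      have := hLyap u
      rw [← ha] at this
      linear_combination (1 / 2 * inner ℝ u (S u)) * hdrift + (g p / 2) * this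
    have b2 : |inner ℝ (prevFrequency g c A p u) (S (prevFrequency g c A p u)) / 2 + s
        - inner ℝ u (S u) / 2| ≤ g p * ‖u‖ * (R * (|r p - 2 * ζ| * ‖S‖
          + 2 * |1 - k p| * (‖A‖ * ‖S‖) + k p * g p * (‖A‖ ^ 2 * ‖S‖) + |ρ p - 1| * ‖G‖)) := by
      rw [e1, abs_mul, abs_of_pos (by positivity : 0 < g p / 2)]
      have i1 : |inner ℝ u (S u)| ≤ ‖S‖ * ‖u‖ ^ 2 := by
        rw [sq]; exact abs_inner_clm_le S u u
      have i2 : |inner ℝ a (S u)| ≤ ‖A‖ * ‖S‖ * ‖u‖ ^ 2 := by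
        refine (abs_inner_clm_le S a u).trans ?_
        have := mul_le_mul_of_nonneg_left haA (by positivity : 0 ≤ ‖S‖ * ‖u‖)
        nlinarith
      have i3 : |inner ℝ a (S a)| ≤ ‖A‖ ^ 2 * ‖S‖ * ‖u‖ ^ 2 := by
        refine (abs_inner_clm_le S a a).trans ?_
        have := mul_le_mul_of_nonneg_left (mul_le_mul haA haA (norm_nonneg _) (by positivity))
          (norm_nonneg S)
        refine this.trans (le_of_eq (by ring))
      have i4 : |inner ℝ u (G u)| ≤ ‖G‖ * ‖u‖ ^ 2 := by
        rw [sq]; exact abs_inner_clm_le G u u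
      have j : |(r p - 2 * ζ) * inner ℝ u (S u) + (1 - k p) * (2 * inner ℝ a (S u))
          + k p * g p * inner ℝ a (S a) + (ρ p - 1) * inner ℝ u (G u)|
          ≤ (|r p - 2 * ζ| * ‖S‖ + 2 * |1 - k p| * (‖A‖ * ‖S‖) + k p * g p * (‖A‖ ^ 2 * ‖S‖)
            + |ρ p - 1| * ‖G‖) * ‖u‖ ^ 2 := by
        have j1 : |(r p - 2 * ζ) * inner ℝ u (S u)| ≤ |r p - 2 * ζ| * (‖S‖ * ‖u‖ ^ 2) := by
          rw [abs_mul]; exact mul_le_mul_of_nonneg_left i1 (abs_nonneg _)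
        have j2 : |(1 - k p) * (2 * inner ℝ a (S u))|
            ≤ |1 - k p| * (2 * (‖A‖ * ‖S‖ * ‖u‖ ^ 2)) := by
          rw [abs_mul, abs_mul, abs_two]
          exact mul_le_mul_of_nonneg_left (mul_le_mul_of_nonneg_left i2 two_pos.le) (abs_nonneg _)
        have j3 : |k p * g p * inner ℝ a (S a)| ≤ k p * g p * (‖A‖ ^ 2 * ‖S‖ * ‖u‖ ^ 2) := by
          rw [abs_mul, abs_of_pos (mul_pos (hkpos p) hg)]
          exact mul_le_mul_of_nonneg_left i3 (mul_pos (hkpos p) hg).le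
        have j4 : |(ρ p - 1) * inner ℝ u (G u)| ≤ |ρ p - 1| * (‖G‖ * ‖u‖ ^ 2) := by
          rw [abs_mul]; exact mul_le_mul_of_nonneg_left i4 (abs_nonneg _)
        refine (abs_add_le _ _).trans ((add_le_add ((abs_add_le _ _).trans (add_le_add
          ((abs_add_le _ _).trans (add_le_add j1 j2)) j3)) j4).trans (le_of_eq ?_))
        ring
      set T := |r p - 2 * ζ| * ‖S‖ + 2 * |1 - k p| * (‖A‖ * ‖S‖) + k p * g p * (‖A‖ ^ 2 * ‖S‖)
            + |ρ p - 1| * ‖G‖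
      have hT : 0 ≤ T := by
        have := hkpos p
        positivity
      have j5 : T * ‖u‖ ^ 2 ≤ T * (R * ‖u‖) := by
        rw [sq]
        gcongr
      have j6 : 0 ≤ T * (R * ‖u‖) := by positivity
      have j7 := mul_le_mul_of_nonneg_left (j.trans j5) (by positivity : 0 ≤ g p / 2)
      refine j7.trans ?_
      have j8 : 0 ≤ g p / 2 * (T * (R * ‖u‖)) := by positivity
      linarith
    rw [mul_add]
    exact add_le_add b1 b2

/-- Convergence of characteristic functions from an approximate one-step recursion. The induction
bounds `|φ - gaussian|` by a multiple of `‖u‖`: this is what makes the contraction of the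
frequencies effective. -/
theorem charFun_tendsto_of_recursion {ι : Type*} {l : Filter ι} (h : IsStepGauge g c ζ)
    (hlam : ζ < lam) (hA : ∀ v, lam * ‖v‖ ^ 2 ≤ inner ℝ v (A v))
    (hG : ∀ w, 0 ≤ inner ℝ w (G w)) (hS : ∀ w, 0 ≤ inner ℝ w (S w))
    (hSsymm : ∀ x y, inner ℝ x (S y) = inner ℝ y (S x))
    (hLyap : ∀ u, inner ℝ u (G u) = 2 * inner ℝ (A.adjoint u) (S u) - 2 * ζ * inner ℝ u (S u))
    {R : ℝ} (hR : 0 ≤ R) {φ : ι → ℕ → Vec d → ℂ} {C : ℝ} (hC : 0 ≤ C)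
    (hφ : ∀ᶠ i in l, ∀ p v, ‖φ i p v - 1‖ ≤ C * (√(c p) * ‖v‖))
    (hstep : ∀ η > 0, ∃ p₁ : ℕ, ∀ᶠ i in l, ∀ p ≥ p₁, ∀ u, ‖u‖ ≤ R →
      ‖φ i (p + 1) ((√(c (p + 1)))⁻¹ • u)
        - ((1 - inner ℝ ((g p / √(c (p + 1))) • u) (G ((g p / √(c (p + 1))) • u)) / 2 : ℝ) : ℂ)
          * φ i p ((√(c (p + 1)))⁻¹ • u - A.adjoint ((g p / √(c (p + 1))) • u))‖
        ≤ g p * ‖u‖ * η)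
    {ε : ℝ} (hε : 0 < ε) :
    ∃ p₂ : ℕ, ∀ᶠ i in l, ∀ p ≥ p₂, ∀ u, ‖u‖ ≤ R →
      ‖φ i p ((√(c p))⁻¹ • u) - (Real.exp (-(inner ℝ u (S u) / 2)) : ℂ)‖ ≤ ε := by
  have hκ0 : 0 < lam - ζ := sub_pos.2 hlam
  set κ := (lam - ζ) / 2 with hκdef
  have hκ : 0 < κ := by positivity
  set η := ε * κ / (4 * (R + 1)) with hη
  have hη0 : 0 < η := by positivity
  obtain ⟨e, he0, he⟩ := exists_gaussian_step_error h hG hS hSsymm hLyap R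
  obtain ⟨p₀, hp₀⟩ := hstep η hη0
  have hρ : Tendsto (fun p => g p * (c (p + 1) / g p)⁻¹ * (‖G‖ * R ^ 2)) atTop (𝓝 0) := by
    have := (h.tendsto_step.mul (h.tendsto_ratio.inv₀ one_ne_zero)).mul_const (‖G‖ * R ^ 2)
    simpa using this
  obtain ⟨p₁, hp₁⟩ := eventually_atTop.1 ((eventually_norm_prevFrequency_le h hlam hA).and
    ((h.tendsto_step.eventually_lt_const (by positivity : (0 : ℝ) < 1 / κ)).and
    ((he0.eventually_lt_const hη0).and ((hρ.eventually_lt_const one_pos).and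
      (eventually_ge_atTop p₀)))))
  have hκg : ∀ p ≥ p₁, κ * g p ≤ 1 := by
    intro p hp
    have := (hp₁ p hp).2.1
    rw [lt_div_iff₀ hκ] at this
    linarith
  set K := C + ‖S‖ * R with hK
  have hK0 : 0 ≤ K := by positivity
  -- the solution of `b (p + 1) = (1 - κ g p) b p + 2 η g p` with `b p₁ = 2 η / κ + K`; its limit
  -- `2 η / κ` is small and does not depend on `K`
  set b : ℕ → ℝ := fun p => 2 * η / κ + K * ∏ k ∈ Finset.Ico p₁ p, (1 - κ * g k) with hb
  have hprod0 : ∀ p, 0 ≤ ∏ k ∈ Finset.Ico p₁ p, (1 - κ * g k) := fun p =>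
    Finset.prod_nonneg fun k hk => by linarith [hκg k (Finset.mem_Ico.1 hk).1]
  have hb0 : ∀ p, 0 ≤ b p := fun p => add_nonneg (by positivity) (mul_nonneg hK0 (hprod0 p))
  have hbsucc : ∀ p ≥ p₁, b (p + 1) = (1 - κ * g p) * b p + 2 * η * g p := by
    intro p hp
    simp only [hb]
    rw [Finset.prod_Ico_succ_top hp]
    field_simp
    ring
  have hblim : Tendsto (fun p => b p * R) atTop (𝓝 ((2 * η / κ + K * 0) * R)) :=
    (((h.tendsto_prod_one_sub hκ hκg).const_mul K).const_add _).mul_const R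
  have hlimlt : (2 * η / κ + K * 0) * R < ε := by
    have : (2 * η / κ + K * 0) * R = ε / 2 * (R / (R + 1)) := by
      rw [hη]
      field_simp
      ring
    rw [this]
    have h1 : R / (R + 1) ≤ 1 := by rw [div_le_one (by positivity)]; linarith
    nlinarith
  obtain ⟨p₂, hp₂⟩ := eventually_atTop.1 ((hblim.eventually_lt_const hlimlt).and
    (eventually_ge_atTop p₁))
  refine ⟨p₂, ?_⟩
  filter_upwards [hp₀, hφ] with i hi hφi
  have key : ∀ p ≥ p₁, ∀ u, ‖u‖ ≤ R →
      ‖φ i p ((√(c p))⁻¹ • u) - (Real.exp (-(inner ℝ u (S u) / 2)) : ℂ)‖ ≤ b p * ‖u‖ := by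
    intro p hp
    induction p, hp using Nat.le_induction with
    | base =>
      intro u hu
      have hcp := Real.sqrt_pos.2 (h.gauge_pos p₁)
      have h1 : ‖φ i p₁ ((√(c p₁))⁻¹ • u) - 1‖ ≤ C * ‖u‖ := by
        refine (hφi p₁ _).trans (le_of_eq ?_)
        rw [norm_smul, norm_inv, Real.norm_eq_abs, abs_of_pos hcp, mul_inv_cancel_left₀ hcp.ne']
      have h2 : ‖(1 : ℂ) - (Real.exp (-(inner ℝ u (S u) / 2)) : ℂ)‖ ≤ ‖S‖ * R * ‖u‖ := by
        have h3 : (1 : ℂ) - (Real.exp (-(inner ℝ u (S u) / 2)) : ℂ)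
            = ((1 - Real.exp (-(inner ℝ u (S u) / 2)) : ℝ) : ℂ) := by push_cast; ring
        rw [h3, Complex.norm_real, Real.norm_eq_abs, abs_of_nonneg
          (sub_nonneg.2 (Real.exp_le_one_iff.2 (by linarith [hS u])))]
        have h4 := Real.add_one_le_exp (-(inner ℝ u (S u) / 2))
        have h5 := (le_abs_self _).trans (abs_inner_clm_le S u u)
        have h6 : ‖S‖ * (‖u‖ * ‖u‖) ≤ ‖S‖ * (R * ‖u‖) := by gcongr
        linarith [hS u]
      have h3 : b p₁ * ‖u‖ = 2 * η / κ * ‖u‖ + (C * ‖u‖ + ‖S‖ * R * ‖u‖) := by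
        simp [hb, hK]; ring
      have h4 : 0 ≤ 2 * η / κ * ‖u‖ := by positivity
      have h5 := norm_sub_le_norm_sub_add_norm_sub (φ i p₁ ((√(c p₁))⁻¹ • u)) 1
        (Real.exp (-(inner ℝ u (S u) / 2)) : ℂ)
      linarith
    | succ p hp ih =>
      intro u hu
      obtain ⟨hcontr, -, hep, hsmall, hpp₀⟩ := hp₁ p hp
      have hg := h.step_pos p
      have hc' := h.gauge_pos (p + 1)
      set u' := prevFrequency g c A p u with hu'
      set s := inner ℝ ((g p / √(c (p + 1))) • u) (G ((g p / √(c (p + 1))) • u)) / 2 with hs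
      have hs0 : 0 ≤ s := div_nonneg (hG _) two_pos.le
      have hs1 : s ≤ 1 := by
        have h1 := (le_abs_self _).trans (abs_inner_clm_le G ((g p / √(c (p + 1))) • u)
          ((g p / √(c (p + 1))) • u))
        have h2 : ‖(g p / √(c (p + 1))) • u‖ * ‖(g p / √(c (p + 1))) • u‖
            = g p * (c (p + 1) / g p)⁻¹ * ‖u‖ ^ 2 := by
          rw [norm_smul, mul_mul_mul_comm, ← sq, ← sq, Real.norm_eq_abs, sq_abs, div_pow,
            Real.sq_sqrt hc'.le, inv_div]
          ring
        rw [h2] at h1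
        have h3 : ‖u‖ ^ 2 ≤ R ^ 2 := pow_le_pow_left₀ (norm_nonneg _) hu 2
        have h4 : ‖G‖ * (g p * (c (p + 1) / g p)⁻¹ * ‖u‖ ^ 2)
            ≤ ‖G‖ * (g p * (c (p + 1) / g p)⁻¹ * R ^ 2) := by gcongr
        have h5 := hG ((g p / √(c (p + 1))) • u)
        rw [hs]
        linarith
      have hcu : ‖u'‖ ≤ (1 - κ * g p) * ‖u‖ := hcontr u
      have hu'R : ‖u'‖ ≤ R := by
        refine hcu.trans ((mul_le_of_le_one_left (norm_nonneg _) ?_).trans hu)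
        have := mul_pos hκ hg
        linarith
      have h1 := hi p hpp₀ u hu
      rw [← smul_prevFrequency h.gauge_pos] at h1
      have h2 := ih u' hu'R
      have h3 := he p u hu
      have e1 : φ i (p + 1) ((√(c (p + 1)))⁻¹ • u) - (Real.exp (-(inner ℝ u (S u) / 2)) : ℂ)
          = (φ i (p + 1) ((√(c (p + 1)))⁻¹ • u) - ((1 - s : ℝ) : ℂ) * φ i p ((√(c p))⁻¹ • u'))
            + ((1 - s : ℝ) : ℂ) * (φ i p ((√(c p))⁻¹ • u')
              - (Real.exp (-(inner ℝ u' (S u') / 2)) : ℂ))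
            + (((1 - s) * Real.exp (-(inner ℝ u' (S u') / 2))
              - Real.exp (-(inner ℝ u (S u) / 2)) : ℝ) : ℂ) := by
        push_cast
        ring
      rw [e1]
      refine (norm_add₃_le).trans ?_
      have n2 : ‖((1 - s : ℝ) : ℂ) * (φ i p ((√(c p))⁻¹ • u')
          - (Real.exp (-(inner ℝ u' (S u') / 2)) : ℂ))‖ ≤ b p * ((1 - κ * g p) * ‖u‖) := by
        rw [norm_mul, Complex.norm_real, Real.norm_eq_abs, abs_of_nonneg (by linarith)]
        exact (mul_le_of_le_one_left (norm_nonneg _) (by linarith)).trans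
          (h2.trans (mul_le_mul_of_nonneg_left hcu (hb0 p)))
      have n3 : ‖(((1 - s) * Real.exp (-(inner ℝ u' (S u') / 2))
          - Real.exp (-(inner ℝ u (S u) / 2)) : ℝ) : ℂ)‖ ≤ g p * ‖u‖ * η := by
        rw [Complex.norm_real, Real.norm_eq_abs]
        exact h3.trans (mul_le_mul_of_nonneg_left hep.le (by positivity))
      rw [hbsucc p hp]
      refine (add_le_add (add_le_add h1 n2) n3).trans (le_of_eq ?_)
      ring
  intro p hp u hu
  have h1 := hp₂ p hp
  refine (key p h1.2 u hu).trans ?_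
  have h2 : b p * ‖u‖ ≤ b p * R := mul_le_mul_of_nonneg_left hu (hb0 p)
  linarith [h1.1]

end CharFunRecursion

/-! ### Convergence of the normalized error of the schemes -/

section Scheme

variable {d q : ℕ} {Ω : Type*} [MeasurableSpace Ω] {P : Measure Ω} [IsProbabilityMeasure P]
  {H : Vec d → Vec q → Vec d} {γ : ℝ → ℝ} {θ₀ : Ω → Vec d} {ξ : ℕ → Ω → Vec q}

theorem indepFun_prodMk_left {α β δ : Type*} [MeasurableSpace α] [MeasurableSpace β]
    [MeasurableSpace δ] {X : Ω → α} {Y : Ω → β} {Z : Ω → δ} (hX : Measurable X)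
    (hY : Measurable Y) (hZ : Measurable Z) (h1 : IndepFun X (fun ω => (Y ω, Z ω)) P)
    (h2 : IndepFun Y Z P) : IndepFun (fun ω => (X ω, Y ω)) Z P := by
  have := Measure.isProbabilityMeasure_map (μ := P) hX.aemeasurable
  have := Measure.isProbabilityMeasure_map (μ := P) hY.aemeasurable
  have := Measure.isProbabilityMeasure_map (μ := P) hZ.aemeasurable
  rw [indepFun_iff_map_prod_eq_prod_map_map (hX.prodMk hY).aemeasurable hZ.aemeasurable]
  have hXY : IndepFun X Y P := h1.comp measurable_id measurable_fst
  rw [indepFun_iff_map_prod_eq_prod_map_map hX.aemeasurable hY.aemeasurable] at hXY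
  rw [indepFun_iff_map_prod_eq_prod_map_map hY.aemeasurable hZ.aemeasurable] at h2
  rw [indepFun_iff_map_prod_eq_prod_map_map hX.aemeasurable (hY.prodMk hZ).aemeasurable, h2] at h1
  have h3 : (fun ω => ((X ω, Y ω), Z ω))
      = MeasurableEquiv.prodAssoc.symm ∘ fun ω => (X ω, (Y ω, Z ω)) := rfl
  rw [hXY, h3, ← Measure.map_map (MeasurableEquiv.measurable _) (hX.prodMk (hY.prodMk hZ)), h1,
    ← Measure.prodAssoc_prod, MeasurableEquiv.map_symm_map]

theorem measurable_saScheme (hH : Measurable (Function.uncurry H)) (hθ₀ : Measurable θ₀)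
    (hξ : ∀ p, Measurable (ξ p)) (p : ℕ) : Measurable (saScheme γ H θ₀ ξ p) := by
  induction p with
  | zero => exact hθ₀
  | succ p ih => exact ih.sub ((hH.comp (ih.prodMk (hξ p))).const_smul (γ ((p : ℝ) + 1)))

theorem exists_saScheme_eq {Ω : Type*} {θ₀ : Ω → Vec d} {ξ : ℕ → Ω → Vec q}
    (hH : Measurable (Function.uncurry H)) (p : ℕ) :
    ∃ F : Vec d × (Finset.range p → Vec q) → Vec d, Measurable F ∧
      ∀ ω, saScheme γ H θ₀ ξ p ω = F (θ₀ ω, fun i => ξ i ω) := by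
  induction p with
  | zero => exact ⟨Prod.fst, measurable_fst, fun ω => rfl⟩
  | succ p ih =>
    obtain ⟨F, hF, hFeq⟩ := ih
    let r : Vec d × (Finset.range (p + 1) → Vec q) → Vec d × (Finset.range p → Vec q) :=
      fun z => (z.1, fun i => z.2 ⟨i, Finset.range_mono p.le_succ i.2⟩)
    have hr : Measurable r := measurable_fst.prodMk
      (measurable_pi_lambda _ fun i => (measurable_pi_apply _).comp measurable_snd)
    have hlast : Measurable (fun z : Vec d × (Finset.range (p + 1) → Vec q) =>
        z.2 ⟨p, Finset.self_mem_range_succ p⟩) := (measurable_pi_apply _).comp measurable_snd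
    refine ⟨fun z => F (r z) - γ ((p : ℝ) + 1) • H (F (r z))
      (z.2 ⟨p, Finset.self_mem_range_succ p⟩), ?_, fun ω => ?_⟩
    · exact (hF.comp hr).sub ((hH.comp ((hF.comp hr).prodMk hlast)).const_smul (γ ((p : ℝ) + 1)))
    · simp only [saScheme, hFeq, r]

/-- The position at time `p` is a function of the initial value and of the first `p` innovations;
it is therefore independent of the next innovation. -/
theorem indepFun_saScheme (hH : Measurable (Function.uncurry H)) (hθ₀ : Measurable θ₀)
    (hξ : ∀ p, Measurable (ξ p)) (hind : iIndepFun ξ P)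
    (hθξ : IndepFun θ₀ (fun ω p => ξ p ω) P) (p : ℕ) :
    IndepFun (saScheme γ H θ₀ ξ p) (ξ p) P := by
  obtain ⟨F, hF, hFeq⟩ := exists_saScheme_eq (γ := γ) (θ₀ := θ₀) (ξ := ξ) hH p
  have hY : Measurable (fun ω (i : Finset.range p) => ξ i ω) := measurable_pi_lambda _ fun i => hξ i
  have h1 : IndepFun (fun ω (i : Finset.range p) => ξ i ω) (ξ p) P := by
    have h := hind.indepFun_finset (Finset.range p) {p} (by simp) hξ
    exact h.comp measurable_id (measurable_pi_apply (⟨p, Finset.mem_singleton_self p⟩ :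
      ({p} : Finset ℕ)))
  have h2 : IndepFun θ₀ (fun ω => ((fun (i : Finset.range p) => ξ i ω), ξ p ω)) P := by
    have hm : Measurable (fun z : ℕ → Vec q => ((fun (i : Finset.range p) => z i), z p)) :=
      (measurable_pi_lambda _ fun i => measurable_pi_apply _).prodMk (measurable_pi_apply _)
    exact hθξ.comp measurable_id hm
  have h3 := indepFun_prodMk_left hθ₀ hY (hξ p) h2 h1
  have h4 : saScheme γ H θ₀ ξ p = F ∘ fun ω => (θ₀ ω, fun (i : Finset.range p) => ξ i ω) :=
    funext hFeq
  rw [h4]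
  exact h3.comp hF measurable_id

variable {ν : Measure (Vec q)} {θs : Vec d} {L lam : ℝ}

theorem memLp_saScheme (hadm : IsAdmissible H ν θs L lam) (hθ₀ : Measurable θ₀)
    (hξ : ∀ p, Measurable (ξ p)) (hν : ∀ p, P.map (ξ p) = ν) (hind : iIndepFun ξ P)
    (hθξ : IndepFun θ₀ (fun ω p => ξ p ω) P) (h0 : MemLp (fun ω => θ₀ ω - θs) 2 P) (p : ℕ) :
    MemLp (fun ω => saScheme γ H θ₀ ξ p ω - θs) 2 P := by
  induction p with
  | zero => exact h0
  | succ p ih =>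
    exact hadm.memLp_step (measurable_saScheme hadm.measurable hθ₀ hξ p) (hξ p)
      (indepFun_saScheme hadm.measurable hθ₀ hξ hind hθξ p) (hν p) ih _

theorem integral_le_sqrt_integral_sq {f : Ω → ℝ} (hf : MemLp f 2 P) :
    ∫ ω, f ω ∂P ≤ √(∫ ω, f ω ^ 2 ∂P) := by
  refine Real.le_sqrt_of_sq_le ?_
  have h := variance_nonneg f P
  rw [variance_eq_sub hf] at h
  simpa using h

open Complex in
theorem norm_integral_cexp_inner_sub_one_le {Z : Ω → Vec d} (hZ : Integrable Z P) (v : Vec d) :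
    ‖(∫ ω, cexp ((inner ℝ (Z ω) v : ℝ) * I) ∂P) - 1‖ ≤ ‖v‖ * ∫ ω, ‖Z ω‖ ∂P := by
  have h1 : Integrable (fun ω => cexp ((inner ℝ (Z ω) v : ℝ) * I)) P := by
    refine Integrable.of_bound ?_ 1 (ae_of_all _ fun x => ?_)
    · exact Complex.continuous_exp.comp_aestronglyMeasurable
        (((hZ.inner_const v).ofReal).mul_const I).1
    · rw [Complex.norm_exp_ofReal_mul_I]
  have h2 : (∫ ω, cexp ((inner ℝ (Z ω) v : ℝ) * I) ∂P) - 1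
      = ∫ ω, (cexp ((inner ℝ (Z ω) v : ℝ) * I) - 1) ∂P := by
    rw [integral_sub h1 (integrable_const _)]
    simp
  rw [h2, ← integral_const_mul]
  refine norm_integral_le_of_norm_le (hZ.norm.const_mul _) (ae_of_all _ fun ω => ?_)
  refine (norm_cexp_ofReal_mul_I_sub_one_le _).trans ((abs_real_inner_le_norm _ _).trans ?_)
  rw [mul_comm]

end Scheme

section SchemeLimit

open Complex

variable {d q : ℕ} {Ω : Type*} [MeasurableSpace Ω] {P : Measure Ω} [IsProbabilityMeasure P]
  {H : Vec d → Vec q → Vec d} {γ : ℝ → ℝ} {c : ℕ → ℝ} {ζ lam L : ℝ}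
  {A G S : Vec d →L[ℝ] Vec d}

/-- The characteristic function of the normalized error of the schemes converges to the Gaussian
one as time goes to infinity, uniformly on balls and along the family of schemes. -/
theorem saScheme_charFun_tendsto {ι : Type*} {l : Filter ι}
    (h : IsStepGauge (fun p => γ ((p : ℝ) + 1)) c ζ) (hlam0 : 0 < lam) (hlam : ζ < lam)
    (hL : 0 ≤ L)
    (hA : ∀ v, lam * ‖v‖ ^ 2 ≤ inner ℝ v (A v))
    (hG : ∀ w, 0 ≤ inner ℝ w (G w)) (hS : ∀ w, 0 ≤ inner ℝ w (S w))
    (hSsymm : ∀ x y, inner ℝ x (S y) = inner ℝ y (S x))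
    (hLyap : ∀ u, inner ℝ u (G u) = 2 * inner ℝ (A.adjoint u) (S u) - 2 * ζ * inner ℝ u (S u))
    {ν : ι → Measure (Vec q)} {θn : ι → Vec d}
    (hadm : ∀ᶠ i in l, IsAdmissible H (ν i) (θn i) L lam)
    {K : ℝ} (hK : 0 ≤ K) {e : ι → ℝ} (he0 : ∀ i, 0 ≤ e i) (he : Tendsto e l (𝓝 0))
    (hlin : ∀ i θ, ‖(∫ x, H θ x ∂(ν i)) - A (θ - θn i)‖
      ≤ K * ‖θ - θn i‖ ^ 2 + e i * ‖θ - θn i‖)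
    (hexp : ∀ η > 0, ∃ C : ℝ, 0 ≤ C ∧ ∃ τ : ℝ, 0 < τ ∧ ∀ᶠ i in l, ∀ θ w, ‖w‖ ≤ τ →
      ‖(∫ x, cexp ((-(inner ℝ (H θ x) w) : ℝ) * I) ∂(ν i))
        - (1 - (inner ℝ (∫ x, H θ x ∂(ν i)) w : ℝ) * I - ((inner ℝ w (G w) / 2 : ℝ) : ℂ))‖
      ≤ ‖w‖ ^ 2 * (η + C * ‖θ - θn i‖ ^ 2))
    {θ₀ : ι → Ω → Vec d} {ξ : ι → ℕ → Ω → Vec q} (hθ₀ : ∀ i, Measurable (θ₀ i))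
    (hξ : ∀ i p, Measurable (ξ i p)) (hν : ∀ i p, P.map (ξ i p) = ν i)
    (hind : ∀ i, iIndepFun (ξ i) P) (hθξ : ∀ i, IndepFun (θ₀ i) (fun ω p => ξ i p ω) P)
    (h0 : ∀ i, MemLp (fun ω => θ₀ i ω - θn i) 2 P) {Y : ℝ} (hY0 : 0 ≤ Y)
    (hY : ∀ᶠ i in l, ∫ ω, ‖θ₀ i ω - θn i‖ ^ 2 ∂P ≤ Y)
    {R : ℝ} (hR : 0 ≤ R) {ε : ℝ} (hε : 0 < ε) :
    ∃ p₂ : ℕ, ∀ᶠ i in l, ∀ p ≥ p₂, ∀ u, ‖u‖ ≤ R →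
      ‖(∫ ω, cexp ((inner ℝ (saScheme γ H (θ₀ i) (ξ i) p ω - θn i) ((√(c p))⁻¹ • u) : ℝ) * I) ∂P)
        - (Real.exp (-(inner ℝ u (S u) / 2)) : ℂ)‖ ≤ ε := by
  set g : ℕ → ℝ := fun p => γ ((p : ℝ) + 1) with hgdef
  obtain ⟨C₀, hC₀, hC₀le⟩ := h.exists_forall_le_mul_gauge hlam0 hlam hL hY0
  have hm2 : ∀ᶠ i in l, ∀ p,
      ∫ ω, ‖saScheme γ H (θ₀ i) (ξ i) p ω - θn i‖ ^ 2 ∂P ≤ C₀ * c p := by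
    filter_upwards [hadm, hY] with i hadm hY
    refine hC₀le _ (fun p => integral_nonneg fun ω => sq_nonneg _) hY fun p => ?_
    exact hadm.integral_sq_step_le (measurable_saScheme hadm.measurable (hθ₀ i) (hξ i) p) (hξ i p)
      (indepFun_saScheme hadm.measurable (hθ₀ i) (hξ i) (hind i) (hθξ i) p) (hν i p)
      (memLp_saScheme hadm (hθ₀ i) (hξ i) (hν i) (hind i) (hθξ i) (h0 i) p) (h.step_pos p).le
  have hm1 : ∀ᶠ i in l, ∀ p,
      ∫ ω, ‖saScheme γ H (θ₀ i) (ξ i) p ω - θn i‖ ∂P ≤ √(C₀ * c p) := by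
    filter_upwards [hadm, hm2] with i hadm hm2 p
    exact (integral_le_sqrt_integral_sq (memLp_saScheme hadm (hθ₀ i) (hξ i) (hν i) (hind i)
      (hθξ i) (h0 i) p).norm).trans (Real.sqrt_le_sqrt (hm2 p))
  refine charFun_tendsto_of_recursion (φ := fun i p v =>
    ∫ ω, cexp ((inner ℝ (saScheme γ H (θ₀ i) (ξ i) p ω - θn i) v : ℝ) * I) ∂P) (C := √C₀)
    h hlam hA hG hS hSsymm hLyap hR (Real.sqrt_nonneg _) ?_ ?_ hε
  · filter_upwards [hadm, hm1] with i hadm hm1 p v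
    refine (norm_integral_cexp_inner_sub_one_le ((memLp_saScheme hadm (hθ₀ i) (hξ i) (hν i)
      (hind i) (hθξ i) (h0 i) p).integrable (by norm_num)) v).trans ?_
    have h1 := mul_le_mul_of_nonneg_left (hm1 p) (norm_nonneg v)
    rw [Real.sqrt_mul hC₀] at h1
    linarith
  · intro η hη
    obtain ⟨C, hC, τ, hτ, hexp⟩ := hexp (η / (6 * (R + 1))) (by positivity)
    have hT : Tendsto (fun p => 2 * R * C * (C₀ * c p) + 2 * √C₀ * K * √(C₀ * c p)
        + 6 * ‖A‖ ^ 2 * R * (C₀ * c p) + 4 * ‖G‖ * ‖A‖ * R ^ 2 * √C₀ * g p) atTop (𝓝 0) := by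
      have t1 := h.tendsto_gauge.const_mul C₀
      have t2 : Tendsto (fun p => √(C₀ * c p)) atTop (𝓝 0) := by
        have := t1.sqrt
        simpa using this
      have := (((t1.const_mul (2 * R * C)).add (t2.const_mul (2 * √C₀ * K))).add
        (t1.const_mul (6 * ‖A‖ ^ 2 * R))).add
        (h.tendsto_step.const_mul (4 * ‖G‖ * ‖A‖ * R ^ 2 * √C₀))
      simpa using this
    have hτlim : Tendsto (fun p => 2 * R ^ 2 * g p) atTop (𝓝 0) := by
      simpa using h.tendsto_step.const_mul (2 * R ^ 2)
    obtain ⟨p₁, hp₁⟩ := eventually_atTop.1 ((hT.eventually_lt_const (by positivity : 0 < η / 3)).and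
      ((hτlim.eventually_lt_const (by positivity : 0 < τ ^ 2)).and
      ((h.tendsto_ratio.eventually_const_lt (by norm_num : (1 / 2 : ℝ) < 1)).and
        (h.tendsto_gauge_ratio.eventually_lt_const (by norm_num : (1 : ℝ) < 4)))))
    refine ⟨p₁, ?_⟩
    have hei : Tendsto (fun i => 2 * √C₀ * e i) l (𝓝 0) := by
      simpa using he.const_mul (2 * √C₀)
    filter_upwards [hadm, hm1, hm2, hexp, hei.eventually_lt_const (by positivity : 0 < η / 3)]
      with i hadm hm1 hm2 hexp hei p hp u hu
    obtain ⟨hTp, hτp, hratio, hgauge⟩ := hp₁ p hp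
    have hg := h.step_pos p
    have hc := h.gauge_pos p
    have hc' := h.gauge_pos (p + 1)
    have hsc' := Real.sqrt_pos.2 hc'
    set w := (g p / √(c (p + 1))) • u with hw
    have hwv : w = g p • ((√(c (p + 1)))⁻¹ • u) := by rw [smul_smul, hw, div_eq_mul_inv]
    have hwn : ‖w‖ = g p / √(c (p + 1)) * ‖u‖ := by
      rw [hw, norm_smul, Real.norm_eq_abs, abs_of_pos (div_pos hg hsc')]
    have hw2 : ‖w‖ ^ 2 ≤ 2 * g p * ‖u‖ ^ 2 := by
      rw [hwn, mul_pow, div_pow, Real.sq_sqrt hc'.le]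
      refine mul_le_mul_of_nonneg_right ?_ (sq_nonneg _)
      rw [div_le_iff₀ hc']
      rw [lt_div_iff₀ hg] at hratio
      change 1 / 2 * g p < c (p + 1) at hratio
      nlinarith
    have hwm : ‖w‖ * √(C₀ * c p) ≤ 2 * √C₀ * (g p * ‖u‖) := by
      have h1 : √(c p) ≤ 2 * √(c (p + 1)) := by
        refine Real.sqrt_le_iff.2 ⟨by positivity, ?_⟩
        rw [mul_pow, Real.sq_sqrt hc'.le]
        rw [div_lt_iff₀ hc'] at hgauge
        linarith
      rw [hwn, Real.sqrt_mul hC₀]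
      have h2 : √(c p) / √(c (p + 1)) ≤ 2 := by rwa [div_le_iff₀ hsc']
      have h3 := mul_le_mul_of_nonneg_left h2 (by positivity : 0 ≤ √C₀ * (g p * ‖u‖))
      refine le_trans (le_of_eq ?_) (h3.trans (le_of_eq ?_))
      · field_simp
      · ring
    have hwτ : ‖w‖ ≤ τ := by
      refine le_of_sq_le_sq (hw2.trans ?_) hτ.le
      have : ‖u‖ ^ 2 ≤ R ^ 2 := pow_le_pow_left₀ (norm_nonneg _) hu 2
      have := mul_le_mul_of_nonneg_left this (by positivity : 0 ≤ 2 * g p)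
      linarith
    have hstep := norm_charFun_step_sub_le (P := P) hadm.measurable
      (measurable_saScheme (γ := γ) hadm.measurable (hθ₀ i) (hξ i) p) (hξ i p)
      (indepFun_saScheme hadm.measurable (hθ₀ i) (hξ i) (hind i) (hθξ i) p) (hν i p)
      (memLp_saScheme hadm (hθ₀ i) (hξ i) (hν i) (hind i) (hθξ i) (h0 i) p) A G hG hwv hK (he0 i)
      hC (hlin i) (fun θ => hexp θ w hwτ) (hm1 p) (hm2 p)
    refine hstep.trans ?_
    have hm20 : 0 ≤ C₀ * c p := by positivity
    have hsq : √(C₀ * c p) * √(C₀ * c p) = C₀ * c p := Real.mul_self_sqrt hm20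
    set m := √(C₀ * c p) with hm
    have hm0 : 0 ≤ m := Real.sqrt_nonneg _
    set t := g p * ‖u‖ with ht
    have ht0 : 0 ≤ t := by positivity
    have hw2' : ‖w‖ ^ 2 ≤ 2 * R * t := by
      have := mul_le_mul_of_nonneg_left hu (by positivity : 0 ≤ 2 * g p * ‖u‖)
      linarith [congrArg (2 * g p * ·) (sq ‖u‖)]
    have a1 : ‖w‖ ^ 2 * (η / (6 * (R + 1)) + C * (C₀ * c p))
        ≤ 2 * R * t * (η / (6 * (R + 1)) + C * (C₀ * c p)) :=
      mul_le_mul_of_nonneg_right hw2' (by positivity)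
    have a1' : 2 * R * t * (η / (6 * (R + 1))) ≤ t * (η / 3) := by
      have h1 : 2 * R * (η / (6 * (R + 1))) = η / 3 * (R / (R + 1)) := by
        field_simp
        ring
      have h2 : R / (R + 1) ≤ 1 := by rw [div_le_one (by positivity)]; linarith
      have h3 : 2 * R * (η / (6 * (R + 1))) ≤ η / 3 := by
        rw [h1]
        exact mul_le_of_le_one_right (by positivity) h2
      have := mul_le_mul_of_nonneg_left h3 ht0
      linarith
    have a2 : ‖w‖ * (K * (C₀ * c p) + e i * m) ≤ 2 * √C₀ * t * (K * m + e i) := by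
      have h1 : ‖w‖ * (K * (C₀ * c p) + e i * m) = ‖w‖ * m * (K * m + e i) := by
        rw [← hsq]; ring
      rw [h1]
      exact mul_le_mul_of_nonneg_right hwm (add_nonneg (by positivity) (he0 i))
    have a3 : 3 * ‖A‖ ^ 2 * ‖w‖ ^ 2 * (C₀ * c p) ≤ 3 * ‖A‖ ^ 2 * (2 * R * t) * (C₀ * c p) := by
      gcongr
    have a4 : ‖G‖ * ‖A‖ * ‖w‖ ^ 3 * m ≤ ‖G‖ * ‖A‖ * (2 * R * t) * (2 * √C₀ * (g p * R)) := by
      have h1 : ‖G‖ * ‖A‖ * ‖w‖ ^ 3 * m = ‖G‖ * ‖A‖ * ‖w‖ ^ 2 * (‖w‖ * m) := by ring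
      rw [h1]
      have h2 : ‖w‖ * m ≤ 2 * √C₀ * (g p * R) := by
        refine hwm.trans ?_
        rw [ht]
        gcongr
      gcongr
    have a5 := mul_le_mul_of_nonneg_left hTp.le ht0
    have a6 := mul_le_mul_of_nonneg_left hei.le ht0
    change _ ≤ t * η
    linarith

end SchemeLimit

/-! ### Linearization of the mean fields, moments and quadratic forms -/

section Linearization

variable {d : ℕ}

theorem norm_sub_fderiv_apply_le {f : Vec d → Vec d} (hf : Differentiable ℝ f) {K : ℝ≥0}
    (hK : LipschitzWith K (fderiv ℝ f)) {z : Vec d} (hz : f z = 0) (A : Vec d →L[ℝ] Vec d)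
    (θ : Vec d) :
    ‖f θ - A (θ - z)‖ ≤ K * ‖θ - z‖ ^ 2 + ‖fderiv ℝ f z - A‖ * ‖θ - z‖ := by
  have h := (convex_closedBall z ‖θ - z‖).norm_image_sub_le_of_norm_fderiv_le' (𝕜 := ℝ) (f := f)
    (φ := A) (C := K * ‖θ - z‖ + ‖fderiv ℝ f z - A‖) (x := z) (y := θ)
    (fun x _ => hf x) (fun x hx => ?_) (Metric.mem_closedBall_self (norm_nonneg _))
    (by rw [Metric.mem_closedBall, dist_eq_norm])
  · rw [hz, sub_zero] at h
    refine h.trans (le_of_eq ?_)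
    ring
  · rw [Metric.mem_closedBall, dist_eq_norm] at hx
    have h1 := hK.norm_sub_le x z
    have h2 := norm_sub_le_norm_sub_add_norm_sub (fderiv ℝ f x) (fderiv ℝ f z) A
    have h3 : (K : ℝ) * ‖x - z‖ ≤ K * ‖θ - z‖ := by gcongr
    linarith

/-- Strong mean reversion locates the zero: with `θ` fixed, smallness of `f θ` forces `θ` to be
close to `z`. -/
theorem norm_sub_le_of_reverting {f : Vec d → Vec d} {z : Vec d} {lam : ℝ}
    (hf : ∀ θ, lam * ‖θ - z‖ ^ 2 ≤ inner ℝ (θ - z) (f θ)) (θ : Vec d) :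
    lam * ‖θ - z‖ ≤ ‖f θ‖ := by
  rcases (norm_nonneg (θ - z)).eq_or_lt with h | h
  · rw [← h, mul_zero]; exact norm_nonneg _
  · have h1 := (hf θ).trans (real_inner_le_norm _ _)
    rw [sq, ← mul_assoc, mul_comm ‖θ - z‖ ‖f θ‖] at h1
    exact le_of_mul_le_mul_right h1 h

/-- The constant of strong mean reversion of the approximations bounds the limiting Jacobian from
below: evaluate the mean reversion at `z + t v`, first along the family, then for `t → 0`. -/
theorem coercive_of_reverting {ι : Type*} {l : Filter ι} [l.NeBot] {f : ι → Vec d → Vec d}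
    {z : ι → Vec d} {lam K : ℝ} {A : Vec d →L[ℝ] Vec d} {e : ι → ℝ}
    (he : Tendsto e l (𝓝 0))
    (hf : ∀ i θ, lam * ‖θ - z i‖ ^ 2 ≤ inner ℝ (θ - z i) (f i θ))
    (hlin : ∀ i θ, ‖f i θ - A (θ - z i)‖ ≤ K * ‖θ - z i‖ ^ 2 + e i * ‖θ - z i‖) (v : Vec d) :
    lam * ‖v‖ ^ 2 ≤ inner ℝ v (A v) := by
  have h1 : ∀ t : ℝ, 0 < t → ∀ i,
      lam * ‖v‖ ^ 2 ≤ inner ℝ v (A v) + ‖v‖ * (K * t * ‖v‖ ^ 2 + e i * ‖v‖) := by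
    intro t ht i
    have h2 := hf i (z i + t • v)
    have h3 := hlin i (z i + t • v)
    rw [add_sub_cancel_left] at h2 h3
    have h4 : inner ℝ (t • v) (f i (z i + t • v)) ≤ inner ℝ (t • v) (A (t • v))
        + ‖t • v‖ * (K * ‖t • v‖ ^ 2 + e i * ‖t • v‖) := by
      have h5 : inner ℝ (t • v) (f i (z i + t • v)) = inner ℝ (t • v) (A (t • v))
          + inner ℝ (t • v) (f i (z i + t • v) - A (t • v)) := by
        rw [inner_sub_right]; ring
      rw [h5]
      have := (real_inner_le_norm (t • v) (f i (z i + t • v) - A (t • v))).trans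
        (mul_le_mul_of_nonneg_left h3 (norm_nonneg _))
      linarith
    have h6 := h2.trans h4
    rw [map_smul, inner_smul_left, inner_smul_right, norm_smul, Real.norm_eq_abs, abs_of_pos ht,
      conj_trivial] at h6
    have h7 : t ^ 2 * (lam * ‖v‖ ^ 2)
        ≤ t ^ 2 * (inner ℝ v (A v) + ‖v‖ * (K * t * ‖v‖ ^ 2 + e i * ‖v‖)) := by
      refine le_trans (le_of_eq ?_) (h6.trans (le_of_eq ?_)) <;> ring
    exact le_of_mul_le_mul_left h7 (by positivity)
  have h2 : ∀ t : ℝ, 0 < t →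
      lam * ‖v‖ ^ 2 ≤ inner ℝ v (A v) + ‖v‖ * (K * t * ‖v‖ ^ 2 + 0 * ‖v‖) := fun t ht =>
    ge_of_tendsto' ((((he.mul_const ‖v‖).const_add _).const_mul ‖v‖).const_add _) (h1 t ht)
  have h3 : Tendsto (fun t : ℝ => inner ℝ v (A v) + ‖v‖ * (K * t * ‖v‖ ^ 2 + 0 * ‖v‖)) (𝓝[>] 0)
      (𝓝 (inner ℝ v (A v) + ‖v‖ * (K * 0 * ‖v‖ ^ 2 + 0 * ‖v‖))) := by
    refine Tendsto.mono_left (Continuous.tendsto ?_ 0) nhdsWithin_le_nhds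
    fun_prop
  have h4 := ge_of_tendsto h3 (eventually_mem_nhdsWithin.mono fun t ht => h2 t ht)
  simpa using h4

/-- The bias of the zeros: linearization transfers the expansion of `f i θs` to `z i - θs`. -/
theorem tendsto_smul_clm_sub_of_linearization {ι : Type*} {l : Filter ι} {f : ι → Vec d → Vec d}
    {z : ι → Vec d} {θs b : Vec d} {lam K : ℝ} (hlam : 0 < lam) {A : Vec d →L[ℝ] Vec d}
    {e a : ι → ℝ} (he : Tendsto e l (𝓝 0)) (ha : ∀ i, 0 ≤ a i) (hz : Tendsto z l (𝓝 θs))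
    (hf : ∀ i θ, lam * ‖θ - z i‖ ^ 2 ≤ inner ℝ (θ - z i) (f i θ))
    (hlin : ∀ i θ, ‖f i θ - A (θ - z i)‖ ≤ K * ‖θ - z i‖ ^ 2 + e i * ‖θ - z i‖)
    (hb : Tendsto (fun i => a i • f i θs) l (𝓝 b)) :
    Tendsto (fun i => A (a i • (θs - z i))) l (𝓝 b) := by
  have h0 : Tendsto (fun i => ‖θs - z i‖) l (𝓝 0) := by
    have := (hz.const_sub θs).norm
    rwa [sub_self, norm_zero] at this
  have h1 : Tendsto (fun i => ‖a i • f i θs‖ / lam * |K * ‖θs - z i‖ + e i|) l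
      (𝓝 (‖b‖ / lam * |K * 0 + 0|)) :=
    (hb.norm.div_const lam).mul (((h0.const_mul K).add he).abs)
  rw [mul_zero, add_zero, abs_zero, mul_zero] at h1
  have h2 : Tendsto (fun i => a i • f i θs - A (a i • (θs - z i))) l (𝓝 0) := by
    refine squeeze_zero_norm (fun i => ?_) h1
    have h3 := norm_sub_le_of_reverting (hf i) θs
    rw [map_smul, ← smul_sub, norm_smul, norm_smul, Real.norm_eq_abs, abs_of_nonneg (ha i)]
    have h4 : ‖f i θs - A (θs - z i)‖ ≤ ‖f i θs‖ / lam * |K * ‖θs - z i‖ + e i| := by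
      have h5 : ‖θs - z i‖ ≤ ‖f i θs‖ / lam := by rw [le_div_iff₀ hlam]; linarith
      calc ‖f i θs - A (θs - z i)‖ ≤ K * ‖θs - z i‖ ^ 2 + e i * ‖θs - z i‖ := hlin i θs
        _ = ‖θs - z i‖ * (K * ‖θs - z i‖ + e i) := by ring
        _ ≤ ‖θs - z i‖ * |K * ‖θs - z i‖ + e i| :=
            mul_le_mul_of_nonneg_left (le_abs_self _) (norm_nonneg _)
        _ ≤ _ := mul_le_mul_of_nonneg_right h5 (abs_nonneg _)
    have h6 := mul_le_mul_of_nonneg_left h4 (ha i)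
    refine h6.trans (le_of_eq ?_)
    ring
  have h3 := hb.sub h2
  simpa using h3

end Linearization

section Moments

variable {α E : Type*} [MeasurableSpace α] [NormedAddCommGroup E] {μ : Measure α} {f : α → E}

theorem integrable_rpow_norm_of_lintegral_le (hf : AEStronglyMeasurable f μ) {r : ℝ} (hr : 0 ≤ r)
    {C : ℝ≥0∞} (hC : C ≠ ∞) (h : ∫⁻ x, ‖f x‖ₑ ^ r ∂μ ≤ C) :
    Integrable (fun x => ‖f x‖ ^ r) μ ∧ ∫ x, ‖f x‖ ^ r ∂μ ≤ C.toReal := by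
  have hm : AEStronglyMeasurable (fun x => ‖f x‖ ^ r) μ :=
    (hf.norm.aemeasurable.pow_const r).aestronglyMeasurable
  have he : ∀ x, ‖‖f x‖ ^ r‖ₑ = ‖f x‖ₑ ^ r := fun x => by
    rw [Real.enorm_rpow_of_nonneg (norm_nonneg _) hr, enorm_norm]
  have hfin : HasFiniteIntegral (fun x => ‖f x‖ ^ r) μ := by
    rw [hasFiniteIntegral_iff_enorm]
    simp only [he]
    exact h.trans_lt hC.lt_top
  refine ⟨⟨hm, hfin⟩, ?_⟩
  have h1 : ∫ x, ‖f x‖ ^ r ∂μ = ∫ x, ‖‖f x‖ ^ r‖ ∂μ :=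
    integral_congr_ae (ae_of_all _ fun x => by
      simp only [Real.norm_eq_abs]
      rw [abs_of_nonneg (by positivity)])
  rw [h1, integral_norm_eq_lintegral_enorm hm]
  simp only [he]
  exact ENNReal.toReal_mono hC h

theorem memLp_two_of_integrable_rpow [IsFiniteMeasure μ] (hf : AEStronglyMeasurable f μ) {δ : ℝ}
    (hδ : 0 ≤ δ) (h : Integrable (fun x => ‖f x‖ ^ (2 + δ)) μ) : MemLp f 2 μ := by
  rw [memLp_two_iff_integrable_sq_norm hf]
  refine Integrable.mono' ((integrable_const (1 : ℝ)).add h) (hf.norm.pow 2)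
    (ae_of_all _ fun x => ?_)
  rw [Real.norm_eq_abs, abs_of_nonneg (by positivity)]
  rcases le_total ‖f x‖ 1 with hx | hx
  · have h1 : ‖f x‖ ^ 2 ≤ 1 := pow_le_one₀ (norm_nonneg _) hx
    have h2 : 0 ≤ ‖f x‖ ^ (2 + δ) := by positivity
    simp only [Pi.add_apply]
    linarith
  · have h1 : ‖f x‖ ^ (2 : ℝ) ≤ ‖f x‖ ^ (2 + δ) := Real.rpow_le_rpow_of_exponent_le hx (by linarith)
    rw [Real.rpow_two] at h1
    simp only [Pi.add_apply]
    linarith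

theorem integral_sq_le_one_add_integral_rpow [IsProbabilityMeasure μ]
    (hf : AEStronglyMeasurable f μ) {δ : ℝ}
    (hδ : 0 ≤ δ) (h : Integrable (fun x => ‖f x‖ ^ (2 + δ)) μ) :
    ∫ x, ‖f x‖ ^ 2 ∂μ ≤ 1 + ∫ x, ‖f x‖ ^ (2 + δ) ∂μ := by
  have h2 := (memLp_two_iff_integrable_sq_norm hf).1 (memLp_two_of_integrable_rpow hf hδ h)
  have h3 : 1 + ∫ x, ‖f x‖ ^ (2 + δ) ∂μ = ∫ x, (1 + ‖f x‖ ^ (2 + δ)) ∂μ := by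
    rw [integral_add (integrable_const _) h]
    simp
  rw [h3]
  refine integral_mono h2 ((integrable_const (1 : ℝ)).add h) fun x => ?_
  simp only
  rcases le_total ‖f x‖ 1 with hx | hx
  · have h1 : ‖f x‖ ^ 2 ≤ 1 := pow_le_one₀ (norm_nonneg _) hx
    have h2 : 0 ≤ ‖f x‖ ^ (2 + δ) := by positivity
    linarith
  · have h1 : ‖f x‖ ^ (2 : ℝ) ≤ ‖f x‖ ^ (2 + δ) := Real.rpow_le_rpow_of_exponent_le hx (by linarith)
    rw [Real.rpow_two] at h1
    linarith

theorem rpow_two_mul_le_one_add_sq {x b : ℝ} (hx : 0 ≤ x) (hb : 0 ≤ b) (hb1 : b ≤ 1) :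
    x ^ (2 * b) ≤ 1 + x ^ 2 := by
  rcases le_total x 1 with h | h
  · have := Real.rpow_le_one hx h (by positivity : 0 ≤ 2 * b)
    nlinarith
  · have := Real.rpow_le_rpow_of_exponent_le h (by linarith : 2 * b ≤ 2)
    rw [Real.rpow_two] at this
    linarith

end Moments

section Quadratic

variable {d q : ℕ} {ν : Measure (Vec q)} {W : Vec q → Vec d}

theorem integral_inner_sq_eq (hW : MemLp W 2 ν) (w : Vec d) :
    ∫ x, (inner ℝ (W x) w) ^ 2 ∂ν = ∑ i, ∑ j, w i * w j * ∫ x, W x i * W x j ∂ν := by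
  have hc : ∀ i, MemLp (fun x => W x i) 2 ν := fun i => by
    refine hW.of_le ?_ (ae_of_all _ fun x => PiLp.norm_apply_le (W x) i)
    exact (EuclideanSpace.proj (𝕜 := ℝ) i).continuous.comp_aestronglyMeasurable hW.1
  have hint : ∀ i j, Integrable (fun x => W x i * W x j) ν := fun i j =>
    (hc i).integrable_mul (hc j)
  have h1 : ∀ x, (inner ℝ (W x) w) ^ 2 = ∑ i, ∑ j, w i * w j * (W x i * W x j) := by
    intro x
    rw [PiLp.inner_apply, sq, Finset.sum_mul_sum]
    refine Finset.sum_congr rfl fun i _ => Finset.sum_congr rfl fun j _ => ?_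
    simp
    ring
  simp only [h1]
  rw [integral_finsetSum _ fun i _ => integrable_finsetSum _ fun j _ => (hint i j).const_mul _]
  refine Finset.sum_congr rfl fun i _ => ?_
  rw [integral_finsetSum _ fun j _ => (hint i j).const_mul _]
  exact Finset.sum_congr rfl fun j _ => integral_const_mul _ _

theorem inner_toEuclideanCLM_eq_sum (G : Matrix (Fin d) (Fin d) ℝ) (w : Vec d) :
    inner ℝ w (Matrix.toEuclideanCLM (n := Fin d) (𝕜 := ℝ) G w)
      = ∑ i, ∑ j, w i * w j * G i j := by
  rw [Matrix.inner_toEuclideanCLM]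
  simp only [dotProduct, Matrix.mulVec, Finset.mul_sum]
  refine Finset.sum_congr rfl fun i _ => Finset.sum_congr rfl fun j _ => ?_
  ring

theorem abs_integral_inner_sq_sub_le (hW : MemLp W 2 ν) {G : Matrix (Fin d) (Fin d) ℝ} {ε : ℝ}
    (h : ∀ i j, |(∫ x, W x i * W x j ∂ν) - G i j| ≤ ε) (w : Vec d) :
    |(∫ x, (inner ℝ (W x) w) ^ 2 ∂ν)
      - inner ℝ w (Matrix.toEuclideanCLM (n := Fin d) (𝕜 := ℝ) G w)| ≤ d ^ 2 * ε * ‖w‖ ^ 2 := by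
  rw [integral_inner_sq_eq hW, inner_toEuclideanCLM_eq_sum]
  simp only [← Finset.sum_sub_distrib, ← mul_sub]
  refine (Finset.abs_sum_le_sum_abs _ _).trans ((Finset.sum_le_sum fun i _ =>
    Finset.abs_sum_le_sum_abs _ _).trans ?_)
  have h1 : ∀ i j, |w i * w j * ((∫ x, W x i * W x j ∂ν) - G i j)| ≤ ‖w‖ ^ 2 * ε := by
    intro i j
    rw [abs_mul, abs_mul, sq]
    have hi : |w i| ≤ ‖w‖ := PiLp.norm_apply_le w i
    have hj : |w j| ≤ ‖w‖ := PiLp.norm_apply_le w j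
    exact mul_le_mul (mul_le_mul hi hj (abs_nonneg _) (norm_nonneg _)) (h i j) (abs_nonneg _)
      (by positivity)
  refine (Finset.sum_le_sum fun i _ => Finset.sum_le_sum fun j _ => h1 i j).trans (le_of_eq ?_)
  simp
  ring

end Quadratic

/-! ### Consequences of the regularity assumptions and Lévy continuity -/

section Assumptions

variable {d q : ℕ} {Ω : Type*} [MeasurableSpace Ω] {P : Measure Ω}
  {H : Vec d → Vec q → Vec d}

theorem meanField_eq_integral_map (hH : Measurable (Function.uncurry H)) {X : Ω → Vec q}
    (hX : Measurable X) (θ : Vec d) : meanField P H X θ = ∫ x, H θ x ∂(P.map X) := by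
  have hm : Measurable (H θ) := hH.comp measurable_prodMk_left
  rw [meanField, integral_map hX.aemeasurable hm.aestronglyMeasurable]

/-- Locally uniform moments of order `2 + δ` of the innovation laws. -/
theorem exists_moment_bound_of_innovationRegularity {U : Ω → Vec q} {Un : ℕ+ → Ω → Vec q}
    {θs : Vec d} (hH : Measurable (Function.uncurry H)) (hUn : ∀ n, Measurable (Un n))
    (hI : InnovationRegularity P H U Un θs) :
    ∃ δ : ℝ, 0 < δ ∧ ∀ R : ℝ, 0 < R → ∃ C : ℝ, ∀ n θ, ‖θ‖ ≤ R →
      Integrable (fun x => ‖H θ x‖ ^ (2 + δ)) (P.map (Un n))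
        ∧ ∫ x, ‖H θ x‖ ^ (2 + δ) ∂(P.map (Un n)) ≤ C := by
  obtain ⟨⟨δ, hδ, hmom⟩, -⟩ := hI
  refine ⟨δ, hδ, fun R hR => ?_⟩
  obtain ⟨C, hC⟩ := hmom R hR
  refine ⟨C, fun n θ hθ => ?_⟩
  have hm : Measurable (H θ) := hH.comp measurable_prodMk_left
  refine integrable_rpow_norm_of_lintegral_le hm.aestronglyMeasurable (by positivity)
    ENNReal.coe_ne_top ?_
  rw [lintegral_map (hm.enorm.pow_const _) (hUn n)]
  exact hC n θ hθ

/-- Hölder continuity in quadratic mean turns the second moment bound at `θs` into one that grows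
at most quadratically. -/
theorem exists_isAdmissible [IsProbabilityMeasure P] {Un : ℕ+ → Ω → Vec q}
    {θs : Vec d} {θsn : ℕ+ → Vec d} (hH : Measurable (Function.uncurry H))
    (hUn : ∀ n, Measurable (Un n)) (hR : HolderInMean P H Un) {δ : ℝ} (hδ : 0 < δ)
    (hmom : ∀ R : ℝ, 0 < R → ∃ C : ℝ, ∀ n θ, ‖θ‖ ≤ R →
      Integrable (fun x => ‖H θ x‖ ^ (2 + δ)) (P.map (Un n))
        ∧ ∫ x, ‖H θ x‖ ^ (2 + δ) ∂(P.map (Un n)) ≤ C)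
    (hθ : Tendsto θsn atTop (𝓝 θs)) {lam : ℝ}
    (hMR : ∀ (n : ℕ+) (θ : Vec d),
      lam * ‖θ - θsn n‖ ^ 2 ≤ inner ℝ (θ - θsn n) (meanField P H (Un n) θ)) :
    ∃ L : ℝ, 0 ≤ L ∧ ∀ᶠ n in atTop, IsAdmissible H (P.map (Un n)) (θsn n) L lam := by
  obtain ⟨b, hb0, hb1, C, hC⟩ := hR
  obtain ⟨C', hC'⟩ := hmom (‖θs‖ + 1) (by positivity)
  have hHm : ∀ θ, Measurable (H θ) := fun θ => hH.comp measurable_prodMk_left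
  have hprob : ∀ n, IsProbabilityMeasure (P.map (Un n)) :=
    fun n => Measure.isProbabilityMeasure_map (hUn n).aemeasurable
  have hL2 : ∀ n θ, MemLp (H θ) 2 (P.map (Un n)) := by
    intro n θ
    have := hprob n
    obtain ⟨C'', hC''⟩ := hmom (‖θ‖ + 1) (by positivity)
    exact memLp_two_of_integrable_rpow (hHm θ).aestronglyMeasurable hδ.le
      (hC'' n θ (by linarith)).1
  refine ⟨6 * C + 2 * (1 + |C'|), by positivity, ?_⟩
  filter_upwards [hθ.eventually (Metric.ball_mem_nhds θs one_pos)] with n hn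
  rw [dist_eq_norm] at hn
  have := hprob n
  refine ⟨hH, hL2 n, fun θ => ?_, fun θ => ?_⟩
  · have h1 : ∫ x, ‖H θ x - H θs x‖ ^ 2 ∂(P.map (Un n)) ≤ C * (1 + ‖θ - θs‖ ^ 2) := by
      have hm : Measurable (fun x => H θ x - H θs x) := (hHm θ).sub (hHm θs)
      have h2 : ∫⁻ x, ‖H θ x - H θs x‖ₑ ^ (2 : ℝ) ∂(P.map (Un n))
          ≤ C * ‖θ - θs‖ₑ ^ (2 * b) := by
        rw [lintegral_map (hm.enorm.pow_const _) (hUn n)]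
        exact hC n θ θs
      have h3 : (C : ℝ≥0∞) * ‖θ - θs‖ₑ ^ (2 * b) ≠ ∞ :=
        ENNReal.mul_ne_top ENNReal.coe_ne_top
          (ENNReal.rpow_ne_top_of_nonneg (by positivity) enorm_ne_top)
      have h4 := (integrable_rpow_norm_of_lintegral_le hm.aestronglyMeasurable two_pos.le h3 h2).2
      rw [ENNReal.toReal_mul, ENNReal.coe_toReal, ← ENNReal.toReal_rpow, toReal_enorm] at h4
      simp only [Real.rpow_two] at h4
      exact h4.trans (mul_le_mul_of_nonneg_left
        (rpow_two_mul_le_one_add_sq (norm_nonneg _) hb0.le hb1) C.2)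
    have h2 : ∫ x, ‖H θs x‖ ^ 2 ∂(P.map (Un n)) ≤ 1 + |C'| := by
      obtain ⟨h3, h4⟩ := hC' n θs (by linarith)
      have := integral_sq_le_one_add_integral_rpow (hHm θs).aestronglyMeasurable hδ.le h3
      linarith [le_abs_self C']
    have i1 := integrable_norm_sq_of_memLp ((hL2 n θ).sub (hL2 n θs))
    have i2 := integrable_norm_sq_of_memLp (hL2 n θs)
    simp only [Pi.sub_apply] at i1
    have h3 : ∫ x, ‖H θ x‖ ^ 2 ∂(P.map (Un n)) ≤ 2 * ∫ x, ‖H θ x - H θs x‖ ^ 2 ∂(P.map (Un n))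
        + 2 * ∫ x, ‖H θs x‖ ^ 2 ∂(P.map (Un n)) := by
      rw [← integral_const_mul, ← integral_const_mul,
        ← integral_add (i1.const_mul 2) (i2.const_mul 2)]
      refine integral_mono (integrable_norm_sq_of_memLp (hL2 n θ))
        ((i1.const_mul 2).add (i2.const_mul 2)) fun x => ?_
      have h4 : ‖H θ x‖ ≤ ‖H θ x - H θs x‖ + ‖H θs x‖ := by
        simpa using norm_add_le (H θ x - H θs x) (H θs x)
      have h5 := pow_le_pow_left₀ (norm_nonneg _) h4 2
      nlinarith [sq_nonneg (‖H θ x - H θs x‖ - ‖H θs x‖)]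
    have h4 : ‖θ - θs‖ ^ 2 ≤ 2 * ‖θ - θsn n‖ ^ 2 + 2 := by
      have h5 : ‖θ - θs‖ ≤ ‖θ - θsn n‖ + ‖θsn n - θs‖ := norm_sub_le_norm_sub_add_norm_sub _ _ _
      have h6 : ‖θ - θs‖ ≤ ‖θ - θsn n‖ + 1 := by linarith
      have h7 := pow_le_pow_left₀ (norm_nonneg _) h6 2
      nlinarith [sq_nonneg (‖θ - θsn n‖ - 1)]
    have h5 := mul_le_mul_of_nonneg_left h4 C.2
    have h6 : 0 ≤ (C : ℝ) * ‖θ - θsn n‖ ^ 2 := by positivity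
    have h7 : 0 ≤ (1 + |C'|) * ‖θ - θsn n‖ ^ 2 := by positivity
    change (C : ℝ) * _ ≤ (C : ℝ) * _ at h5
    linarith
  · rw [← meanField_eq_integral_map hH (hUn n)]
    exact hMR n θ

theorem covariance_close_of_innovationRegularity [IsProbabilityMeasure P] {U : Ω → Vec q}
    {Un : ℕ+ → Ω → Vec q} {θs : Vec d} (hH : Measurable (Function.uncurry H))
    (hUn : ∀ n, Measurable (Un n)) (hI : InnovationRegularity P H U Un θs)
    (hL2 : ∀ n θ, MemLp (H θ) 2 (P.map (Un n)))
    {ε : ℝ} (hε : 0 < ε) :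
    ∃ r > 0, ∀ᶠ n in atTop, ∀ θ, ‖θ - θs‖ < r → ∀ w,
      |(∫ x, (inner ℝ (H θ x) w) ^ 2 ∂(P.map (Un n))) - inner ℝ w
        (Matrix.toEuclideanCLM (n := Fin d) (𝕜 := ℝ) (secondMoment P H U θs) w)|
      ≤ ε * ‖w‖ ^ 2 := by
  obtain ⟨-, hloc, hcont, -⟩ := hI
  set ε' := ε / (d ^ 2 + 1) with hε'
  have hε'0 : 0 < ε' := by positivity
  have h1 : ∀ i j, ∀ᶠ z : ℕ+ × Vec d in atTop ×ˢ 𝓝 θs,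
      |secondMoment P H (Un z.1) z.2 i j - secondMoment P H U θs i j| ≤ ε' := by
    intro i j
    obtain ⟨t, ht, hn⟩ := Metric.tendstoLocallyUniformly_iff.1 (hloc i j) (ε' / 2) (by positivity)
      θs
    have hc : ∀ᶠ θ in 𝓝 θs,
        dist (secondMoment P H U θ i j) (secondMoment P H U θs i j) < ε' / 2 :=
      (hcont.matrix_elem i j).continuousAt.eventually (Metric.ball_mem_nhds _ (by positivity))
    filter_upwards [hn.prod_mk (hc.and (show ∀ᶠ θ in 𝓝 θs, θ ∈ t from ht))] with z hz
    have h2 := hz.1 z.2 hz.2.2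
    have h3 := hz.2.1
    rw [dist_comm] at h2
    have h4 := dist_triangle (secondMoment P H (Un z.1) z.2 i j) (secondMoment P H U z.2 i j)
      (secondMoment P H U θs i j)
    rw [← Real.dist_eq]
    linarith
  have h2 : ∀ᶠ z : ℕ+ × Vec d in atTop ×ˢ 𝓝 θs, ∀ i j,
      |secondMoment P H (Un z.1) z.2 i j - secondMoment P H U θs i j| ≤ ε' :=
    eventually_all.2 fun i => eventually_all.2 fun j => h1 i j
  obtain ⟨pa, hpa, pb, hpb, hab⟩ := eventually_prod_iff.1 h2
  obtain ⟨r, hr, hball⟩ := Metric.eventually_nhds_iff.1 hpb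
  refine ⟨r, hr, ?_⟩
  filter_upwards [hpa] with n hn θ hθ w
  have h3 := hab hn (hball (by rwa [dist_eq_norm] : dist θ θs < r))
  have hHm : Measurable (H θ) := hH.comp measurable_prodMk_left
  refine (abs_integral_inner_sq_sub_le (hL2 n θ) (ε := ε') (fun i j => ?_) w).trans ?_
  · have h4 : ∫ x, H θ x i * H θ x j ∂(P.map (Un n)) = secondMoment P H (Un n) θ i j := by
      have hc : ∀ k : Fin d, Measurable fun x => H θ x k := fun k =>
        (EuclideanSpace.proj (𝕜 := ℝ) k).continuous.measurable.comp hHm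
      exact integral_map (hUn n).aemeasurable (f := fun x => H θ x i * H θ x j)
        ((hc i).mul (hc j)).aestronglyMeasurable
    rw [h4]
    exact h3 i j
  · refine mul_le_mul_of_nonneg_right ?_ (sq_nonneg _)
    rw [hε', mul_div_assoc', div_le_iff₀ (by positivity)]
    nlinarith

theorem memLp_sub_const_of_lintegral_le [IsProbabilityMeasure P] {E : Type*} [NormedAddCommGroup E]
    {X : Ω → E} (hX : AEStronglyMeasurable X P) {C : ℝ≥0}
    (h : ∫⁻ ω, ‖X ω‖ₑ ^ (2 : ℝ) ∂P ≤ C) (a : E) :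
    MemLp (fun ω => X ω - a) 2 P ∧ ∫ ω, ‖X ω - a‖ ^ 2 ∂P ≤ 2 * C + 2 * ‖a‖ ^ 2 := by
  obtain ⟨h1, h2⟩ := integrable_rpow_norm_of_lintegral_le hX two_pos.le ENNReal.coe_ne_top h
  simp only [Real.rpow_two, ENNReal.coe_toReal] at h1 h2
  have hX2 : MemLp X 2 P := (memLp_two_iff_integrable_sq_norm hX).2 h1
  have hXa : MemLp (fun ω => X ω - a) 2 P := hX2.sub (memLp_const a)
  refine ⟨hXa, ?_⟩
  have h3 : ∫ ω, ‖X ω - a‖ ^ 2 ∂P ≤ ∫ ω, (2 * ‖X ω‖ ^ 2 + 2 * ‖a‖ ^ 2) ∂P := by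
    refine integral_mono (integrable_norm_sq_of_memLp hXa)
      ((h1.const_mul 2).add (integrable_const _)) fun ω => ?_
    have h4 := pow_le_pow_left₀ (norm_nonneg _) (norm_sub_le (X ω) a) 2
    simp only
    nlinarith [sq_nonneg (‖X ω‖ - ‖a‖)]
  rw [integral_add (h1.const_mul 2) (integrable_const _), integral_const_mul] at h3
  simp at h3
  linarith

end Assumptions

section Convergence

open Complex

theorem tendsto_of_tendsto_comp_succPNat {α : Type*} {l : Filter α} {f : ℕ+ → α}
    (h : Tendsto (fun k : ℕ => f k.succPNat) atTop l) : Tendsto f atTop l := by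
  have h1 : Tendsto (fun n : ℕ+ => (n : ℕ) - 1) atTop atTop :=
    (tendsto_sub_atTop_nat 1).comp tendsto_PNat_val_atTop_atTop
  refine (h.comp h1).congr fun n => ?_
  simp only [Function.comp_apply]
  congr 1
  exact PNat.succPNat_natPred n

theorem tendsto_succPNat : Tendsto Nat.succPNat atTop atTop :=
  tendsto_atTop_atTop.2 fun n => ⟨n, fun k hk => by
    rw [← PNat.coe_le_coe, Nat.succPNat_coe]; omega⟩

/-- A form of Lévy's continuity theorem along `ℕ+`. -/
theorem tendstoInDistribution_of_tendsto_charFun {d : ℕ} {Ω : Type*} [MeasurableSpace Ω]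
    {P : Measure Ω} [IsProbabilityMeasure P] {X : ℕ+ → Ω → Vec d} (hX : ∀ n, Measurable (X n))
    {μ : Measure (Vec d)} [IsProbabilityMeasure μ]
    (h : ∀ t : Vec d, Tendsto (fun n => ∫ ω, cexp ((inner ℝ (X n ω) t : ℝ) * I) ∂P) atTop
      (𝓝 (charFun μ t))) :
    TendstoInDistribution X atTop (id : Vec d → Vec d) (fun _ => P) μ where
  forall_aemeasurable n := (hX n).aemeasurable
  aemeasurable_limit := aemeasurable_id
  tendsto := by
    refine tendsto_of_tendsto_comp_succPNat ?_
    refine ProbabilityMeasure.tendsto_iff_tendsto_charFun.2 fun t => ?_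
    have h1 := (h t).comp tendsto_succPNat
    simp only [ProbabilityMeasure.coe_mk, Measure.map_id]
    refine h1.congr fun k => ?_
    simp only [Function.comp_apply]
    rw [charFun_apply, integral_map (hX _).aemeasurable]
    exact (Continuous.aestronglyMeasurable (by fun_prop))

end Convergence

/-! ### The limit law -/

section Gaussian

open Complex

variable {d : ℕ}

/-- Passage from the gauge to the normalization `a n`, with `a n ^ 2 * c (M n) → 1`, together with
a converging deterministic shift. -/
theorem tendsto_charFun_of_uniform {Ω : Type*} [MeasurableSpace Ω] {P : Measure Ω}
    {ι : Type*} {l : Filter ι} {c : ℕ → ℝ} (hc : ∀ p, 0 < c p)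
    {S : Vec d →L[ℝ] Vec d} {Z : ι → ℕ → Ω → Vec d}
    (hZ : ∀ R, 0 ≤ R → ∀ ε, 0 < ε → ∃ p₂ : ℕ, ∀ᶠ i in l, ∀ p ≥ p₂, ∀ u, ‖u‖ ≤ R →
      ‖(∫ ω, cexp ((inner ℝ (Z i p ω) ((√(c p))⁻¹ • u) : ℝ) * I) ∂P)
        - (Real.exp (-(inner ℝ u (S u) / 2)) : ℂ)‖ ≤ ε)
    {M : ι → ℕ} (hM : Tendsto M l atTop) {a : ι → ℝ}
    (haM : Tendsto (fun i => a i * √(c (M i))) l (𝓝 1)) {z : ι → Vec d} {m : Vec d}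
    (hz : Tendsto z l (𝓝 m)) (t : Vec d) :
    Tendsto (fun i => ∫ ω, cexp ((inner ℝ (a i • Z i (M i) ω + z i) t : ℝ) * I) ∂P) l
      (𝓝 (cexp ((inner ℝ t m : ℝ) * I - (inner ℝ t (S t) / 2 : ℝ)))) := by
  have hu : Tendsto (fun i => (a i * √(c (M i))) • t) l (𝓝 t) := by
    simpa using haM.smul_const t
  have h1 : Tendsto (fun i => (∫ ω, cexp ((inner ℝ (Z i (M i) ω) ((√(c (M i)))⁻¹ •
      ((a i * √(c (M i))) • t)) : ℝ) * I) ∂P)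
      - (Real.exp (-(inner ℝ ((a i * √(c (M i))) • t) (S ((a i * √(c (M i))) • t)) / 2)) : ℂ)) l
      (𝓝 0) := by
    rw [tendsto_zero_iff_norm_tendsto_zero, Metric.tendsto_nhds]
    intro ε hε
    obtain ⟨p₂, hp₂⟩ := hZ (‖t‖ + 1) (by positivity) (ε / 2) (by positivity)
    filter_upwards [hp₂, hM.eventually_ge_atTop p₂,
      hu.norm.eventually_lt_const (lt_add_one ‖t‖)] with i h1 h2 h3
    rw [dist_zero_right, norm_norm]
    exact (h1 _ h2 _ h3.le).trans_lt (by linarith)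
  have h2 : Tendsto (fun i => (Real.exp (-(inner ℝ ((a i * √(c (M i))) • t)
      (S ((a i * √(c (M i))) • t)) / 2)) : ℂ)) l
      (𝓝 (Real.exp (-(inner ℝ t (S t) / 2)) : ℂ)) := by
    have hcont : Continuous fun u : Vec d => (Real.exp (-(inner ℝ u (S u) / 2)) : ℂ) := by
      fun_prop
    exact (hcont.tendsto t).comp hu
  have h3 : Tendsto (fun i => cexp ((inner ℝ (z i) t : ℝ) * I)) l
      (𝓝 (cexp ((inner ℝ m t : ℝ) * I))) := by
    have hcont : Continuous fun u : Vec d => cexp ((inner ℝ u t : ℝ) * I) := by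
      fun_prop
    exact (hcont.tendsto m).comp hz
  have h4 := h3.mul (h1.add h2)
  have e1 : cexp ((inner ℝ m t : ℝ) * I) * (0 + (Real.exp (-(inner ℝ t (S t) / 2)) : ℂ))
      = cexp ((inner ℝ t m : ℝ) * I - (inner ℝ t (S t) / 2 : ℝ)) := by
    rw [zero_add, Complex.ofReal_exp, ← Complex.exp_add, real_inner_comm]
    congr 1
    push_cast
    ring
  rw [e1] at h4
  refine h4.congr fun i => ?_
  rw [sub_add_cancel, ← integral_const_mul]
  refine integral_congr_ae (ae_of_all _ fun ω => ?_)
  have hs := (Real.sqrt_pos.2 (hc (M i))).ne'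
  have e2 : (√(c (M i)))⁻¹ • ((a i * √(c (M i))) • t) = a i • t := by
    rw [smul_smul]
    congr 1
    field_simp
  simp only
  rw [e2, ← Complex.exp_add, inner_add_left, inner_smul_left, inner_smul_right]
  congr 1
  simp
  ring

theorem isUnit_of_coercive {A : Matrix (Fin d) (Fin d) ℝ} {lam : ℝ} (hlam : 0 < lam)
    (hA : ∀ v, lam * ‖v‖ ^ 2 ≤ inner ℝ v (Matrix.toEuclideanCLM (n := Fin d) (𝕜 := ℝ) A v)) :
    IsUnit A := by
  rw [← Matrix.mulVec_injective_iff_isUnit]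
  refine (injective_iff_map_eq_zero A.mulVecLin).2 fun x hx => ?_
  have h := hA (WithLp.toLp 2 x)
  rw [Matrix.toEuclideanCLM_toLp, show A.mulVec x = 0 from hx] at h
  simp only [WithLp.toLp_zero, inner_zero_right] at h
  have h2 : ‖(WithLp.toLp 2 x : Vec d)‖ = 0 := by
    by_contra h3
    have : 0 < ‖(WithLp.toLp 2 x : Vec d)‖ := lt_of_le_of_ne (norm_nonneg _) (Ne.symm h3)
    have : 0 < lam * ‖(WithLp.toLp 2 x : Vec d)‖ ^ 2 := by positivity
    linarith
  rw [norm_eq_zero] at h2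
  simpa using h2

theorem inner_toEuclideanCLM_transpose (B : Matrix (Fin d) (Fin d) ℝ) (x y : Vec d) :
    inner ℝ x (Matrix.toEuclideanCLM (n := Fin d) (𝕜 := ℝ) B.transpose y)
      = inner ℝ (Matrix.toEuclideanCLM (n := Fin d) (𝕜 := ℝ) B x) y := by
  rw [← Matrix.conjTranspose_eq_transpose_of_trivial, ← Matrix.star_eq_conjTranspose, map_star,
    ContinuousLinearMap.star_eq_adjoint, ContinuousLinearMap.adjoint_inner_right]

theorem adjoint_toEuclideanCLM (B : Matrix (Fin d) (Fin d) ℝ) :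
    (Matrix.toEuclideanCLM (n := Fin d) (𝕜 := ℝ) B).adjoint
      = Matrix.toEuclideanCLM (n := Fin d) (𝕜 := ℝ) B.transpose := by
  rw [← Matrix.conjTranspose_eq_transpose_of_trivial, ← Matrix.star_eq_conjTranspose, map_star,
    ContinuousLinearMap.star_eq_adjoint]

/-- The Lyapunov equation for `A - ζ` as an identity between quadratic forms. -/
theorem inner_lyapunov {A S G : Matrix (Fin d) (Fin d) ℝ} {ζ : ℝ}
    (hS : S.transpose = S)
    (h : (A - ζ • (1 : Matrix (Fin d) (Fin d) ℝ)) * S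
      + S * (A - ζ • (1 : Matrix (Fin d) (Fin d) ℝ)).transpose = G) (u : Vec d) :
    inner ℝ u (Matrix.toEuclideanCLM (n := Fin d) (𝕜 := ℝ) G u)
      = 2 * inner ℝ ((Matrix.toEuclideanCLM (n := Fin d) (𝕜 := ℝ) A).adjoint u)
          (Matrix.toEuclideanCLM (n := Fin d) (𝕜 := ℝ) S u)
        - 2 * ζ * inner ℝ u (Matrix.toEuclideanCLM (n := Fin d) (𝕜 := ℝ) S u) := by
  rw [adjoint_toEuclideanCLM, ← h]
  have h1 : (A - ζ • (1 : Matrix (Fin d) (Fin d) ℝ)).transpose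
      = A.transpose - ζ • (1 : Matrix (Fin d) (Fin d) ℝ) := by
    rw [Matrix.transpose_sub, Matrix.transpose_smul, Matrix.transpose_one]
  have h2 : ∀ x y : Vec d, inner ℝ x (Matrix.toEuclideanCLM (n := Fin d) (𝕜 := ℝ) S y)
      = inner ℝ (Matrix.toEuclideanCLM (n := Fin d) (𝕜 := ℝ) S x) y := fun x y => by
    conv_lhs => rw [← hS]
    exact inner_toEuclideanCLM_transpose S x y
  have h3 : inner ℝ u (Matrix.toEuclideanCLM (n := Fin d) (𝕜 := ℝ) A
      (Matrix.toEuclideanCLM (n := Fin d) (𝕜 := ℝ) S u))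
      = inner ℝ (Matrix.toEuclideanCLM (n := Fin d) (𝕜 := ℝ) A.transpose u)
        (Matrix.toEuclideanCLM (n := Fin d) (𝕜 := ℝ) S u) := by
    rw [← inner_toEuclideanCLM_transpose, Matrix.transpose_transpose]
  rw [h1]
  simp only [map_add, map_mul, map_sub, map_smul, map_one, add_apply,
    mul_apply_eq_comp, sub_apply, smul_apply,
    one_apply_eq_self, inner_add_right, inner_sub_right, inner_smul_right]
  rw [h3, h2 u (Matrix.toEuclideanCLM (n := Fin d) (𝕜 := ℝ) A.transpose u),
    real_inner_comm]
  ring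

end Gaussian

theorem theorem2p7 {d q : ℕ} {Ω : Type*} [MeasurableSpace Ω]
    (P : Measure Ω) [IsProbabilityMeasure P]
    -- the function `H`, the random vector `U` and its approximations `U^n`
    (H : Vec d → Vec q → Vec d) (hH : Measurable (Function.uncurry H))
    (U : Ω → Vec q) (hU : Measurable U)
    (Un : ℕ+ → Ω → Vec q) (hUn : ∀ n, Measurable (Un n))
    -- the zeros of `h` and `h^n`, and the mean-reverting assumption
    (θs : Vec d) (hθs : meanField P H U θs = 0)
    (hmr : MeanReverting (meanField P H U) θs)
    (θsn : ℕ+ → Vec d) (hθsn : ∀ n, meanField P H (Un n) (θsn n) = 0)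
    (hmrn : ∀ n, MeanReverting (meanField P H (Un n)) (θsn n))
    -- smoothness and convergence of `h^n` to `h`
    (hC1 : ContDiff ℝ 1 (meanField P H U))
    (hC2n : ∀ n, ContDiff ℝ 2 (meanField P H (Un n)))
    (hLip : ∃ K : ℝ≥0, ∀ n, LipschitzWith K (fderiv ℝ (meanField P H (Un n))))
    (hconv : TendstoLocallyUniformly (fun n : ℕ+ => meanField P H (Un n))
      (meanField P H U) atTop)
    (hDconv : TendstoLocallyUniformly (fun n : ℕ+ => fderiv ℝ (meanField P H (Un n)))
      (fderiv ℝ (meanField P H U)) atTop)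
    -- the standard weak error
    (α : ℝ) (hα : 0 < α) (E : Vec d → Vec d)
    (hE : ∀ θ, Tendsto (fun n : ℕ+ =>
      ((n : ℕ) : ℝ) ^ α • (meanField P H (Un n) θ - meanField P H U θ)) atTop (𝓝 (E θ)))
    -- local assumptions on `h` at `θ^*` and moments of `H(θ, U)`
    (hC2 : ContDiffAt ℝ 2 (meanField P H U) θs)
    (hstable : IsStableMatrix (jacobian (meanField P H U) θs))
    (hmom : LocallyBoundedMoment P H U)
    -- (HR), (HI), (HMR)
    (hR : HolderInMean P H Un)
    (hI : InnovationRegularity P H U Un θs)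
    (lam : ℝ) (hlam : 0 < lam)
    (hMR : ∀ (n : ℕ+) (θ : Vec d),
      lam * ‖θ - θsn n‖ ^ 2 ≤ inner ℝ (θ - θsn n) (meanField P H (Un n) θ))
    -- the step function
    (γ : ℝ → ℝ) (hγpos : ∀ t, 0 ≤ t → 0 < γ t) (hγanti : AntitoneOn γ (Ici 0))
    (hγlim : Tendsto γ atTop (𝓝 0))
    (hγsum : ¬ Summable (fun p : ℕ => γ ((p : ℝ) + 1)))
    (hγsq : Summable (fun p : ℕ => γ ((p : ℝ) + 1) ^ 2))
    (ζ : ℝ)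
    (hS : (RegularlyVaryingStep γ ∧ ζ = 0) ∨
      (∃ γ₀ : ℝ, HarmonicStep γ lam γ₀ ∧ ζ = 1 / (2 * γ₀)))
    -- initial conditions and i.i.d. innovations with the law of `U^n`
    (θ₀ : ℕ+ → Ω → Vec d) (hθ₀ : ∀ n, Measurable (θ₀ n))
    (hθ₀mom : ∃ C : ℝ≥0, ∀ n, ∫⁻ ω, ‖θ₀ n ω‖ₑ ^ (2 : ℝ) ∂P ≤ C)
    (ξ : ℕ+ → ℕ → Ω → Vec q) (hξ : ∀ n p, Measurable (ξ n p))
    (hξlaw : ∀ n p, IdentDistrib (ξ n p) (Un n) P P)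
    (hξindep : ∀ n, iIndepFun (ξ n) P)
    (hξθ₀ : ∀ n, IndepFun (θ₀ n) (fun ω p => ξ n p ω) P)
    -- the number of steps: `γ⁻¹(1 / n^{2α})` rounded to an adjacent integer
    (M : ℕ+ → ℕ)
    (hM : ∀ n : ℕ+, |(M n : ℝ) - stepInverse γ (1 / ((n : ℕ) : ℝ) ^ (2 * α))| < 1) :
    let A := jacobian (meanField P H U) θs
    let B := A - ζ • (1 : Matrix (Fin d) (Fin d) ℝ)
    let Γ := secondMoment P H U θs
    -- the integral defining `Σ^*` converges, `Σ^*` is positive definite, and it is the unique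
    -- solution of the Lyapunov equation
    (∀ i j, IntegrableOn (fun s => covIntegrand B Γ s i j) (Ioi 0)) ∧
    (asymptoticCov B Γ).PosDef ∧
    (∀ S : Matrix (Fin d) (Fin d) ℝ,
      Γ - B * S - S * B.transpose = 0 ↔ S = asymptoticCov B Γ) ∧
    -- the central limit theorem; the derivative at `θ^*` is invertible
    IsUnit A ∧
    TendstoInDistribution
      (fun (n : ℕ+) ω => ((n : ℕ) : ℝ) ^ α • (saScheme γ H (θ₀ n) (ξ n) (M n) ω - θs))
      atTop (id : Vec d → Vec d) (fun _ => P)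
      (multivariateGaussian (-(Matrix.toEuclideanCLM (n := Fin d) (𝕜 := ℝ) A⁻¹ (E θs)))
        (asymptoticCov B Γ)) := by
  classical
  intro A B Γ
  obtain ⟨K, hK⟩ := hLip
  have hprob : ∀ n, IsProbabilityMeasure (P.map (Un n)) :=
    fun n => Measure.isProbabilityMeasure_map (hUn n).aemeasurable
  have hmf : ∀ n θ, meanField P H (Un n) θ = ∫ x, H θ x ∂(P.map (Un n)) :=
    fun n θ => meanField_eq_integral_map hH (hUn n) θ
  let T := Matrix.toEuclideanCLM (n := Fin d) (𝕜 := ℝ)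
  have hTA : T A = fderiv ℝ (meanField P H U) θs := by simp [T, A, jacobian]
  -- the zeros of the approximations converge
  have hf0 : Tendsto (fun n => meanField P H (Un n) θs) atTop (𝓝 0) := by
    have h := hconv.tendsto_comp (hC1.continuous.continuousAt) (tendsto_const_nhds (x := θs))
    rwa [hθs] at h
  have hθ : Tendsto θsn atTop (𝓝 θs) := by
    rw [tendsto_iff_norm_sub_tendsto_zero]
    have h1 := hf0.norm.div_const lam
    rw [norm_zero, zero_div] at h1
    refine squeeze_zero (fun n => norm_nonneg _) (fun n => ?_) h1
    rw [le_div_iff₀ hlam, norm_sub_rev, mul_comm]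
    exact norm_sub_le_of_reverting (hMR n) θs
  -- linearization of the mean fields
  set e : ℕ+ → ℝ := fun n => ‖fderiv ℝ (meanField P H (Un n)) (θsn n) - T A‖ with he_def
  have he : Tendsto e atTop (𝓝 0) := by
    have h := hDconv.tendsto_comp ((hC1.continuous_fderiv one_ne_zero).continuousAt) hθ
    have h2 := (h.sub_const (T A)).norm
    rwa [← hTA, sub_self, norm_zero] at h2
  have hlin : ∀ n θ, ‖meanField P H (Un n) θ - T A (θ - θsn n)‖
      ≤ K * ‖θ - θsn n‖ ^ 2 + e n * ‖θ - θsn n‖ := fun n θ =>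
    norm_sub_fderiv_apply_le ((hC2n n).differentiable two_ne_zero) (hK n) (hθsn n) (T A) θ
  have hA : ∀ v, lam * ‖v‖ ^ 2 ≤ inner ℝ v (T A v) := coercive_of_reverting he hMR hlin
  have hAunit : IsUnit A := isUnit_of_coercive hlam hA
  -- the gauge
  obtain ⟨hζ, c, hc⟩ : ζ < lam ∧ ∃ c : ℕ → ℝ, IsStepGauge (fun p => γ ((p : ℝ) + 1)) c ζ := by
    rcases hS with ⟨⟨a, -, ha1, hrv⟩, rfl⟩ | ⟨γ₀, hharm, rfl⟩
    · exact ⟨hlam, _, isStepGauge_of_regularlyVarying ha1 hγpos hγanti hγlim hγsum hrv⟩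
    · refine ⟨?_, _, isStepGauge_of_harmonicStep hγpos hγlim hγsum hharm⟩
      obtain ⟨h1, -, h2⟩ := hharm
      rw [div_lt_iff₀ (by positivity)]
      linarith
  -- the Lyapunov equation
  have hμ : 0 < lam - ζ := sub_pos.2 hζ
  have hB : ∀ x, (lam - ζ) * ‖x‖ ^ 2 ≤ inner ℝ x (T B x) := by
    intro x
    have h1 : T B x = T A x - ζ • x := by simp [B, T]
    rw [h1, inner_sub_right, inner_smul_right, real_inner_self_eq_norm_sq]
    linarith [hA x]
  have hΓ : Γ.PosDef := hI.2.2.2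
  have hCov : (asymptoticCov B Γ).PosDef := posDef_asymptoticCov hμ hB hΓ
  refine ⟨integrableOn_covIntegrand hμ hB Γ, hCov, lyapunov_iff hμ hB Γ, hAunit, ?_⟩
  have hnonneg : ∀ {M : Matrix (Fin d) (Fin d) ℝ}, M.PosDef → ∀ w, 0 ≤ inner ℝ w (T M w) := by
    intro M hM w
    rw [Matrix.inner_toEuclideanCLM]
    simpa using hM.posSemidef.dotProduct_mulVec_nonneg w.ofLp
  have hCovT : (asymptoticCov B Γ).transpose = asymptoticCov B Γ := by
    rw [← Matrix.conjTranspose_eq_transpose_of_trivial]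
    exact hCov.1
  have hCovSymm : ∀ x y,
      inner ℝ x (T (asymptoticCov B Γ) y) = inner ℝ y (T (asymptoticCov B Γ) x) := by
    intro x y
    rw [real_inner_comm (T (asymptoticCov B Γ) x) y, ← inner_toEuclideanCLM_transpose, hCovT]
  -- moments of the innovations and of the initial values
  obtain ⟨δ, hδ, hmomn⟩ := exists_moment_bound_of_innovationRegularity hH hUn hI
  have hL2 : ∀ n θ, MemLp (H θ) 2 (P.map (Un n)) := by
    intro n θ
    obtain ⟨C, hC⟩ := hmomn (‖θ‖ + 1) (by positivity)
    exact memLp_two_of_integrable_rpow (hH.comp measurable_prodMk_left).aestronglyMeasurable hδ.le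
      (hC n θ (by linarith)).1
  obtain ⟨L, hL, hadm⟩ := exists_isAdmissible hH hUn hR hδ hmomn hθ hMR
  obtain ⟨C₀, hC₀⟩ := hθ₀mom
  have h0 := fun n => memLp_sub_const_of_lintegral_le (hθ₀ n).aestronglyMeasurable (hC₀ n) (θsn n)
  have hY : ∀ᶠ n in atTop, ∫ ω, ‖θ₀ n ω - θsn n‖ ^ 2 ∂P ≤ 2 * C₀ + 2 * (‖θs‖ + 1) ^ 2 := by
    filter_upwards [hθ.norm.eventually_lt_const (lt_add_one ‖θs‖)] with n hn
    refine (h0 n).2.trans ?_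
    have := pow_le_pow_left₀ (norm_nonneg _) hn.le 2
    linarith
  have hexp := fun η hη => eventually_norm_charFun_innovation_le (η := η) hprob hθ hL hδ (T Γ) hadm
    hmomn (fun ε hε => covariance_close_of_innovationRegularity hH hUn hI hL2 hε) hη
  -- convergence of the characteristic functions of the normalized errors
  have hZ := fun R hR ε hε => saScheme_charFun_tendsto (P := P) (H := H) (γ := γ) (c := c)
    (R := R) (ε := ε) hc hlam hζ hL hA (hnonneg hΓ) (hnonneg hCov) hCovSymm
    (inner_lyapunov hCovT (lyapunov_asymptoticCov hμ hB Γ)) hadm K.2 (fun n => norm_nonneg _) he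
    (fun n θ => by rw [← hmf]; exact hlin n θ) hexp hθ₀ hξ (fun n p => (hξlaw n p).map_eq) hξindep
    hξθ₀ (fun n => (h0 n).1) (by positivity) hY hR hε
  -- the number of steps
  have hnα : Tendsto (fun n : ℕ+ => ((n : ℕ) : ℝ) ^ (2 * α)) atTop atTop :=
    (tendsto_rpow_atTop (by positivity)).comp
      (tendsto_natCast_atTop_atTop.comp tendsto_PNat_val_atTop_atTop)
  have hnpos : ∀ n : ℕ+, (0 : ℝ) < ((n : ℕ) : ℝ) := fun n => by exact_mod_cast n.pos
  obtain ⟨hMtop, hcM⟩ := tendsto_gauge_div_of_stepInverse hγpos hγanti hγlim hc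
    (y := fun n : ℕ+ => 1 / ((n : ℕ) : ℝ) ^ (2 * α))
    (fun n => by have := hnpos n; positivity) (tendsto_const_nhds.div_atTop hnα) hM
  have haM : Tendsto (fun n : ℕ+ => ((n : ℕ) : ℝ) ^ α * √(c (M n))) atTop (𝓝 1) := by
    have h1 := hcM.sqrt
    rw [Real.sqrt_one] at h1
    refine h1.congr fun n => ?_
    have h2 : ((n : ℕ) : ℝ) ^ (2 * α) = (((n : ℕ) : ℝ) ^ α) ^ 2 := by
      rw [mul_comm, Real.rpow_mul (hnpos n).le, Real.rpow_two]
    rw [h2, div_div_eq_mul_div, div_one, mul_comm, Real.sqrt_mul (sq_nonneg _),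
      Real.sqrt_sq (by have := hnpos n; positivity)]
  -- the bias
  have hbias : Tendsto (fun n : ℕ+ => ((n : ℕ) : ℝ) ^ α • (θsn n - θs)) atTop
      (𝓝 (-(T A⁻¹ (E θs)))) := by
    have hb := hE θs
    simp only [hθs, sub_zero] at hb
    have h1 := tendsto_smul_clm_sub_of_linearization (a := fun n : ℕ+ => ((n : ℕ) : ℝ) ^ α) hlam he
      (fun n => by have := hnpos n; positivity) hθ hMR hlin hb
    have h2 := (((T A⁻¹).continuous.tendsto _).comp h1).neg
    refine h2.congr fun n => ?_
    have h3 : ∀ v, T A⁻¹ (T A v) = v := fun v => by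
      rw [← mul_apply_eq_comp, ← map_mul,
        Matrix.nonsing_inv_mul _ ((Matrix.isUnit_iff_isUnit_det A).1 hAunit), map_one,
        one_apply_eq_self]
    simp only [Function.comp_apply]
    rw [h3, ← smul_neg, neg_sub]
  refine tendstoInDistribution_of_tendsto_charFun (fun n => ?_) fun t => ?_
  · have h1 := (measurable_saScheme (γ := γ) hH (hθ₀ n) (hξ n) (M n)).sub_const θs
    exact h1.const_smul (((n : ℕ) : ℝ) ^ α)
  · have h1 := tendsto_charFun_of_uniform (P := P) hc.gauge_pos hZ hMtop haM hbias t
    rw [charFun_multivariateGaussian hCov.posSemidef, ← Matrix.inner_toEuclideanCLM]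
    push_cast at h1
    refine h1.congr fun n => ?_
    refine integral_congr_ae (ae_of_all _ fun ω => ?_)
    simp only
    rw [← smul_add, sub_add_sub_cancel]
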